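/- Let $M\ge 1$ be an integer and let $p_1,\dots,p_A\in(0,1)$ with $\sum_{j=1}^A p_j=1$ and $\sum_{j=1}^A p_j^2<1/M$. Let $\rho$ be the unique real number with $\sum_{j=1}^A p_j^{\rho}=1/M$. Assume that $\rho>1$ and that the $p_j$ are not all equal to $1/A$. Consider $n$ random labelings of the edges of the rooted infinite $M$-ary tree by letters from an alphabet of size $A$, where all labels (within a labeling and in different labelings) are independent and equal to the $j$-th letter with probability $p_j$. The G-trie built from these labelings consists of all pairs of a finite path in the $M$-ary tree that starts at the root (including the empty path) and a word of letters such that the path carries this word in at least two of the $n$ labelings. Let $S_n$ be its size, i.e., the number of these pairs, and let $A_n^{(m)}=\mathbb{E}\big((S_n-\mathbb{E}S_n)^m\big)$ be its central moments. Set \[ P(s)=1-M\sum_{j=1}^{A}p_j^{s},\qquad \mathcal{S}_\rho=\{s\in\mathbb{C}: P(s)=0,\ \Re(s)=\rho\},\qquad G_E(s)=\frac{(1-s)\Gamma(-s)}{M\sum_{j=1}^{A}p_j^{s}\log p_j}, \] \[ c=\frac{M-1}{M\,P(2\rho-1)}-1 , \] and let $g_m$ be the $m$-th moment of the standard normal distribution.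 Then $S_n$ is almost surely finite and has finite moments of all orders, $c>0$, the series $\sum_{\beta\in\mathcal{S}_\rho}\beta G_E(\beta)n^{\beta-1}$ converges absolutely for every $n\ge 1$, and for every integer $m\ge 0$, as $n\to\infty$, \[ A_n^{(m)}\sim g_m\,c^{m/2}\Big(\sum_{\beta\in\mathcal{S}_\rho}\beta G_E(\beta)n^{\beta-1}\Big)^{m}n^{m/2}. \] Here $a_n\sim g\,b_n$ means $a_n=g\,b_n+o(b_n)$; thus, for odd $m$, where $g_m=0$, the claim is $A_n^{(m)}=o\Big(c^{m/2}\big(\sum_{\beta\in\mathcal{S}_\rho}\beta G_E(\beta)n^{\beta-1}\big)^{m}n^{m/2}\Big)$. In particular ($m=2$), $\mathrm{Var}(S_n)\sim c\,\big(\sum_{\beta\in\mathcal{S}_\rho}\beta G_E(\beta)n^{\beta-1}\big)^2n$. -/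

import Mathlib

open MeasureTheory ProbabilityTheory Filter Asymptotics

noncomputable section

namespace GTrie

/-- The edges of the rooted infinite `M`-ary tree. The nodes of the tree are the finite words over
`Fin M`; the pair `(v, i)` is the edge which joins the node `v` to its `i`-th child `v ++ [i]`. -/
abbrev Edge (M : ℕ) : Type := List (Fin M) × Fin M

/-- An edge labeling of the rooted infinite `M`-ary tree by an alphabet with `A` letters. -/
abbrev Labeling (M A : ℕ) : Type := Edge M → Fin A

/-- The labeling which `L` induces on the `i`-th subtree of the root. -/
def Labeling.subtree {M A : ℕ} (L : Labeling M A) (i : Fin M) : Labeling M A :=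
  fun e => L (i :: e.1, e.2)

/-- The word of letters read along the path that leads from the root to the node `w`. -/
def pathLabels {M A : ℕ} : Labeling M A → List (Fin M) → List (Fin A)
  | _, [] => []
  | L, i :: w => L ([], i) :: pathLabels (L.subtree i) w

/-- A node of the rooted infinite `M * A`-ary tree is a path in the `M`-ary tree together with a
letter for each of its edges. It occurs in `L` if `L` puts exactly these letters on the path. -/
def Occurs {M A : ℕ} (L : Labeling M A) (x : List (Fin M × Fin A)) : Prop :=
  pathLabels L (x.map Prod.fst) = x.map Prod.snd

/-- The set of (internal) nodes of the G-trie built from the `n` labelings `L 0, …, L (n - 1)`: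
the nodes of the `M * A`-ary tree which occur in at least two of the labelings. -/
def nodes {M A n : ℕ} (L : Fin n → Labeling M A) : Set (List (Fin M × Fin A)) :=
  {x | ∃ k l : Fin n, k ≠ l ∧ Occurs (L k) x ∧ Occurs (L l) x}

/-- The nodes of the random G-trie built from the first `n` of the random labelings `X 0, X 1, …`
(where `X k e ω` is the letter on the edge `e` in the `k`-th labeling). -/
def randomNodes {M A : ℕ} {Ω : Type*} (X : ℕ → Edge M → Ω → Fin A) (n : ℕ) (ω : Ω) :
    Set (List (Fin M × Fin A)) :=
  nodes (fun (k : Fin n) (e : Edge M) => X k e ω)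

/-- The size `S_n` of the random G-trie, i.e., its number of (internal) nodes. -/
def size {M A : ℕ} {Ω : Type*} (X : ℕ → Edge M → Ω → Fin A) (n : ℕ) (ω : Ω) : ℝ :=
  ((randomNodes X n ω).ncard : ℝ)

/-- The function `P(s) = 1 - M ∑ p_j ^ s` of a complex variable. -/
def P (M : ℕ) {A : ℕ} (p : Fin A → ℝ) (s : ℂ) : ℂ :=
  1 - (M : ℂ) * ∑ j, (p j : ℂ) ^ s

/-- The function `P` on the real line, as a real number. -/
def realP (M : ℕ) {A : ℕ} (p : Fin A → ℝ) (x : ℝ) : ℝ :=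
  1 - (M : ℝ) * ∑ j, p j ^ x

theorem ofReal_realP (M : ℕ) {A : ℕ} (p : Fin A → ℝ) (hp : ∀ j, 0 < p j) (x : ℝ) :
    ((realP M p x : ℝ) : ℂ) = P M p (x : ℂ) := by
  simp [realP, P, Complex.ofReal_cpow (hp _).le]

/-- The set of the zeros of `P` on the line `Re s = ρ`. -/
def zeros (M : ℕ) {A : ℕ} (p : Fin A → ℝ) (ρ : ℝ) : Set ℂ :=
  {s | P M p s = 0 ∧ s.re = ρ}

/-- `G_E(s) = (1 - s) Γ(-s) / (M ∑ p_j ^ s log p_j)`. -/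
def GE (M : ℕ) {A : ℕ} (p : Fin A → ℝ) (s : ℂ) : ℂ :=
  (1 - s) * Complex.Gamma (-s) / ((M : ℂ) * ∑ j, (p j : ℂ) ^ s * (Real.log (p j) : ℂ))

/-- The term `β G_E(β) n ^ (β - 1)`. -/
def meanDerivTerm (M : ℕ) {A : ℕ} (p : Fin A → ℝ) (n : ℕ) (β : ℂ) : ℂ :=
  β * GE M p β * (n : ℂ) ^ (β - 1)

/-- The series `∑ β G_E(β) n ^ (β - 1)` over the zeros `β` of `P` on the line `Re s = ρ`. -/
def meanDeriv (M : ℕ) {A : ℕ} (p : Fin A → ℝ) (ρ : ℝ) (n : ℕ) : ℂ :=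
  ∑' β : zeros M p ρ, meanDerivTerm M p n (β : ℂ)

/-- The constant `c = (M - 1) / (M P(2ρ - 1)) - 1`. -/
def varConst (M : ℕ) {A : ℕ} (p : Fin A → ℝ) (ρ : ℝ) : ℝ :=
  ((M : ℝ) - 1) / ((M : ℝ) * realP M p (2 * ρ - 1)) - 1

/-- The `m`-th moment of the standard normal distribution. -/
def normalMoment (m : ℕ) : ℝ :=
  ∫ x, x ^ m ∂(gaussianReal 0 1)

/-- `c ^ (m / 2) (∑ β G_E(β) n ^ (β - 1)) ^ m n ^ (m / 2)`. -/
def momentScale (M : ℕ) {A : ℕ} (p : Fin A → ℝ) (ρ : ℝ) (m n : ℕ) : ℂ :=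
  ((varConst M p ρ ^ ((m : ℝ) / 2) : ℝ) : ℂ) * meanDeriv M p ρ n ^ m *
    (((n : ℝ) ^ ((m : ℝ) / 2) : ℝ) : ℂ)

end GTrie

end

noncomputable section

open scoped ENNReal NNReal Topology FourierTransform

set_option linter.unusedSectionVars false

/-! The proof is a contraction (method of moments) argument based on splitting the trie at the root.
Given the labels on the edges at the root, the size is one plus a sum of independent sizes of
subtries, one for each pair of a child and a letter. Hence each central moment satisfies a
recurrence whose inhomogeneity contains lower moments and the toll, the conditional mean of the size
minus its mean (`IsModel.exists_centered`). Before anything can be subtracted, finiteness of all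
moments is needed; it is obtained from the same splitting applied to truncated sizes, because the
expected number of subtries that receive all `n` labelings is `M ∑ p_j ^ n < 1`.

The toll is governed by the increments of the mean. The mean is a sum over words of the probability
that a word occurs at least twice, so its increments are explicit, and after division by `n ^ (ρ -
1)` they are within `O(1/n)` of `renewal`, the bounded solution of a renewal equation with step
probabilities `M p_j ^ ρ`. A convexity argument (`IsParam.tendsto_sqIncr`) shows that this solution
becomes invariant under `y ↦ y * p j`. Integrating or summing the renewal equation then identifies
its limit when the `log p_j` generate a dense group, and its limiting periodic function when they
generate a lattice. Poisson summation rewrites the periodic function as a Fourier series with Gamma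
coefficients, and its frequencies are exactly the zeros of `P` on `Re s = ρ`; this is the series
`meanDeriv` (`IsParam.exists_meanDeriv`).

Slow variation of the increments makes the toll asymptotically linear in the root counts
(`IsTrie.lpEquiv_toll`), hence a normalized sum of centered independent variables, with Gaussian
limiting moments. With `d_n` the increment of the mean and variance ansatz `c d_n ^ 2 n`, the
subtries contribute `q c` with `q = M ∑ p_j ^ (2ρ - 1)`, the toll contributes `q - 1/M`, and `c = q
c + (q - 1/M)` determines `c`. Since Gaussian moments are stable under convolution, they solve the
moment recurrence up to an error `o(n ^ (m (ρ - 1/2)))`. For `m ≥ 2` this exponent exceeds `ρ`, so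
the recurrence is contracting at this order and `IsTrie.transfer` shows that the true moment has the
same asymptotics; the argument is an induction on `m`. -/

namespace GTrie

/-! ### Independence of blocks of independent variables -/

section Blocks

variable {Ω ι : Type*} [MeasurableSpace Ω] {μ : Measure Ω}

/-- The blocks of a family of independent random variables are independent. -/
theorem iIndepFun_sigma_curry {κ : ι → Type*} {𝓧 : (i : ι) → κ i → Type*}
    [∀ i j, MeasurableSpace (𝓧 i j)] {X : (i : ι) → (j : κ i) → Ω → 𝓧 i j}
    (mX : ∀ i j, Measurable (X i j))
    (h : iIndepFun (fun (p : (i : ι) × κ i) ω => X p.1 p.2 ω) μ) :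
    iIndepFun (fun i ω => (X i · ω)) μ := by
  have := h.isProbabilityMeasure
  have : ∀ i j, IsProbabilityMeasure (μ.map (X i j)) :=
    fun i j => Measure.isProbabilityMeasure_map (mX i j).aemeasurable
  have h2 : ∀ i, iIndepFun (X i) μ := fun i =>
    h.precomp (g := fun j : κ i => (⟨i, j⟩ : (i : ι) × κ i)) (by
      intro a b hab
      simpa using hab)
  rw [iIndepFun_iff_map_fun_eq_infinitePi_map (by fun_prop)]
  have e1 : (fun ω i j => X i j ω) =
      (MeasurableEquiv.piCurry 𝓧) ∘ (fun ω p => X p.1 p.2 ω) := by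
    ext; simp [Sigma.curry]
  rw [e1, ← Measure.map_map (by fun_prop) (by fun_prop),
    (iIndepFun_iff_map_fun_eq_infinitePi_map (by fun_prop)).1 h,
    Measure.infinitePi_map_piCurry (fun i j => μ.map (X i j))]
  congrm Measure.infinitePi fun i => ?_
  rw [(iIndepFun_iff_map_fun_eq_infinitePi_map (by fun_prop)).1 (h2 i)]

end Blocks

/-! ### Combinatorial splitting of the trie at the root -/

section Tree

variable {M A n : ℕ}

@[simp] theorem occurs_nil (L : Labeling M A) : Occurs L [] := by simp [Occurs, pathLabels]

@[simp] theorem occurs_cons (L : Labeling M A) (a : Fin M × Fin A) (x : List (Fin M × Fin A)) :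
    Occurs L (a :: x) ↔ L ([], a.1) = a.2 ∧ Occurs (L.subtree a.1) x := by
  simp [Occurs, pathLabels]

/-- The number of nodes of the G-trie as an extended nonnegative real number. -/
def esize (L : Fin n → Labeling M A) : ℝ≥0∞ :=
  ∑' x : List (Fin M × Fin A), (nodes L).indicator 1 x

theorem esize_eq_encard (L : Fin n → Labeling M A) :
    esize L = ((nodes L).encard : ℝ≥0∞) := by
  rw [esize, ← tsum_subtype]
  exact ENNReal.tsum_set_one _

/-- `ncard` and `toReal` both send the infinite value to zero, so no finiteness hypothesis is needed
here. -/
theorem toReal_esize (L : Fin n → Labeling M A) :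
    (esize L).toReal = ((nodes L).ncard : ℝ) := by
  rw [esize_eq_encard, Set.ncard]
  cases h : (nodes L).encard <;> simp

theorem finite_of_esize_ne_top (L : Fin n → Labeling M A) (h : esize L ≠ ⊤) :
    (nodes L).Finite := by
  rw [esize_eq_encard] at h
  rw [← Set.encard_ne_top_iff]
  intro h'
  simp [h'] at h

theorem esize_of_lt_two (L : Fin n → Labeling M A) (h : n < 2) : esize L = 0 := by
  have : nodes L = ∅ := by
    ext x
    simp only [nodes, Set.mem_ofPred_eq, Set.mem_empty_iff_false, iff_false]
    rintro ⟨k, l, hkl, -⟩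
    exact hkl (Fin.ext (by omega))
  simp [esize, this]

theorem measurableSet_occurs (x : List (Fin M × Fin A)) :
    MeasurableSet {L : Labeling M A | Occurs L x} := by
  induction x with
  | nil => simp
  | cons a x ih =>
    simp only [occurs_cons]
    refine MeasurableSet.inter ?_ ?_
    · have : Measurable fun L : Labeling M A => L ([], a.1) := measurable_pi_apply _
      exact this (MeasurableSet.singleton a.2)
    · have : Measurable (fun L : Labeling M A => L.subtree a.1) := by
        unfold Labeling.subtree
        fun_prop
      exact this ih

theorem measurable_esize : Measurable (esize : (Fin n → Labeling M A) → ℝ≥0∞) := by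
  unfold esize
  refine Measurable.tsum fun x => ?_
  have : (fun L : Fin n → Labeling M A => (nodes L).indicator (1 : List (Fin M × Fin A) → ℝ≥0∞) x) =
      {L | x ∈ nodes L}.indicator 1 := by
    ext L
    simp [Set.indicator]
  rw [this]
  refine measurable_one.indicator ?_
  simp only [nodes, Set.mem_ofPred_eq]
  refine measurableSet_setOfPred.2 ?_
  refine Measurable.exists fun k => Measurable.exists fun l => ?_
  refine Measurable.and measurable_const (Measurable.and ?_ ?_)
  · exact (measurableSet_setOfPred.1 (measurableSet_occurs x)).comp (measurable_pi_apply k)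
  · exact (measurableSet_setOfPred.1 (measurableSet_occurs x)).comp (measurable_pi_apply l)

/-- The labelings which have the letter `a.2` on the edge from the root to its child `a.1`. -/
def fiber (r : Fin n → Fin M → Fin A) (a : Fin M × Fin A) : Finset (Fin n) :=
  Finset.univ.filter fun k => r k a.1 = a.2

@[simp] theorem mem_fiber (r : Fin n → Fin M → Fin A) (a : Fin M × Fin A) (k : Fin n) :
    k ∈ fiber r a ↔ r k a.1 = a.2 := by simp [fiber]

/-- The number of labelings with the letter `a.2` on the edge from the root to its child `a.1`. -/
def rootCount (r : Fin n → Fin M → Fin A) (a : Fin M × Fin A) : ℕ := (fiber r a).card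

/-- The labelings of the subtree `a.1` which have the letter `a.2` above the root. -/
def subLabelings (L : Fin n → Labeling M A) (r : Fin n → Fin M → Fin A) (a : Fin M × Fin A) :
    Fin (rootCount r a) → Labeling M A :=
  fun k => (L ((fiber r a).orderEmbOfFin rfl k)).subtree a.1

/-- A word that starts with `a` can only occur in a labeling from `fiber r a`, and `orderEmbOfFin`
renumbers these labelings injectively. The root labels `r` are an argument of their own, tied to `L`
only by `hr`: the index type of `subLabelings` depends on them, and later `r` is frozen while `L` is
random. -/
theorem cons_mem_nodes (L : Fin n → Labeling M A) (r : Fin n → Fin M → Fin A)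
    (hr : ∀ k i, L k ([], i) = r k i) (a : Fin M × Fin A) (x : List (Fin M × Fin A)) :
    a :: x ∈ nodes L ↔ x ∈ nodes (subLabelings L r a) := by
  have key : ∀ k, k ∈ fiber r a ↔
      ∃ k' : Fin (rootCount r a), (fiber r a).orderEmbOfFin rfl k' = k := by
    intro k
    have := Finset.range_orderEmbOfFin (fiber r a) rfl
    rw [← Finset.mem_coe, ← this]
    rfl
  simp only [nodes, Set.mem_ofPred_eq, occurs_cons, hr, subLabelings]
  constructor
  · rintro ⟨k, l, hkl, ⟨hk, hk'⟩, hl, hl'⟩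
    obtain ⟨k', rfl⟩ := (key k).1 (by simp [fiber, hk])
    obtain ⟨l', rfl⟩ := (key l).1 (by simp [fiber, hl])
    exact ⟨k', l', fun h => hkl (by rw [h]), hk', hl'⟩
  · rintro ⟨k, l, hkl, hk, hl⟩
    refine ⟨_, _, fun h => hkl ?_, ⟨?_, hk⟩, ?_, hl⟩
    · exact (Finset.orderEmbOfFin _ rfl).injective h
    · have := (key _).2 ⟨k, rfl⟩
      simpa [fiber] using this
    · have := (key _).2 ⟨l, rfl⟩
      simpa [fiber] using this

theorem ennreal_tsum_list {α : Type*} (F : List α → ℝ≥0∞) :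
    ∑' x, F x = F [] + ∑' a, ∑' x, F (a :: x) := by
  let e : Unit ⊕ (α × List α) ≃ List α :=
    { toFun := Sum.elim (fun _ => []) (fun q => q.1 :: q.2)
      invFun := fun x => match x with
        | [] => Sum.inl ()
        | a :: x => Sum.inr (a, x)
      left_inv := by rintro (⟨⟩ | ⟨a, x⟩) <;> rfl
      right_inv := by rintro (_ | ⟨a, x⟩) <;> rfl }
  rw [← e.tsum_eq, ENNReal.summable.tsum_sum ENNReal.summable, ENNReal.tsum_prod']
  simp [e]

theorem esize_eq_one_add (hn : 2 ≤ n) (L : Fin n → Labeling M A) (r : Fin n → Fin M → Fin A)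
    (hr : ∀ k i, L k ([], i) = r k i) :
    esize L = 1 + ∑ a, esize (subLabelings L r a) := by
  rw [esize, ennreal_tsum_list, tsum_fintype]
  congr 1
  · have : [] ∈ nodes L :=
      ⟨⟨0, by omega⟩, ⟨1, by omega⟩, by simp, occurs_nil _, occurs_nil _⟩
    simp [this]
  · refine Finset.sum_congr rfl fun a _ => ?_
    refine tsum_congr fun x => ?_
    by_cases h : a :: x ∈ nodes L
    · simp [h, (cons_mem_nodes L r hr a x).1 h]
    · simp [h, mt (cons_mem_nodes L r hr a x).2 h]

end Tree

/-! ### Law and independence of the subtries -/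

variable {M A : ℕ} {p : Fin A → ℝ} {Ω : Type*} [MeasurableSpace Ω] {μ : Measure Ω}
  [IsProbabilityMeasure μ] {X : ℕ → Edge M → Ω → Fin A}

/-- The labels `X k e` are independent random variables with the law `p`. -/
structure IsModel (p : Fin A → ℝ) (μ : Measure Ω) (X : ℕ → Edge M → Ω → Fin A) : Prop where
  meas : ∀ k e, Measurable (X k e)
  indep : iIndepFun (fun q : ℕ × Edge M => X q.1 q.2) μ
  law : ∀ k e j, μ (X k e ⁻¹' {j}) = ENNReal.ofReal (p j)

/-- The number of nodes of the random G-trie as an extended nonnegative real number. -/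
def rsize (X : ℕ → Edge M → Ω → Fin A) (n : ℕ) (ω : Ω) : ℝ≥0∞ :=
  esize (fun (k : Fin n) (e : Edge M) => X k e ω)

/-- The labels of the edges at the root. -/
def rootLabels (X : ℕ → Edge M → Ω → Fin A) (n : ℕ) (ω : Ω) : Fin n → Fin M → Fin A :=
  fun k i => X k ([], i) ω

/-- The size of the subtrie `a` if the labels at the root are `r`. -/
def subSize (X : ℕ → Edge M → Ω → Fin A) {n : ℕ} (r : Fin n → Fin M → Fin A) (a : Fin M × Fin A)
    (ω : Ω) : ℝ≥0∞ :=
  esize (subLabelings (fun (k : Fin n) (e : Edge M) => X k e ω) r a)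

theorem IsModel.map_eq (h : IsModel p μ X) (k l : ℕ) (e e' : Edge M) :
    μ.map (X k e) = μ.map (X l e') := by
  refine Measure.ext_of_singleton fun j => ?_
  rw [Measure.map_apply (h.meas _ _) (MeasurableSet.singleton j),
    Measure.map_apply (h.meas _ _) (MeasurableSet.singleton j), h.law, h.law]

/-- Relabeling the edges and the labelings does not change the law of the size. -/
theorem IsModel.map_esize_eq (h : IsModel p μ X) {n : ℕ} (φ : Fin n × Edge M → ℕ × Edge M)
    (hφ : Function.Injective φ) :
    μ.map (fun ω => esize (fun (k : Fin n) (e : Edge M) => X (φ (k, e)).1 (φ (k, e)).2 ω)) =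
      μ.map (rsize X n) := by
  -- All labels have the same law, represented here by the label `X 0 ([], q.2.2)`. Along any
  -- injective relabeling the law of the size is therefore the image of one product measure that
  -- does not mention the relabeling.
  have key : ∀ ψ : Fin n × Edge M → ℕ × Edge M, Function.Injective ψ →
      μ.map (fun ω => esize (fun (k : Fin n) (e : Edge M) => X (ψ (k, e)).1 (ψ (k, e)).2 ω)) =
      (Measure.infinitePi fun q : Fin n × Edge M => μ.map (X 0 ([], q.2.2))).map
        (fun L => esize fun k e => L (k, e)) := by
    intro ψ hψ
    have h1 := (iIndepFun_iff_map_fun_eq_infinitePi_map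
      (fun q => h.meas (ψ q).1 (ψ q).2)).1 (h.indep.precomp hψ)
    have h2 : ∀ q : Fin n × Edge M,
        μ.map (X (ψ q).1 (ψ q).2) = μ.map (X 0 ([], q.2.2)) := fun q => h.map_eq _ _ _ _
    simp only [h2] at h1
    rw [← h1, Measure.map_map]
    · rfl
    · refine measurable_esize.comp ?_
      fun_prop
    · exact measurable_pi_iff.2 fun q => h.meas _ _
  rw [key φ hφ]
  have := key (fun q => ((q.1 : ℕ), q.2)) (by
    rintro ⟨a, b⟩ ⟨c, d⟩ hab
    simp only [Prod.mk.injEq] at hab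
    exact Prod.ext (Fin.ext hab.1) hab.2)
  rw [← this]
  rfl

theorem IsModel.measurable_rsize (h : IsModel p μ X) (n : ℕ) : Measurable (rsize X n) :=
  measurable_esize.comp (measurable_pi_iff.2 fun _ => measurable_pi_iff.2 fun _ => h.meas _ _)

theorem IsModel.measurable_rootLabels (h : IsModel p μ X) (n : ℕ) :
    Measurable (rootLabels X n) :=
  measurable_pi_iff.2 fun _ => measurable_pi_iff.2 fun _ => h.meas _ _

theorem IsModel.measurable_subSize (h : IsModel p μ X) {n : ℕ} (r : Fin n → Fin M → Fin A)
    (a : Fin M × Fin A) : Measurable (subSize X r a) := by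
  refine measurable_esize.comp (measurable_pi_iff.2 fun _ => measurable_pi_iff.2 fun _ => ?_)
  exact h.meas _ _

/-- The subtries have the laws of tries. -/
theorem IsModel.map_subSize (h : IsModel p μ X) {n : ℕ} (r : Fin n → Fin M → Fin A)
    (a : Fin M × Fin A) : μ.map (subSize X r a) = μ.map (rsize X (rootCount r a)) := by
  refine h.map_esize_eq (fun q => (((fiber r a).orderEmbOfFin rfl q.1 : Fin n),
    (a.1 :: q.2.1, q.2.2))) ?_
  rintro ⟨k, v, i⟩ ⟨k', v', i'⟩ hq
  simp only [Prod.mk.injEq, List.cons.injEq, true_and] at hq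
  have := (Finset.orderEmbOfFin _ rfl).injective (Fin.ext hq.1)
  simp [this, hq.2]

/-- The indices of the labels on which the root labels (`none`) and the subtrie `a` (`some a`)
depend. -/
def BlockIndex (M : ℕ) {n : ℕ} (r : Fin n → Fin M → Fin A) : Option (Fin M × Fin A) → Type
  | none => Fin n × Fin M
  | some a => Fin (rootCount r a) × Edge M

/-- The label with the given index in the given block. -/
def blockEdge {n : ℕ} (r : Fin n → Fin M → Fin A) :
    (b : Option (Fin M × Fin A)) → BlockIndex M r b → ℕ × Edge M
  | none, q => ((q.1 : ℕ), ([], q.2))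
  | some a, q => (((fiber r a).orderEmbOfFin rfl q.1 : Fin n), (a.1 :: q.2.1, q.2.2))

/-- Different subtries read different labels: below different children the edges differ, and below
the same child with different letters the labelings differ, because a labeling has only one letter
on an edge. -/
theorem blockEdge_injective {n : ℕ} (r : Fin n → Fin M → Fin A) :
    Function.Injective fun q : (b : Option (Fin M × Fin A)) × BlockIndex M r b =>
      blockEdge r q.1 q.2 := by
  have hmem : ∀ a (k : Fin (rootCount r a)), r ((fiber r a).orderEmbOfFin rfl k) a.1 = a.2 := by
    intro a k
    have := Finset.orderEmbOfFin_mem (fiber r a) rfl k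
    simpa [fiber] using this
  rintro ⟨_ | a, q⟩ ⟨_ | a', q'⟩ hq
  · obtain ⟨k, i⟩ := q
    obtain ⟨k', i'⟩ := q'
    simp only [blockEdge, Prod.mk.injEq, true_and] at hq
    rw [Fin.ext hq.1, hq.2]
  · simp [blockEdge] at hq
  · simp [blockEdge] at hq
  · obtain ⟨k, v, i⟩ := q
    obtain ⟨k', v', i'⟩ := q'
    simp only [blockEdge, Prod.mk.injEq, List.cons.injEq] at hq
    obtain ⟨h1, ⟨h2, h3⟩, h4⟩ := hq
    have h1' := Fin.ext h1
    have haa : a = a' := by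
      refine Prod.ext h2 ?_
      rw [← hmem a k, ← hmem a' k', h1', h2]
    subst haa
    have := (Finset.orderEmbOfFin _ rfl).injective h1'
    simp [this, h3, h4]

theorem IsModel.iIndepFun_block (h : IsModel p μ X) {n : ℕ} (r : Fin n → Fin M → Fin A) :
    iIndepFun (fun b ω (q : BlockIndex M r b) =>
      X (blockEdge r b q).1 (blockEdge r b q).2 ω) μ :=
  iIndepFun_sigma_curry (fun _ _ => h.meas _ _) (h.indep.precomp (blockEdge_injective r))

theorem IsModel.iIndepFun_subSize (h : IsModel p μ X) {n : ℕ} (r : Fin n → Fin M → Fin A) :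
    iIndepFun (subSize X r) μ := by
  have h1 := (h.iIndepFun_block r).precomp (Option.some_injective (Fin M × Fin A))
  refine (h1.comp (fun a L => esize fun k e => L (k, e)) fun a => ?_)
  refine measurable_esize.comp (measurable_pi_iff.2 fun k => measurable_pi_iff.2 fun e => ?_)
  exact measurable_pi_apply _

/-- With `r` frozen, the subtries read only edges below the first level. Conditioning on the root
labels thus reduces to a finite sum of product probabilities. -/
theorem IsModel.indepFun_rootLabels_subSize (h : IsModel p μ X) {n : ℕ}
    (r : Fin n → Fin M → Fin A) :
    IndepFun (rootLabels X n) (fun ω a => subSize X r a ω) μ := by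
  classical
  have h1 := (h.iIndepFun_block r).indepFun_finset {none}
    (Finset.univ.image Option.some) (by simp)
    (fun b => measurable_pi_iff.2 fun _ => h.meas _ _)
  refine h1.comp (φ := fun L k i => L ⟨none, by simp⟩ (k, i))
    (ψ := fun L a => esize fun k e => L ⟨some a, by simp⟩ (k, e)) ?_ ?_
  · refine measurable_pi_iff.2 fun k => measurable_pi_iff.2 fun i => ?_
    exact (measurable_pi_apply (X := fun _ : BlockIndex M r none => Fin A) (k, i)).comp
      (measurable_pi_apply _)
  · refine measurable_pi_iff.2 fun a => measurable_esize.comp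
      (measurable_pi_iff.2 fun k => measurable_pi_iff.2 fun e => ?_)
    exact (measurable_pi_apply (X := fun _ : BlockIndex M r (some a) => Fin A) (k, e)).comp
      (measurable_pi_apply _)

/-- The law of the size is the mixture, over the labels at the root, of the laws of one plus a sum
of independent sizes. -/
theorem IsModel.map_rsize_eq_sum (h : IsModel p μ X) {n : ℕ} (hn : 2 ≤ n) :
    μ.map (rsize X n) = ∑ r : Fin n → Fin M → Fin A,
      μ (rootLabels X n ⁻¹' {r}) • μ.map (fun ω => 1 + ∑ a, subSize X r a ω) := by
  ext B hB
  rw [Measure.map_apply (h.measurable_rsize n) hB, Measure.finsetSum_apply]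
  -- On the event that the root labels are `r`, the sizes with frozen `r` coincide with the true
  -- sizes of the subtries.
  have hdec : rsize X n ⁻¹' B = ⋃ r ∈ (Finset.univ : Finset (Fin n → Fin M → Fin A)),
      (rootLabels X n ⁻¹' {r} ∩ (fun ω => 1 + ∑ a, subSize X r a ω) ⁻¹' B) := by
    ext ω
    have hs : rsize X n ω = 1 + ∑ a, subSize X (rootLabels X n ω) a ω :=
      esize_eq_one_add hn _ _ fun k i => rfl
    simp only [Set.mem_preimage, Finset.mem_univ, Set.iUnion_true, Set.mem_iUnion,
      Set.mem_inter_iff, Set.mem_singleton_iff, exists_eq_left', hs]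
  have hm : ∀ r : Fin n → Fin M → Fin A, Measurable fun ω => 1 + ∑ a, subSize X r a ω :=
    fun r => measurable_const.add (Finset.measurable_fun_sum _ fun a _ => h.measurable_subSize r a)
  rw [hdec, measure_biUnion_finset]
  · refine Finset.sum_congr rfl fun r _ => ?_
    have h2 : IndepFun (rootLabels X n) (fun ω => 1 + ∑ a, subSize X r a ω) μ := by
      refine (h.indepFun_rootLabels_subSize r).comp (φ := id)
        (ψ := fun z : Fin M × Fin A → ℝ≥0∞ => 1 + ∑ a, z a) measurable_id ?_
      fun_prop
    rw [h2.measure_inter_preimage_eq_mul _ _ (MeasurableSet.of_discrete) hB,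
      Measure.smul_apply, Measure.map_apply (hm r) hB, smul_eq_mul]
  · intro r _ r' _ hrr
    refine Set.disjoint_left.2 fun ω hω hω' => hrr ?_
    rw [← hω.1, ← hω'.1]
  · intro r _
    exact (h.measurable_rootLabels n (MeasurableSet.of_discrete)).inter (hm r hB)

/-! ### Finiteness of all moments -/

/-- In the expansion of a power of a sum of independent variables, only the pure powers carry the
full order; mixed products factorize into moments of lower order, which `C` controls. What matters
later is that `D` is chosen before `Y`, hence is uniform over truncation levels and root labels. -/
theorem lintegral_pow_one_add_sum_le {Ω ι : Type*} [MeasurableSpace Ω] {μ : Measure Ω}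
    [IsProbabilityMeasure μ] (F : Finset ι) (m : ℕ) (C : ℝ≥0∞) (hC : C ≠ ⊤) :
    ∃ D : ℝ≥0∞, D ≠ ⊤ ∧ ∀ Y : ι → Ω → ℝ≥0∞, (∀ a, Measurable (Y a)) → iIndepFun Y μ →
      (∀ a, ∀ k < m, ∫⁻ ω, Y a ω ^ k ∂μ ≤ C) → ∀ k ≤ m,
      ∫⁻ ω, (1 + ∑ a ∈ F, Y a ω) ^ k ∂μ ≤ ∑ a ∈ F, ∫⁻ ω, Y a ω ^ k ∂μ + D := by
  classical
  induction F using Finset.induction_on with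
  | empty => exact ⟨1, by simp, fun Y _ _ _ k _ => by simp⟩
  | insert b F hb ih =>
    obtain ⟨D, hD, h⟩ := ih
    let E : ℝ≥0∞ := (F.card • C + D) * C
    have hE : E ≠ ⊤ := by
      refine ENNReal.mul_ne_top (ENNReal.add_ne_top.2 ⟨?_, hD⟩) hC
      rw [nsmul_eq_mul]
      exact ENNReal.mul_ne_top (by simp) hC
    refine ⟨D + 1 + 2 ^ m * E, by
      simp [ENNReal.mul_eq_top, hD, hE], fun Y hY hi hl k hk => ?_⟩
    have hU : Measurable fun ω => 1 + ∑ a ∈ F, Y a ω :=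
      measurable_const.add (Finset.measurable_fun_sum _ fun a _ => hY a)
    have hind : IndepFun (fun ω => 1 + ∑ a ∈ F, Y a ω) (Y b) μ := by
      have := hi.indepFun_finset F {b} (by simpa using hb) hY
      refine this.comp (φ := fun z : F → ℝ≥0∞ => 1 + ∑ a, z a)
        (ψ := fun z : ({b} : Finset ι) → ℝ≥0∞ => z ⟨b, by simp⟩) ?_ ?_ |>.congr ?_ ?_
      · fun_prop
      · fun_prop
      · refine Filter.Eventually.of_forall fun ω => ?_
        simp only [Function.comp_apply]
        rw [← Finset.sum_coe_sort F]
      · exact Filter.Eventually.of_forall fun ω => rfl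
    have hprod : ∀ l l' : ℕ, ∫⁻ ω, (1 + ∑ a ∈ F, Y a ω) ^ l * Y b ω ^ l' ∂μ =
        (∫⁻ ω, (1 + ∑ a ∈ F, Y a ω) ^ l ∂μ) * ∫⁻ ω, Y b ω ^ l' ∂μ := fun l l' =>
      lintegral_mul_eq_lintegral_mul_lintegral_of_indepFun (hU.pow_const l) ((hY b).pow_const l')
        (hind.comp (measurable_id.pow_const l) (measurable_id.pow_const l'))
    have hexp : ∀ ω, (1 + ∑ a ∈ insert b F, Y a ω) ^ k =
        ∑ l ∈ Finset.range (k + 1),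
          (k.choose l : ℝ≥0∞) * ((1 + ∑ a ∈ F, Y a ω) ^ l * Y b ω ^ (k - l)) := by
      intro ω
      rw [Finset.sum_insert hb, show 1 + (Y b ω + ∑ a ∈ F, Y a ω) =
        (1 + ∑ a ∈ F, Y a ω) + Y b ω by ring, add_pow]
      exact Finset.sum_congr rfl fun l _ => by ring
    have hlow : ∀ l < m, ∫⁻ ω, (1 + ∑ a ∈ F, Y a ω) ^ l ∂μ ≤ F.card • C + D := fun l hlm =>
      (h Y hY hi hl l hlm.le).trans
        (by gcongr; exact Finset.sum_le_card_nsmul _ _ _ fun a _ => hl a l hlm)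
    rw [lintegral_congr hexp, lintegral_finsetSum _ fun l _ => by fun_prop]
    -- Only `l = k` and `l = 0` involve a moment of order `k`; every other product of expectations
    -- is at most `E`.
    have hterm : ∀ l ∈ Finset.range (k + 1),
        ∫⁻ ω, (k.choose l : ℝ≥0∞) * ((1 + ∑ a ∈ F, Y a ω) ^ l * Y b ω ^ (k - l)) ∂μ ≤
        (if l = k then ∑ a ∈ F, ∫⁻ ω, Y a ω ^ k ∂μ + D else 0) +
        (if l = 0 then ∫⁻ ω, Y b ω ^ k ∂μ else 0) + (k.choose l : ℝ≥0∞) * E := by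
      intro l hl'
      have hl'' : l ≤ k := Nat.lt_succ_iff.1 (Finset.mem_range.1 hl')
      rw [lintegral_const_mul _ (by fun_prop), hprod]
      by_cases h1 : l = k
      · subst h1
        simp only [Nat.choose_self, Nat.cast_one, one_mul, Nat.sub_self, pow_zero,
          lintegral_const, measure_univ, mul_one, if_true]
        exact (h Y hY hi hl l hk).trans (by rw [add_assoc]; exact le_self_add)
      by_cases h2 : l = 0
      · subst h2
        simp only [Nat.choose_zero_right, Nat.cast_one, one_mul, Nat.sub_zero, pow_zero,
          lintegral_const, measure_univ, h1, if_true, if_false, zero_add]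
        exact le_self_add
      · simp only [h1, h2, if_false, zero_add]
        exact mul_le_mul' le_rfl (mul_le_mul' (hlow l (by omega)) (hl b _ (by omega)))
    refine (Finset.sum_le_sum hterm).trans ?_
    rw [Finset.sum_add_distrib, Finset.sum_add_distrib, Finset.sum_ite_eq', Finset.sum_ite_eq',
      ← Finset.sum_mul, ← Nat.cast_sum, Nat.sum_range_choose, Finset.sum_insert hb]
    simp only [Finset.mem_range, Nat.lt_succ_self, if_true, Nat.succ_pos]
    have : ((2 ^ k : ℕ) : ℝ≥0∞) * E ≤ 2 ^ m * E := by
      push_cast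
      gcongr
      norm_num
    calc _ ≤ ∑ a ∈ F, ∫⁻ ω, Y a ω ^ k ∂μ + D + ∫⁻ ω, Y b ω ^ k ∂μ + 2 ^ m * E := by gcongr
      _ ≤ ∑ a ∈ F, ∫⁻ ω, Y a ω ^ k ∂μ + D + ∫⁻ ω, Y b ω ^ k ∂μ + 2 ^ m * E + 1 := le_self_add
      _ = _ := by ring

variable {M A : ℕ} {p : Fin A → ℝ} {Ω : Type*} [MeasurableSpace Ω] {μ : Measure Ω}
  [IsProbabilityMeasure μ] {X : ℕ → Edge M → Ω → Fin A}

theorem rootCount_le {n : ℕ} (r : Fin n → Fin M → Fin A) (a : Fin M × Fin A) :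
    rootCount r a ≤ n := by
  exact (Finset.card_le_univ (fiber r a)).trans_eq (Fintype.card_fin n)

theorem IsModel.measure_rootCount_eq (h : IsModel p μ X) (n : ℕ) (a : Fin M × Fin A) :
    μ {ω | rootCount (rootLabels X n ω) a = n} = ENNReal.ofReal (p a.2) ^ n := by
  have h1 : {ω | rootCount (rootLabels X n ω) a = n} =
      ⋂ q ∈ (Finset.range n).image (fun k => ((k, ([], a.1)) : ℕ × Edge M)),
        (fun q : ℕ × Edge M => X q.1 q.2) q ⁻¹' {a.2} := by
    ext ω
    simp only [Set.mem_ofPred_eq, Finset.mem_image, Finset.mem_range, Set.mem_iInter,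
      Set.mem_preimage, Set.mem_singleton_iff, forall_exists_index, and_imp, rootCount]
    constructor
    · intro hc q k hk hq
      have := (Finset.card_eq_iff_eq_univ (fiber (rootLabels X n ω) a)).1 (by simpa using hc)
      have h2 : (⟨k, hk⟩ : Fin n) ∈ fiber (rootLabels X n ω) a := by rw [this]; simp
      subst hq
      simpa [rootLabels] using h2
    · intro hq
      have : fiber (rootLabels X n ω) a = Finset.univ := by
        ext k
        simpa [rootLabels] using hq _ k k.2 rfl
      simp [this]
  rw [h1, h.indep.measure_inter_preimage_eq_mul _ fun _ _ => MeasurableSet.singleton _,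
    Finset.prod_image (by simp)]
  simp [h.law]

theorem IsModel.lintegral_rsize (h : IsModel p μ X) {n : ℕ} (hn : 2 ≤ n) (g : ℝ≥0∞ → ℝ≥0∞)
    (hg : Measurable g) :
    ∫⁻ ω, g (rsize X n ω) ∂μ = ∑ r : Fin n → Fin M → Fin A,
      μ (rootLabels X n ⁻¹' {r}) * ∫⁻ ω, g (1 + ∑ a, subSize X r a ω) ∂μ := by
  rw [← lintegral_map hg (h.measurable_rsize n), h.map_rsize_eq_sum hn,
    lintegral_finsetSum_measure]
  refine Finset.sum_congr rfl fun r _ => ?_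
  rw [lintegral_smul_measure, lintegral_map hg, smul_eq_mul]
  exact measurable_const.add (Finset.measurable_fun_sum _ fun a _ => h.measurable_subSize r a)

theorem IsModel.lintegral_subSize (h : IsModel p μ X) {n : ℕ} (r : Fin n → Fin M → Fin A)
    (a : Fin M × Fin A) (g : ℝ≥0∞ → ℝ≥0∞) (hg : Measurable g) :
    ∫⁻ ω, g (subSize X r a ω) ∂μ = ∫⁻ ω, g (rsize X (rootCount r a) ω) ∂μ := by
  rw [← lintegral_map hg (h.measurable_subSize r a), h.map_subSize,
    lintegral_map hg (h.measurable_rsize _)]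

theorem IsModel.lintegral_rootLabels (h : IsModel p μ X) {n : ℕ}
    (φ : (Fin n → Fin M → Fin A) → ℝ≥0∞) :
    ∫⁻ ω, φ (rootLabels X n ω) ∂μ =
      ∑ r : Fin n → Fin M → Fin A, μ (rootLabels X n ⁻¹' {r}) * φ r := by
  rw [← lintegral_map (measurable_of_finite φ) (h.measurable_rootLabels n), lintegral_fintype]
  refine Finset.sum_congr rfl fun r _ => ?_
  rw [Measure.map_apply (h.measurable_rootLabels n) (MeasurableSet.singleton r), mul_comm]

theorem rsize_of_lt_two {n : ℕ} (hn : n < 2) (ω : Ω) : rsize X n ω = 0 :=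
  esize_of_lt_two _ hn

/-- The truncated moments of the size are bounded. -/
theorem IsModel.truncated_moment_bound (h : IsModel p μ X) (hp : ∀ j, 0 < p j ∧ p j < 1)
    (hexp : (M : ℝ) * ∑ j, p j ^ 2 < 1) (m n : ℕ) :
    ∃ C : ℝ≥0∞, C ≠ ⊤ ∧ ∀ B : ℕ, ∫⁻ ω, (min (rsize X n ω) B) ^ m ∂μ ≤ C := by
  induction m using Nat.strong_induction_on generalizing n with
  | _ m ihm =>
  induction n using Nat.strong_induction_on with
  | _ n ihn =>
  rcases lt_or_ge n 2 with hn | hn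
  · refine ⟨1, by simp, fun B => ?_⟩
    simp only [rsize_of_lt_two hn, zero_le, inf_of_le_left, lintegral_const, measure_univ, mul_one]
    exact pow_le_one' zero_le_one _
  choose! c hc hcB using ihm
  choose! d hd hdB using ihn
  let C0 : ℝ≥0∞ := ∑ k ∈ Finset.range m, ∑ N ∈ Finset.range (n + 1), c k N
  have hC0 : C0 ≠ ⊤ := by
    refine ENNReal.sum_ne_top.2 fun k hk => ENNReal.sum_ne_top.2 fun N _ => hc k ?_ N
    exact Finset.mem_range.1 hk
  let C1 : ℝ≥0∞ := ∑ N ∈ Finset.range n, d N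
  have hC1 : C1 ≠ ⊤ := ENNReal.sum_ne_top.2 fun N hN => hd N (Finset.mem_range.1 hN)
  obtain ⟨D, hD, hsum⟩ := lintegral_pow_one_add_sum_le (μ := μ)
    (Finset.univ : Finset (Fin M × Fin A)) m C0 hC0
  -- The expected number of subtries that receive all `n` labelings. It is smaller than one because
  -- `n ≥ 2` and the sum of squares is smaller than `1 / M`.
  let θ : ℝ≥0∞ := ∑ a : Fin M × Fin A, ENNReal.ofReal (p a.2) ^ n
  have hθ : θ < 1 := by
    have : θ = ENNReal.ofReal ((M : ℝ) * ∑ j, p j ^ n) := by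
      simp only [θ, Fintype.sum_prod_type, Finset.sum_const, Finset.card_univ, Fintype.card_fin,
        nsmul_eq_mul]
      rw [ENNReal.ofReal_mul (by positivity), ENNReal.ofReal_natCast,
        ENNReal.ofReal_sum_of_nonneg fun j _ => pow_nonneg (hp j).1.le n]
      simp_rw [ENNReal.ofReal_pow (hp _).1.le]
    rw [this, ENNReal.ofReal_lt_one]
    refine lt_of_le_of_lt ?_ hexp
    exact mul_le_mul_of_nonneg_left (Finset.sum_le_sum fun j _ =>
      pow_le_pow_of_le_one (hp j).1.le (hp j).2.le hn) (by positivity)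
  let K : ℝ≥0∞ := (M * A : ℕ) * C1 + D
  have hK : K ≠ ⊤ := by simp [K, ENNReal.mul_eq_top, hC1, hD]
  refine ⟨K / (1 - θ), ENNReal.div_ne_top hK (tsub_pos_of_lt hθ).ne', fun B => ?_⟩
  set y := ∫⁻ ω, (min (rsize X n ω) B) ^ m ∂μ with hy
  -- Truncation serves only this purpose: with `y` finite, the inequality `y ≤ θ * y + K` can be
  -- solved for `y`, and the resulting bound does not depend on `B`.
  have hyB : y ≠ ⊤ := by
    refine ne_top_of_le_ne_top (b := ∫⁻ _, (B : ℝ≥0∞) ^ m ∂μ) (by simp) ?_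
    exact lintegral_mono fun ω => by gcongr; exact min_le_right _ _
  have hg : ∀ k : ℕ, Measurable fun z : ℝ≥0∞ => (min z (B : ℝ≥0∞)) ^ k := fun k => by fun_prop
  have hone : ∀ r : Fin n → Fin M → Fin A,
      ∫⁻ ω, (min (1 + ∑ a, subSize X r a ω) B) ^ m ∂μ ≤
        (∑ a, if rootCount r a = n then 1 else 0) * y + K := by
    intro r
    -- Truncation is subadditive: if some summand reaches `B`, the right-hand side is already at
    -- least `B`; otherwise no summand is truncated.
    have e1 : ∀ ω, min (1 + ∑ a, subSize X r a ω) (B : ℝ≥0∞) ≤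
        1 + ∑ a, min (subSize X r a ω) (B : ℝ≥0∞) := by
      intro ω
      by_cases hex : ∃ a, (B : ℝ≥0∞) ≤ subSize X r a ω
      · obtain ⟨a, ha⟩ := hex
        refine (min_le_right _ _).trans ?_
        refine le_add_of_nonneg_of_le zero_le ?_
        have := Finset.single_le_sum (f := fun a => min (subSize X r a ω) (B : ℝ≥0∞))
          (fun _ _ => zero_le) (Finset.mem_univ a)
        simpa [ha] using this
      · push Not at hex
        refine (min_le_left _ _).trans ?_
        gcongr with a
        exact le_min le_rfl (hex a).le
    have e2 := hsum (fun a ω => min (subSize X r a ω) B)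
      (fun a => (h.measurable_subSize r a).min measurable_const)
      ((h.iIndepFun_subSize r).comp (fun _ z => min z (B : ℝ≥0∞))
        fun _ => measurable_id.min measurable_const)
      (fun a k hk => by
        rw [h.lintegral_subSize r a _ (hg k)]
        refine (hcB k hk _ B).trans ?_
        refine le_trans ?_ (Finset.single_le_sum (fun _ _ => zero_le) (Finset.mem_range.2 hk))
        exact Finset.single_le_sum (f := fun N => c k N) (fun _ _ => zero_le)
          (Finset.mem_range.2 (Nat.lt_succ_of_le (rootCount_le r a)))) m le_rfl
    refine (lintegral_mono fun ω => pow_le_pow_left₀ zero_le (e1 ω) m).trans (e2.trans ?_)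
    have e3 : ∀ a, ∫⁻ ω, (min (subSize X r a ω) B) ^ m ∂μ ≤
        (if rootCount r a = n then 1 else 0) * y + C1 := by
      intro a
      rw [h.lintegral_subSize r a _ (hg m)]
      by_cases ha : rootCount r a = n
      · rw [ha]
        simp [y]
      · have ha' : rootCount r a < n := lt_of_le_of_ne (rootCount_le r a) ha
        simp only [ha, if_false, zero_mul, zero_add]
        refine (hdB _ ha' B).trans ?_
        exact Finset.single_le_sum (f := d) (fun _ _ => zero_le) (Finset.mem_range.2 ha')
    refine (add_le_add_left (Finset.sum_le_sum fun a _ => e3 a) D).trans_eq ?_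
    rw [Finset.sum_add_distrib, ← Finset.sum_mul, Finset.sum_const, Finset.card_univ,
      nsmul_eq_mul]
    simp [K, add_assoc]
  have hmain : y ≤ θ * y + K := by
    calc y = ∑ r, μ (rootLabels X n ⁻¹' {r}) * ∫⁻ ω, (min (1 + ∑ a, subSize X r a ω) B) ^ m ∂μ :=
          h.lintegral_rsize hn _ (hg m)
      _ ≤ ∑ r, μ (rootLabels X n ⁻¹' {r}) *
          ((∑ a, if rootCount r a = n then 1 else 0) * y + K) :=
          Finset.sum_le_sum fun r _ => by gcongr; exact hone r
      _ = θ * y + K := by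
        rw [← h.lintegral_rootLabels fun r => (∑ a, if rootCount r a = n then 1 else 0) * y + K]
        rw [lintegral_add_right _ measurable_const, lintegral_const, measure_univ, mul_one,
          lintegral_mul_const' _ _ hyB, lintegral_finsetSum']
        · congr 2
          refine Finset.sum_congr rfl fun a _ => ?_
          rw [← h.measure_rootCount_eq n a, ← lintegral_indicator_one]
          · exact lintegral_congr fun ω => by simp [Set.indicator]
          · exact (measurable_of_finite (fun r : Fin n → Fin M → Fin A => rootCount r a)).comp
              (h.measurable_rootLabels n) (MeasurableSet.singleton n)
        · intro a _
          exact ((measurable_of_finite fun r : Fin n → Fin M → Fin A =>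
            if rootCount r a = n then (1 : ℝ≥0∞) else 0).comp
              (h.measurable_rootLabels n)).aemeasurable
  rw [ENNReal.le_div_iff_mul_le (Or.inl (tsub_pos_of_lt hθ).ne') (Or.inl (by simp)), mul_comm,
    ENNReal.sub_mul (fun _ _ => hyB), one_mul]
  exact tsub_le_iff_left.2 hmain

theorem IsModel.lintegral_rsize_pow_ne_top (h : IsModel p μ X) (hp : ∀ j, 0 < p j ∧ p j < 1)
    (hexp : (M : ℝ) * ∑ j, p j ^ 2 < 1) (m n : ℕ) :
    ∫⁻ ω, rsize X n ω ^ m ∂μ ≠ ⊤ := by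
  obtain ⟨C, hC, hCB⟩ := h.truncated_moment_bound hp hexp m n
  refine ne_top_of_le_ne_top hC ?_
  have hsup : ∀ ω, Tendsto (fun B : ℕ => (min (rsize X n ω) B) ^ m) atTop
      (𝓝 (rsize X n ω ^ m)) := by
    intro ω
    refine ENNReal.Tendsto.pow ?_
    have : Tendsto (fun B : ℕ => min (rsize X n ω) (B : ℝ≥0∞)) atTop
        (𝓝 (min (rsize X n ω) ⊤)) := tendsto_const_nhds.min ENNReal.tendsto_nat_nhds_top
    simpa using this
  have := lintegral_tendsto_of_tendsto_of_monotone (μ := μ)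
    (f := fun (B : ℕ) ω => (min (rsize X n ω) B) ^ m) (F := fun ω => rsize X n ω ^ m)
    (fun B => (((h.measurable_rsize n).min measurable_const).pow_const m).aemeasurable)
    (Filter.Eventually.of_forall fun ω B B' hB => by
      simp only
      gcongr) (Filter.Eventually.of_forall hsup)
  exact le_of_tendsto' this hCB

/-! ### Recurrences for the mean and the central moments -/

variable {M A : ℕ} {p : Fin A → ℝ} {Ω : Type*} [MeasurableSpace Ω] {μ : Measure Ω}
  [IsProbabilityMeasure μ] {X : ℕ → Edge M → Ω → Fin A}

theorem toReal_rsize (X : ℕ → Edge M → Ω → Fin A) (n : ℕ) (ω : Ω) :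
    (rsize X n ω).toReal = size X n ω := toReal_esize _

/-- The expected size. -/
def meanSize (μ : Measure Ω) (X : ℕ → Edge M → Ω → Fin A) (n : ℕ) : ℝ := ∫ ω, size X n ω ∂μ

theorem size_of_lt_two {n : ℕ} (hn : n < 2) (ω : Ω) : size X n ω = 0 := by
  rw [← toReal_rsize, rsize_of_lt_two hn, ENNReal.toReal_zero]

theorem meanSize_of_lt_two {n : ℕ} (hn : n < 2) : meanSize μ X n = 0 := by
  simp [meanSize, size_of_lt_two hn]

theorem IsModel.ae_rsize_ne_top (h : IsModel p μ X) (hp : ∀ j, 0 < p j ∧ p j < 1)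
    (hexp : (M : ℝ) * ∑ j, p j ^ 2 < 1) (n : ℕ) : ∀ᵐ ω ∂μ, rsize X n ω ≠ ⊤ := by
  have := ae_lt_top (h.measurable_rsize n) (by simpa using h.lintegral_rsize_pow_ne_top hp hexp 1 n)
  filter_upwards [this] with ω hω using hω.ne

/-- Formulated through the law of `Z` so that it covers both the sizes themselves and the sizes of
subtries. -/
theorem IsModel.memLp_toReal (h : IsModel p μ X) (hp : ∀ j, 0 < p j ∧ p j < 1)
    (hexp : (M : ℝ) * ∑ j, p j ^ 2 < 1) {n : ℕ} {Z : Ω → ℝ≥0∞} (hZ : Measurable Z)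
    (hmap : μ.map Z = μ.map (rsize X n)) (m : ℕ) : MemLp (fun ω => (Z ω).toReal) m μ := by
  rcases Nat.eq_zero_or_pos m with rfl | hm
  · simpa using hZ.ennreal_toReal.aestronglyMeasurable
  rw [← integrable_norm_rpow_iff hZ.ennreal_toReal.aestronglyMeasurable (by simp; omega) (by simp)]
  have e : ∀ ω, ‖(Z ω).toReal‖ ^ ((m : ℝ≥0∞).toReal) = ((Z ω) ^ m).toReal := by
    intro ω
    simp
  simp_rw [e]
  refine integrable_toReal_of_lintegral_ne_top (hZ.pow_const m).aemeasurable ?_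
  have hg : Measurable fun z : ℝ≥0∞ => z ^ m := measurable_id.pow_const m
  rw [← lintegral_map hg hZ, hmap, lintegral_map hg (h.measurable_rsize n)]
  exact h.lintegral_rsize_pow_ne_top hp hexp m n

theorem integrable_pow_of_memLp {Y : Ω → ℝ} {m : ℕ} (h : MemLp Y m μ) :
    Integrable (fun ω => Y ω ^ m) μ := by
  rcases Nat.eq_zero_or_pos m with rfl | hm
  · simp
  refine (h.integrable_norm_pow (by omega)).mono (h.1.pow m) ?_
  exact Filter.Eventually.of_forall fun ω => by simp

theorem IsModel.memLp_size (h : IsModel p μ X) (hp : ∀ j, 0 < p j ∧ p j < 1)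
    (hexp : (M : ℝ) * ∑ j, p j ^ 2 < 1) (n m : ℕ) : MemLp (size X n) m μ := by
  have := h.memLp_toReal hp hexp (h.measurable_rsize n) rfl m
  simpa only [toReal_rsize] using this

theorem IsModel.integral_toReal_pow_eq (h : IsModel p μ X) {n : ℕ} {Z : Ω → ℝ≥0∞}
    (hZ : Measurable Z) (hmap : μ.map Z = μ.map (rsize X n)) (c : ℝ) (m : ℕ) :
    ∫ ω, ((Z ω).toReal - c) ^ m ∂μ = ∫ ω, (size X n ω - c) ^ m ∂μ := by
  have hg : Measurable fun z : ℝ≥0∞ => (z.toReal - c) ^ m := by fun_prop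
  simp_rw [← toReal_rsize]
  rw [← integral_map (f := fun z : ℝ≥0∞ => (z.toReal - c) ^ m) hZ.aemeasurable
    hg.aestronglyMeasurable, hmap, integral_map (h.measurable_rsize n).aemeasurable
    hg.aestronglyMeasurable]

theorem IsModel.ae_subSize_ne_top (h : IsModel p μ X) (hp : ∀ j, 0 < p j ∧ p j < 1)
    (hexp : (M : ℝ) * ∑ j, p j ^ 2 < 1) {n : ℕ} (r : Fin n → Fin M → Fin A)
    (a : Fin M × Fin A) : ∀ᵐ ω ∂μ, subSize X r a ω ≠ ⊤ := by
  have h1 := h.ae_rsize_ne_top hp hexp (rootCount r a)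
  have hs : MeasurableSet {z : ℝ≥0∞ | z ≠ ⊤} := (MeasurableSet.singleton ⊤).compl
  rw [← ae_map_iff (p := fun z : ℝ≥0∞ => z ≠ ⊤) (h.measurable_rsize _).aemeasurable hs] at h1
  rw [← h.map_subSize r a] at h1
  exact (ae_map_iff (h.measurable_subSize r a).aemeasurable hs).1 h1

/-- The shift `c` is free because two cases are needed: `c = 0`, `m = 1` gives the recurrence of the
mean, and `c` equal to the mean gives that of the central moments. -/
theorem IsModel.integral_size_sub_pow (h : IsModel p μ X) (hp : ∀ j, 0 < p j ∧ p j < 1)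
    (hexp : (M : ℝ) * ∑ j, p j ^ 2 < 1) {n : ℕ} (hn : 2 ≤ n) (c : ℝ) (m : ℕ) :
    ∫ ω, (size X n ω - c) ^ m ∂μ = ∑ r : Fin n → Fin M → Fin A,
      μ.real (rootLabels X n ⁻¹' {r}) *
        ∫ ω, (1 + ∑ a, (subSize X r a ω).toReal - c) ^ m ∂μ := by
  have hg : Measurable fun z : ℝ≥0∞ => (z.toReal - c) ^ m := by fun_prop
  have hm : ∀ r : Fin n → Fin M → Fin A, Measurable fun ω => 1 + ∑ a, subSize X r a ω :=
    fun r => measurable_const.add (Finset.measurable_fun_sum _ fun a _ => h.measurable_subSize r a)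
  have hae : ∀ r : Fin n → Fin M → Fin A, ∀ᵐ ω ∂μ, (1 + ∑ a, subSize X r a ω).toReal =
      1 + ∑ a, (subSize X r a ω).toReal := by
    intro r
    filter_upwards [ae_all_iff.2 fun a => h.ae_subSize_ne_top hp hexp r a] with ω hω
    rw [ENNReal.toReal_add (by simp) (ENNReal.sum_ne_top.2 fun a _ => hω a),
      ENNReal.toReal_sum fun a _ => hω a]
    simp
  simp_rw [← toReal_rsize]
  rw [← integral_map (f := fun z : ℝ≥0∞ => (z.toReal - c) ^ m)
    (h.measurable_rsize n).aemeasurable hg.aestronglyMeasurable, h.map_rsize_eq_sum hn,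
    integral_finsetSum_measure]
  · refine Finset.sum_congr rfl fun r _ => ?_
    rw [integral_smul_measure, integral_map (hm r).aemeasurable hg.aestronglyMeasurable]
    simp only [smul_eq_mul]
    congr 1
    refine integral_congr_ae ?_
    filter_upwards [hae r] with ω hω
    rw [hω]
  · intro r _
    refine Integrable.smul_measure ?_ (measure_ne_top _ _)
    rw [integrable_map_measure hg.aestronglyMeasurable (hm r).aemeasurable]
    have hsum : MemLp (fun ω => ∑ a, (subSize X r a ω).toReal) m μ :=
      memLp_finsetSum Finset.univ fun a _ =>
        h.memLp_toReal hp hexp (h.measurable_subSize r a) (h.map_subSize r a) m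
    have h1 : MemLp (fun _ : Ω => (1 : ℝ)) m μ := memLp_const 1
    have h2 : MemLp (fun _ : Ω => c) m μ := memLp_const c
    have : MemLp (fun ω => 1 + ∑ a, (subSize X r a ω).toReal - c) m μ := (h1.add hsum).sub h2
    refine (integrable_pow_of_memLp this).congr ?_
    filter_upwards [hae r] with ω hω
    simp [hω]

theorem IsModel.sum_rootLabels (h : IsModel p μ X) {n : ℕ} (φ : (Fin n → Fin M → Fin A) → ℝ) :
    ∑ r : Fin n → Fin M → Fin A, μ.real (rootLabels X n ⁻¹' {r}) * φ r =
      ∫ ω, φ (rootLabels X n ω) ∂μ := by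
  rw [← integral_map (h.measurable_rootLabels n).aemeasurable
    (measurable_of_finite φ).aestronglyMeasurable, integral_fintype (Integrable.of_finite)]
  refine Finset.sum_congr rfl fun r _ => ?_
  rw [map_measureReal_apply (h.measurable_rootLabels n) (MeasurableSet.singleton r), smul_eq_mul]

/-- The conditional mean of the size given the labels at the root, minus its mean. -/
def toll (μ : Measure Ω) (X : ℕ → Edge M → Ω → Fin A) {n : ℕ} (r : Fin n → Fin M → Fin A) : ℝ :=
  1 + ∑ a, meanSize μ X (rootCount r a) - meanSize μ X n

/-- The central moments of the size satisfy a distributional recurrence. -/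
theorem IsModel.exists_centered (h : IsModel p μ X) (hp : ∀ j, 0 < p j ∧ p j < 1)
    (hexp : (M : ℝ) * ∑ j, p j ^ 2 < 1) (n : ℕ) :
    ∃ Y : (Fin n → Fin M → Fin A) → Fin M × Fin A → Ω → ℝ,
      (∀ r a, Measurable (Y r a)) ∧ (∀ r, iIndepFun (Y r) μ) ∧
      (∀ r a (k : ℕ), MemLp (Y r a) k μ) ∧
      (∀ r a k, ∫ ω, Y r a ω ^ k ∂μ = centralMoment (size X (rootCount r a)) k μ) ∧
      (2 ≤ n → ∀ m, centralMoment (size X n) m μ =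
        ∑ r, μ.real (rootLabels X n ⁻¹' {r}) * ∫ ω, (∑ a, Y r a ω + toll μ X r) ^ m ∂μ) := by
  -- Each subtrie is centered at the mean for its own number of labelings; what remains after
  -- centering the whole is the toll.
  refine ⟨fun r a ω => (subSize X r a ω).toReal - meanSize μ X (rootCount r a),
    fun r a => (h.measurable_subSize r a).ennreal_toReal.sub_const _, fun r => ?_, fun r a k => ?_,
    fun r a k => ?_, fun hn m => ?_⟩
  · exact (h.iIndepFun_subSize r).comp (fun a z => z.toReal - meanSize μ X (rootCount r a))
      fun a => by fun_prop
  · exact (h.memLp_toReal hp hexp (h.measurable_subSize r a) (h.map_subSize r a) k).sub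
      (memLp_const _)
  · exact h.integral_toReal_pow_eq (h.measurable_subSize r a) (h.map_subSize r a) _ k
  · have := h.integral_size_sub_pow hp hexp hn (meanSize μ X n) m
    rw [centralMoment]
    refine this.trans (Finset.sum_congr rfl fun r _ => ?_)
    congr 1
    refine integral_congr_ae (Filter.Eventually.of_forall fun ω => ?_)
    simp only [toll, Finset.sum_sub_distrib]
    ring

/-- The mean size satisfies a recurrence. -/
theorem IsModel.meanSize_eq (h : IsModel p μ X) (hp : ∀ j, 0 < p j ∧ p j < 1)
    (hexp : (M : ℝ) * ∑ j, p j ^ 2 < 1) {n : ℕ} (hn : 2 ≤ n) :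
    meanSize μ X n = ∫ ω, (1 + ∑ a, meanSize μ X (rootCount (rootLabels X n ω) a)) ∂μ := by
  have := h.integral_size_sub_pow hp hexp hn 0 1
  simp only [sub_zero, pow_one] at this
  rw [meanSize, this,
    ← h.sum_rootLabels fun r => (1 + ∑ a, meanSize μ X (rootCount r a))]
  refine Finset.sum_congr rfl fun r _ => ?_
  have hint : ∀ a, Integrable (fun ω => (subSize X r a ω).toReal) μ := fun a => by
    have := h.memLp_toReal hp hexp (h.measurable_subSize r a) (h.map_subSize r a) 1
    exact this.integrable (by simp)
  rw [integral_add (integrable_const _) (integrable_finsetSum _ fun a _ => hint a),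
    integral_finsetSum _ fun a _ => hint a]
  simp only [integral_const, probReal_univ, smul_eq_mul, mul_one]
  congr 2
  refine Finset.sum_congr rfl fun a _ => ?_
  have := h.integral_toReal_pow_eq (h.measurable_subSize r a) (h.map_subSize r a) 0 1
  simpa [meanSize] using this

/-! ### Sums over words and supersolutions -/

section Weights

variable {M A : ℕ} {p : Fin A → ℝ}

/-- The probability that the node `x` occurs in a labeling. -/
def weight (p : Fin A → ℝ) (x : List (Fin M × Fin A)) : ℝ := (x.map fun a => p a.2).prod

@[simp] theorem weight_nil : weight p ([] : List (Fin M × Fin A)) = 1 := by simp [weight]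

@[simp] theorem weight_cons (a : Fin M × Fin A) (x : List (Fin M × Fin A)) :
    weight p (a :: x) = p a.2 * weight p x := by simp [weight]

theorem weight_pos (hp : ∀ j, 0 < p j ∧ p j < 1) (x : List (Fin M × Fin A)) :
    0 < weight p x := by
  induction x with
  | nil => simp
  | cons a x ih => simpa using mul_pos (hp a.2).1 ih

theorem weight_le_one (hp : ∀ j, 0 < p j ∧ p j < 1) (x : List (Fin M × Fin A)) :
    weight p x ≤ 1 := by
  induction x with
  | nil => simp
  | cons a x ih => simpa using mul_le_one₀ (hp a.2).2.le (weight_pos hp x).le ih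

theorem sum_prod_snd (F : Fin A → ℝ) : ∑ a : Fin M × Fin A, F a.2 = M * ∑ j, F j := by
  simp [Fintype.sum_prod_type]

/-- A supersolution of the renewal equation bounds its solution. -/
theorem summable_of_supersolution (hp : ∀ j, 0 < p j ∧ p j < 1) {F H : ℝ → ℝ}
    (hF : ∀ y, 0 < y → 0 ≤ F y) (hH : ∀ y, 0 < y → 0 ≤ H y)
    (hsup : ∀ y, 0 < y → F y + M * ∑ j, H (y * p j) ≤ H y) {y : ℝ} (hy : 0 < y) :
    (Summable fun x : List (Fin M × Fin A) => F (y * weight p x)) ∧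
      ∑' x : List (Fin M × Fin A), F (y * weight p x) ≤ H y := by
  -- Only words shorter than `d` are summed, and each additional level costs one application of
  -- `hsup`. Every finite set of words lies below some depth, which gives the full sum.
  have key : ∀ d : ℕ, ∀ y, 0 < y → ∑' x : List (Fin M × Fin A),
      (if x.length < d then ENNReal.ofReal (F (y * weight p x)) else 0) ≤
        ENNReal.ofReal (H y) := by
    intro d
    induction d with
    | zero => intro y hy; simp
    | succ d ih =>
      intro y hy
      rw [ennreal_tsum_list, tsum_fintype]
      simp only [List.length_nil, Nat.succ_pos, if_true, weight_nil, mul_one, List.length_cons,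
        Nat.succ_lt_succ_iff, weight_cons]
      calc _ ≤ ENNReal.ofReal (F y) + ∑ a : Fin M × Fin A, ENNReal.ofReal (H (y * p a.2)) := by
            gcongr with a
            have := ih (y * p a.2) (mul_pos hy (hp a.2).1)
            simpa only [mul_assoc] using this
        _ = ENNReal.ofReal (F y + M * ∑ j, H (y * p j)) := by
            rw [← ENNReal.ofReal_sum_of_nonneg fun a _ => hH _ (mul_pos hy (hp a.2).1),
              sum_prod_snd fun j => H (y * p j), ENNReal.ofReal_add (hF y hy)]
            exact mul_nonneg (by positivity)
              (Finset.sum_nonneg fun j _ => hH _ (mul_pos hy (hp j).1))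
        _ ≤ _ := ENNReal.ofReal_le_ofReal (hsup y hy)
  have hle : ∀ s : Finset (List (Fin M × Fin A)), ∑ x ∈ s, F (y * weight p x) ≤ H y := by
    intro s
    rw [← ENNReal.ofReal_le_ofReal_iff (hH y hy),
      ENNReal.ofReal_sum_of_nonneg fun x _ => hF _ (mul_pos hy (weight_pos hp x))]
    refine le_trans ?_ (key (s.sup List.length + 1) y hy)
    refine le_trans (Finset.sum_le_sum fun x hx => ?_) (ENNReal.sum_le_tsum s)
    rw [if_pos (Nat.lt_succ_of_le (Finset.le_sup (f := List.length) hx))]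
  have hs := summable_of_sum_le (fun x => hF _ (mul_pos hy (weight_pos hp x))) hle
  exact ⟨hs, hs.tsum_le_of_sum_le hle⟩

theorem tsum_list {α : Type*} [Fintype α] {F : List α → ℝ} (hF : Summable F) :
    ∑' x, F x = F [] + ∑ a, ∑' x, F (a :: x) := by
  let e : Unit ⊕ (α × List α) ≃ List α :=
    { toFun := Sum.elim (fun _ => []) (fun q => q.1 :: q.2)
      invFun := fun x => match x with
        | [] => Sum.inl ()
        | a :: x => Sum.inr (a, x)
      left_inv := by rintro (⟨⟩ | ⟨a, x⟩) <;> rfl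
      right_inv := by rintro (_ | ⟨a, x⟩) <;> rfl }
  have h1 : Summable fun q => F (e q) := e.summable_iff.2 hF
  have h2 : Summable fun q : α × List α => F (q.1 :: q.2) :=
    h1.comp_injective (i := Sum.inr) Sum.inr_injective
  rw [← e.tsum_eq, Summable.tsum_sum (f := fun q => F (e q)) (Summable.of_finite) h2,
    show (∑' q : α × List α, F (e (Sum.inr q))) = ∑' a, ∑' x, F (a :: x) from h2.tsum_prod,
    tsum_fintype, tsum_fintype]
  simp [e]

end Weights

/-! ### The mean size as a series over words -/

/-- The probability that at least two of `n` independent events of probability `q` occur. -/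
def atLeastTwo (n : ℕ) (q : ℝ) : ℝ := 1 - (1 - q) ^ n - n * q * (1 - q) ^ (n - 1)

/-- The new event raises the count to two exactly when it occurs and one of the first `n` events has
occurred. For `n = 0` the truncated exponent is harmless because of the factor `n`. -/
theorem atLeastTwo_succ (n : ℕ) (q : ℝ) :
    atLeastTwo (n + 1) q = atLeastTwo n q + n * q ^ 2 * (1 - q) ^ (n - 1) := by
  cases n with
  | zero => simp [atLeastTwo]
  | succ n => simp only [atLeastTwo, Nat.add_sub_cancel]; push_cast; ring

theorem atLeastTwo_nonneg (n : ℕ) {q : ℝ} (hq1 : q ≤ 1) : 0 ≤ atLeastTwo n q := by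
  induction n with
  | zero => simp [atLeastTwo]
  | succ n ih =>
    rw [atLeastTwo_succ]
    have : 0 ≤ 1 - q := by linarith
    positivity

theorem atLeastTwo_le (n : ℕ) {q : ℝ} (hq : 0 ≤ q) (hq1 : q ≤ 1) :
    atLeastTwo n q ≤ n ^ 2 * q ^ 2 := by
  induction n with
  | zero => simp [atLeastTwo]
  | succ n ih =>
    rw [atLeastTwo_succ]
    have h1 : (1 - q) ^ (n - 1) ≤ 1 := pow_le_one₀ (by linarith) (by linarith)
    have h2 : n * q ^ 2 * (1 - q) ^ (n - 1) ≤ n * q ^ 2 * 1 :=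
      mul_le_mul_of_nonneg_left h1 (by positivity)
    have h3 : (0 : ℝ) ≤ n := by positivity
    push_cast
    nlinarith [sq_nonneg q, mul_nonneg h3 (sq_nonneg q)]

section Model

variable {M A : ℕ} {p : Fin A → ℝ} {Ω : Type*} [MeasurableSpace Ω] {μ : Measure Ω}
  [IsProbabilityMeasure μ] {X : ℕ → Edge M → Ω → Fin A}

@[simp] theorem rootCount_zero (r : Fin 0 → Fin M → Fin A) (a : Fin M × Fin A) :
    rootCount r a = 0 := Nat.le_zero.1 (rootCount_le r a)

theorem rootCount_succ (X : ℕ → Edge M → Ω → Fin A) (n : ℕ) (ω : Ω) (a : Fin M × Fin A) :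
    rootCount (rootLabels X (n + 1) ω) a =
      rootCount (rootLabels X n ω) a + if X n ([], a.1) ω = a.2 then 1 else 0 := by
  simp only [rootCount, fiber, Finset.card_filter]
  rw [Fin.sum_univ_castSucc]
  simp only [rootLabels, Fin.val_castSucc, Fin.val_last]
  congr

theorem IsModel.iIndepFun_root (h : IsModel p μ X) :
    iIndepFun (fun (k : ℕ) ω (i : Fin M) => X k ([], i) ω) μ := by
  refine iIndepFun_sigma_curry (fun _ _ => h.meas _ _) (h.indep.precomp
    (g := fun q : (_ : ℕ) × Fin M => (q.1, ([], q.2))) ?_)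
  rintro ⟨k, i⟩ ⟨k', i'⟩ hq
  simpa using hq

theorem IsModel.indepFun_root_rootLabels (h : IsModel p μ X) (n : ℕ) :
    IndepFun (fun ω (i : Fin M) => X n ([], i) ω) (rootLabels X n) μ := by
  have h1 := h.iIndepFun_root.indepFun_finset {n} (Finset.range n) (by simp)
    (fun k => measurable_pi_iff.2 fun _ => h.meas _ _)
  refine h1.comp (φ := fun L => L ⟨n, by simp⟩)
    (ψ := fun L (k : Fin n) => L ⟨k, by simp⟩) ?_ ?_
  · exact measurable_pi_apply _
  · exact measurable_pi_iff.2 fun k => measurable_pi_apply _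

theorem IsModel.integrable_comp_rootLabels (h : IsModel p μ X) {n : ℕ}
    (φ : (Fin n → Fin M → Fin A) → ℝ) : Integrable (fun ω => φ (rootLabels X n ω)) μ := by
  refine (integrable_map_measure (measurable_of_finite φ).aestronglyMeasurable
    (h.measurable_rootLabels n).aemeasurable).1 Integrable.of_finite

theorem IsModel.measureReal_eq (h : IsModel p μ X) (hp : ∀ j, 0 < p j ∧ p j < 1) (k : ℕ)
    (e : Edge M) (j : Fin A) : μ.real {ω | X k e ω = j} = p j := by
  have := h.law k e j
  rw [measureReal_def]
  change (μ (X k e ⁻¹' {j})).toReal = _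
  rw [this, ENNReal.toReal_ofReal (hp j).1.le]

theorem IsModel.integral_indicator (h : IsModel p μ X) (hp : ∀ j, 0 < p j ∧ p j < 1) (k : ℕ)
    (e : Edge M) (j : Fin A) : ∫ ω, (if X k e ω = j then (1 : ℝ) else 0) ∂μ = p j := by
  rw [← h.measureReal_eq hp k e j, ← integral_indicator_one
    (show MeasurableSet {ω | X k e ω = j} from h.meas k e (MeasurableSet.singleton j))]
  exact integral_congr_ae (Filter.Eventually.of_forall fun ω => by simp [Set.indicator])

/-- Conditioning on the last labeling. This one-step recursion replaces the explicit binomial law of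
the root counts. -/
theorem IsModel.integral_rootCount_succ (h : IsModel p μ X) (hp : ∀ j, 0 < p j ∧ p j < 1)
    (n : ℕ) (a : Fin M × Fin A) (g : ℕ → ℝ) :
    ∫ ω, g (rootCount (rootLabels X (n + 1) ω) a) ∂μ =
      (1 - p a.2) * ∫ ω, g (rootCount (rootLabels X n ω) a) ∂μ +
        p a.2 * ∫ ω, g (rootCount (rootLabels X n ω) a + 1) ∂μ := by
  have hdec : ∀ ω, g (rootCount (rootLabels X (n + 1) ω) a) =
      g (rootCount (rootLabels X n ω) a) + (if X n ([], a.1) ω = a.2 then (1 : ℝ) else 0) *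
        (g (rootCount (rootLabels X n ω) a + 1) - g (rootCount (rootLabels X n ω) a)) := by
    intro ω
    rw [rootCount_succ]
    split_ifs <;> simp
  have i1 := h.integrable_comp_rootLabels (n := n) fun r => g (rootCount r a)
  have i2 := h.integrable_comp_rootLabels (n := n) fun r => g (rootCount r a + 1)
  have hind := (h.indepFun_root_rootLabels n).comp
    (φ := fun L => if L a.1 = a.2 then (1 : ℝ) else 0)
    (ψ := fun r => g (rootCount r a + 1) - g (rootCount r a))
    (measurable_of_finite _) (measurable_of_finite _)
  have hmul := hind.integral_fun_mul_eq_mul_integral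
    (((measurable_of_finite fun L : Fin M → Fin A => if L a.1 = a.2 then (1 : ℝ) else 0).comp
      (measurable_pi_iff.2 fun i => h.meas n ([], i))).aestronglyMeasurable)
    (h.integrable_comp_rootLabels (n := n)
      fun r => g (rootCount r a + 1) - g (rootCount r a)).aestronglyMeasurable
  simp only [Function.comp_apply] at hmul
  have i3 : Integrable (fun ω => (if X n ([], a.1) ω = a.2 then (1 : ℝ) else 0) *
      (g (rootCount (rootLabels X n ω) a + 1) - g (rootCount (rootLabels X n ω) a))) μ := by
    refine (h.integrable_comp_rootLabels (n := n + 1) fun r =>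
      (if r (Fin.last n) a.1 = a.2 then (1 : ℝ) else 0) *
        (g (rootCount (fun k => r k.castSucc) a + 1) -
          g (rootCount (fun k => r k.castSucc) a))).congr ?_
    exact Filter.Eventually.of_forall fun ω => by
      simp only [rootLabels, Fin.val_last]
      rfl
  simp_rw [hdec]
  rw [integral_add i1 i3, hmul, integral_sub i2 i1, h.integral_indicator hp]
  ring

theorem IsModel.integral_pow_rootCount (h : IsModel p μ X) (hp : ∀ j, 0 < p j ∧ p j < 1)
    (n : ℕ) (a : Fin M × Fin A) (q : ℝ) :
    ∫ ω, (1 - q) ^ rootCount (rootLabels X n ω) a ∂μ = (1 - p a.2 * q) ^ n := by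
  induction n with
  | zero => simp
  | succ n ih =>
    rw [h.integral_rootCount_succ hp n a fun N => (1 - q) ^ N, ih]
    simp_rw [pow_succ (1 - q)]
    rw [integral_mul_const, ih]
    ring

/-- Thinning: a trial that is retained with probability `p a.2` and then succeeds with probability
`q` is a trial with success probability `p a.2 * q`. -/
theorem IsModel.integral_atLeastTwo_rootCount (h : IsModel p μ X) (hp : ∀ j, 0 < p j ∧ p j < 1)
    (n : ℕ) (a : Fin M × Fin A) (q : ℝ) :
    ∫ ω, atLeastTwo (rootCount (rootLabels X n ω) a) q ∂μ = atLeastTwo n (p a.2 * q) := by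
  induction n with
  | zero => simp [atLeastTwo]
  | succ n ih =>
    rw [h.integral_rootCount_succ hp n a fun N => atLeastTwo N q, ih]
    have h1 : ∀ m, ∫ ω, (rootCount (rootLabels X m ω) a : ℝ) *
        (1 - q) ^ (rootCount (rootLabels X m ω) a - 1) ∂μ =
        m * p a.2 * (1 - p a.2 * q) ^ (m - 1) := by
      intro m
      induction m with
      | zero => simp
      | succ m ihm =>
        rw [h.integral_rootCount_succ hp m a fun N => (N : ℝ) * (1 - q) ^ (N - 1), ihm]
        have e : ∀ N : ℕ, ((N + 1 : ℕ) : ℝ) * (1 - q) ^ (N + 1 - 1) =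
            (N : ℝ) * (1 - q) ^ (N - 1) * (1 - q) + (1 - q) ^ N := by
          intro N
          cases N with
          | zero => simp
          | succ N => simp only [Nat.add_sub_cancel]; push_cast; ring
        simp_rw [e]
        have i1 := h.integrable_comp_rootLabels (n := m)
          fun r => (rootCount r a : ℝ) * (1 - q) ^ (rootCount r a - 1) * (1 - q)
        have i2 := h.integrable_comp_rootLabels (n := m) fun r => (1 - q) ^ (rootCount r a)
        rw [integral_add i1 i2, integral_mul_const, ihm, h.integral_pow_rootCount hp]
        cases m with
        | zero => simp
        | succ m => simp only [Nat.add_sub_cancel]; push_cast; ring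
    have e : ∀ N : ℕ, atLeastTwo (N + 1) q =
        atLeastTwo N q + q ^ 2 * ((N : ℝ) * (1 - q) ^ (N - 1)) := by
      intro N; rw [atLeastTwo_succ]; ring
    simp_rw [e]
    have i1 := h.integrable_comp_rootLabels (n := n) fun r => atLeastTwo (rootCount r a) q
    have i2 := h.integrable_comp_rootLabels (n := n)
      fun r => q ^ 2 * ((rootCount r a : ℝ) * (1 - q) ^ (rootCount r a - 1))
    rw [integral_add i1 i2, ih, integral_const_mul, h1, atLeastTwo_succ]
    ring

theorem summable_atLeastTwo (hp : ∀ j, 0 < p j ∧ p j < 1)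
    (hexp : (M : ℝ) * ∑ j, p j ^ 2 < 1) (n : ℕ) :
    Summable fun x : List (Fin M × Fin A) => atLeastTwo n (weight p x) := by
  have h1 := (summable_of_supersolution (M := M) hp (F := fun y => y ^ 2)
    (H := fun y => y ^ 2 / (1 - M * ∑ j, p j ^ 2)) (fun y _ => sq_nonneg y)
    (fun y _ => div_nonneg (sq_nonneg y) (by linarith)) (fun y _ => by
      have h0 : 1 - (M : ℝ) * ∑ j, p j ^ 2 ≠ 0 := by linarith
      refine le_of_eq ?_
      rw [← Finset.sum_div]
      simp_rw [mul_pow]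
      rw [← Finset.mul_sum]
      field_simp
      ring) one_pos).1
  simp only [one_mul] at h1
  exact Summable.of_nonneg_of_le (fun x => atLeastTwo_nonneg n (weight_le_one hp x))
    (fun x => atLeastTwo_le n (weight_pos hp x).le (weight_le_one hp x)) (h1.mul_left _)

/-- The two sides obey the same recurrence. By strong induction only subtries with all `n` labelings
contribute to their difference, which is therefore multiplied by `M * ∑ j, p j ^ n < 1` and must
vanish. -/
theorem IsModel.meanSize_eq_tsum (h : IsModel p μ X) (hp : ∀ j, 0 < p j ∧ p j < 1)
    (hexp : (M : ℝ) * ∑ j, p j ^ 2 < 1) (n : ℕ) :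
    meanSize μ X n = ∑' x : List (Fin M × Fin A), atLeastTwo n (weight p x) := by
  induction n using Nat.strong_induction_on with
  | _ n ihn =>
  rcases lt_or_ge n 2 with hn | hn
  · rw [meanSize_of_lt_two hn]
    have : ∀ x : List (Fin M × Fin A), atLeastTwo n (weight p x) = 0 := by
      intro x
      interval_cases n <;> simp [atLeastTwo]
    simp [this]
  set Fs : ℕ → ℝ := fun N => ∑' x : List (Fin M × Fin A), atLeastTwo N (weight p x) with hFs
  have hrec : Fs n = ∫ ω, (1 + ∑ a, Fs (rootCount (rootLabels X n ω) a)) ∂μ := by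
    have i1 : ∀ a, Integrable (fun ω => Fs (rootCount (rootLabels X n ω) a)) μ := fun a =>
      h.integrable_comp_rootLabels fun r => Fs (rootCount r a)
    rw [integral_add (integrable_const _) (integrable_finsetSum _ fun a _ => i1 a),
      integral_finsetSum _ fun a _ => i1 a, hFs]
    simp only [integral_const, probReal_univ, smul_eq_mul, mul_one]
    rw [tsum_list (summable_atLeastTwo hp hexp n)]
    congr 1
    · simp [atLeastTwo, show n ≠ 0 by omega, show n - 1 ≠ 0 by omega]
    · refine Finset.sum_congr rfl fun a _ => ?_
      have e1 : ∀ x : List (Fin M × Fin A), atLeastTwo n (weight p (a :: x)) =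
          ∑ r, μ.real (rootLabels X n ⁻¹' {r}) * atLeastTwo (rootCount r a) (weight p x) := by
        intro x
        rw [weight_cons, ← h.integral_atLeastTwo_rootCount hp,
          ← h.sum_rootLabels fun r => atLeastTwo (rootCount r a) (weight p x)]
      simp_rw [e1]
      rw [Summable.tsum_finsetSum fun r _ => (summable_atLeastTwo hp hexp _).mul_left _,
        ← h.sum_rootLabels fun r => ∑' x : List (Fin M × Fin A),
          atLeastTwo (rootCount r a) (weight p x)]
      exact Finset.sum_congr rfl fun r _ => tsum_mul_left
  have hdiff : meanSize μ X n - Fs n = (M * ∑ j, p j ^ n) * (meanSize μ X n - Fs n) := by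
    have i1 := h.integrable_comp_rootLabels (n := n) fun r =>
      1 + ∑ a, meanSize μ X (rootCount r a)
    have i2 := h.integrable_comp_rootLabels (n := n) fun r => 1 + ∑ a, Fs (rootCount r a)
    have e : ∀ ω, (1 + ∑ a, meanSize μ X (rootCount (rootLabels X n ω) a)) -
        (1 + ∑ a, Fs (rootCount (rootLabels X n ω) a)) =
        ∑ a, (if rootCount (rootLabels X n ω) a = n then 1 else 0) *
          (meanSize μ X n - Fs n) := by
      intro ω
      rw [add_sub_add_left_eq_sub, ← Finset.sum_sub_distrib]
      refine Finset.sum_congr rfl fun a _ => ?_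
      split_ifs with ha
      · rw [ha, one_mul]
      · rw [ihn _ (lt_of_le_of_ne (rootCount_le _ a) ha), sub_self, zero_mul]
    have i3 : ∀ a, Integrable (fun ω => (if rootCount (rootLabels X n ω) a = n then (1 : ℝ) else 0)
        * (meanSize μ X n - Fs n)) μ := fun a => h.integrable_comp_rootLabels (n := n)
      fun r => (if rootCount r a = n then (1 : ℝ) else 0) * (meanSize μ X n - Fs n)
    calc meanSize μ X n - Fs n
        = ∫ ω, ((1 + ∑ a, meanSize μ X (rootCount (rootLabels X n ω) a)) -
          (1 + ∑ a, Fs (rootCount (rootLabels X n ω) a))) ∂μ := by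
          rw [integral_sub i1 i2, ← h.meanSize_eq hp hexp hn, ← hrec]
      _ = _ := by
          simp_rw [e]
          rw [integral_finsetSum _ fun a _ => i3 a, ← sum_prod_snd fun j => p j ^ n,
            Finset.sum_mul]
          refine Finset.sum_congr rfl fun a _ => ?_
          rw [integral_mul_const]
          congr 1
          have h2 : MeasurableSet {ω | rootCount (rootLabels X n ω) a = n} :=
            (measurable_of_finite (fun r : Fin n → Fin M → Fin A => rootCount r a)).comp
              (h.measurable_rootLabels n) (MeasurableSet.singleton n)
          have h3 := h.measure_rootCount_eq n a
          rw [← ENNReal.ofReal_pow (hp a.2).1.le] at h3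
          have h4 : μ.real {ω | rootCount (rootLabels X n ω) a = n} = p a.2 ^ n := by
            rw [measureReal_def, h3, ENNReal.toReal_ofReal (pow_nonneg (hp a.2).1.le n)]
          rw [← h4, ← integral_indicator_one h2]
          exact integral_congr_ae (Filter.Eventually.of_forall fun ω => by simp [Set.indicator])
  have hθ : M * ∑ j, p j ^ n < 1 := by
    refine lt_of_le_of_lt ?_ hexp
    exact mul_le_mul_of_nonneg_left (Finset.sum_le_sum fun j _ =>
      pow_le_pow_of_le_one (hp j).1.le (hp j).2.le hn) (by positivity)
  have : (1 - M * ∑ j, p j ^ n) * (meanSize μ X n - Fs n) = 0 := by linarith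
  rcases mul_eq_zero.1 this with h0 | h0 <;> linarith

/-- The increments of the mean size. -/
theorem IsModel.meanSize_succ_sub (h : IsModel p μ X) (hp : ∀ j, 0 < p j ∧ p j < 1)
    (hexp : (M : ℝ) * ∑ j, p j ^ 2 < 1) (n : ℕ) :
    meanSize μ X (n + 1) - meanSize μ X n =
      ∑' x : List (Fin M × Fin A), n * weight p x ^ 2 * (1 - weight p x) ^ (n - 1) := by
  rw [h.meanSize_eq_tsum hp hexp, h.meanSize_eq_tsum hp hexp,
    ← (summable_atLeastTwo hp hexp _).tsum_sub (summable_atLeastTwo hp hexp _)]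
  refine tsum_congr fun x => ?_
  rw [atLeastTwo_succ]
  ring

end Model

/-! ### The renewal equation behind the increments of the mean -/

/-- The assumptions on the letter probabilities `p` and the exponent `ρ`. -/
structure IsParam (M : ℕ) {A : ℕ} (p : Fin A → ℝ) (ρ : ℝ) : Prop where
  pos : ∀ j, 0 < p j ∧ p j < 1
  root : (M : ℝ) * ∑ j, p j ^ ρ = 1
  one_lt : 1 < ρ
  lt_two : ρ < 2

/-- The function `y ↦ y ^ (2 - ρ) e ^ (-y)`. -/
def kern (ρ y : ℝ) : ℝ := y ^ (2 - ρ) * Real.exp (-y)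

/-- The solution of the renewal equation for the function `kern`. -/
def renewal (M : ℕ) {A : ℕ} (p : Fin A → ℝ) (ρ y : ℝ) : ℝ :=
  y ^ (-ρ) * ∑' x : List (Fin M × Fin A), (y * weight p x) ^ 2 * Real.exp (-(y * weight p x))

/-- The polynomial bound used for the renewal sums. -/
def bigKern (y : ℝ) : ℝ := (y ^ 2 + y ^ 3 + y ^ 4) * Real.exp (-y)

section Renewal

variable {M A : ℕ} {p : Fin A → ℝ} {ρ : ℝ}

theorem IsParam.pos_M (h : IsParam M p ρ) : 0 < M := by
  rcases Nat.eq_zero_or_pos M with hM | hM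
  · have := h.root
    simp [hM] at this
  · exact hM

theorem IsParam.pos_A (h : IsParam M p ρ) : 0 < A := by
  rcases Nat.eq_zero_or_pos A with hA | hA
  · subst hA
    have := h.root
    simp at this
  · exact hA

/-- The probabilities of the tilted letters. -/
def tilt (M : ℕ) {A : ℕ} (p : Fin A → ℝ) (ρ : ℝ) (j : Fin A) : ℝ := M * p j ^ ρ

theorem IsParam.tilt_pos (h : IsParam M p ρ) (j : Fin A) : 0 < tilt M p ρ j := by
  have := h.pos_M
  have := (h.pos j).1
  unfold tilt
  positivity

theorem IsParam.sum_tilt (h : IsParam M p ρ) : ∑ j, tilt M p ρ j = 1 := by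
  simp only [tilt, ← Finset.mul_sum, h.root]

theorem bigKern_nonneg {y : ℝ} (hy : 0 ≤ y) : 0 ≤ bigKern y := by
  unfold bigKern; positivity

theorem bigKern_le {ε y : ℝ} (hε1 : ε ≤ 1) (hε0 : 0 < ε) (hy : 0 < y) :
    bigKern y ≤ 30 * (y ^ 2 / (1 + y ^ ε) ^ 2) := by
  have h1 : y ^ ε ≤ 1 + y := by
    rcases le_or_gt y 1 with h | h
    · exact (Real.rpow_le_one hy.le h hε0.le).trans (by linarith)
    · calc y ^ ε ≤ y ^ (1 : ℝ) := Real.rpow_le_rpow_of_exponent_le h.le hε1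
        _ ≤ 1 + y := by rw [Real.rpow_one]; linarith
  have h0 : 0 < y ^ ε := Real.rpow_pos_of_pos hy ε
  have h2 : (1 + y ^ ε) ^ 2 ≤ (2 + y) ^ 2 :=
    pow_le_pow_left₀ (by positivity) (by linarith) 2
  -- The constant `30` is dictated by the cubic coefficient: it is `5` on the left and `30 / 6` in
  -- the Taylor polynomial of degree four on the right.
  have h3 : (1 + y + y ^ 2) * (2 + y) ^ 2 ≤ 30 * Real.exp y := by
    have := Real.sum_le_exp_of_nonneg hy.le 5
    simp only [Finset.sum_range_succ, Finset.sum_range_zero, Nat.factorial] at this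
    norm_num at this
    nlinarith [pow_pos hy 2, pow_pos hy 3, pow_pos hy 4]
  rw [bigKern, mul_div_assoc', le_div_iff₀ (by positivity), Real.exp_neg]
  have h4 : (1 + y + y ^ 2) * (1 + y ^ ε) ^ 2 ≤ 30 * Real.exp y :=
    (mul_le_mul_of_nonneg_left h2 (by positivity)).trans h3
  calc (y ^ 2 + y ^ 3 + y ^ 4) * (Real.exp y)⁻¹ * (1 + y ^ ε) ^ 2
      = y ^ 2 * ((1 + y + y ^ 2) * (1 + y ^ ε) ^ 2) * (Real.exp y)⁻¹ := by ring
    _ ≤ y ^ 2 * (30 * Real.exp y) * (Real.exp y)⁻¹ := by gcongr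
    _ = 30 * y ^ 2 := by field_simp

theorem rpow_two_split {y ρ : ℝ} (hy : 0 < y) : y ^ ρ * y ^ (2 - ρ) = y ^ 2 := by
  rw [← Real.rpow_add hy, add_sub_cancel, Real.rpow_two]

/-- A multiple of `y ^ 2 / (1 + y ^ ε)` with `ε = 2 - ρ` is a supersolution. One step of the
recursion lowers this function by at least `κ * (y ^ 2 / (1 + y ^ ε) ^ 2)`, where `κ > 0` because
every `p j ^ ε` is smaller than one, and this loss pays for `bigKern`. -/
theorem IsParam.bigKern_sum (h : IsParam M p ρ) : ∃ C : ℝ, 0 < C ∧ ∀ y, 0 < y →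
    (Summable fun x : List (Fin M × Fin A) => bigKern (y * weight p x)) ∧
      ∑' x : List (Fin M × Fin A), bigKern (y * weight p x) ≤ C * (y ^ 2 / (1 + y ^ (2 - ρ))) := by
  set ε := 2 - ρ with hε
  have hε0 : 0 < ε := by linarith [h.lt_two]
  have hε1 : ε ≤ 1 := by linarith [h.one_lt]
  let κ := ∑ j, tilt M p ρ j * (1 - p j ^ ε)
  have hκ : 0 < κ := by
    have : Nonempty (Fin A) := ⟨⟨0, h.pos_A⟩⟩
    refine Finset.sum_pos (fun j _ => mul_pos (h.tilt_pos j) ?_) Finset.univ_nonempty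
    linarith [Real.rpow_lt_one (h.pos j).1.le (h.pos j).2 hε0]
  refine ⟨30 / κ, by positivity, fun y hy => ?_⟩
  refine summable_of_supersolution h.pos (H := fun y => 30 / κ * (y ^ 2 / (1 + y ^ ε)))
    (fun y hy => bigKern_nonneg hy.le) (fun y hy => ?_) (fun y hy => ?_) hy
  · have := Real.rpow_pos_of_pos hy ε
    positivity
  · have hy' : 0 < y ^ ε := Real.rpow_pos_of_pos hy ε
    have key : ∀ j, (M : ℝ) * ((y * p j) ^ 2 / (1 + (y * p j) ^ ε)) ≤
        tilt M p ρ j * (y ^ 2 / (1 + y ^ ε)) -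
          tilt M p ρ j * (1 - p j ^ ε) * (y ^ 2 / (1 + y ^ ε) ^ 2) := by
      intro j
      have hpj := (h.pos j).1
      set q := p j ^ ε with hq
      have hq0 : 0 < q := Real.rpow_pos_of_pos hpj ε
      have hq1 : q < 1 := Real.rpow_lt_one hpj.le (h.pos j).2 hε0
      rw [Real.mul_rpow hy.le hpj.le, ← hq, mul_pow, ← rpow_two_split (ρ := ρ) hpj, ← hε, ← hq]
      set t := y ^ ε
      -- With `t = y ^ ε` and `q = p j ^ ε`, this exact identity shows that the deficit of the
      -- supersolution inequality is nonnegative for each letter separately.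
      have e1 : 1 / (1 + t) - (1 - q) / (1 + t) ^ 2 - q / (1 + t * q) =
          (1 - q) ^ 2 * t / ((1 + t) ^ 2 * (1 + t * q)) := by
        field_simp
        ring
      have e2 : 0 ≤ (1 - q) ^ 2 * t / ((1 + t) ^ 2 * (1 + t * q)) := by positivity
      have e3 : tilt M p ρ j * (y ^ 2 / (1 + t)) -
          tilt M p ρ j * (1 - q) * (y ^ 2 / (1 + t) ^ 2) -
          (M : ℝ) * (y ^ 2 * (p j ^ ρ * q) / (1 + t * q)) =
          tilt M p ρ j * y ^ 2 * (1 / (1 + t) - (1 - q) / (1 + t) ^ 2 - q / (1 + t * q)) := by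
        unfold tilt
        ring
      have e4 : 0 ≤ tilt M p ρ j * y ^ 2 *
          (1 / (1 + t) - (1 - q) / (1 + t) ^ 2 - q / (1 + t * q)) := by
        rw [e1]
        exact mul_nonneg (mul_nonneg (h.tilt_pos j).le (sq_nonneg y)) e2
      linarith
    have hsum := Finset.sum_le_sum fun j (_ : j ∈ Finset.univ) => key j
    rw [Finset.sum_sub_distrib, ← Finset.sum_mul, ← Finset.sum_mul, h.sum_tilt, one_mul,
      ← Finset.mul_sum] at hsum
    have h1 := bigKern_le hε1 hε0 hy
    have h2 : 30 / κ * (M * ∑ j, (y * p j) ^ 2 / (1 + (y * p j) ^ ε)) ≤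
        30 / κ * (y ^ 2 / (1 + y ^ ε) - κ * (y ^ 2 / (1 + y ^ ε) ^ 2)) :=
      mul_le_mul_of_nonneg_left hsum (by positivity)
    have h3 : 30 / κ * (y ^ 2 / (1 + y ^ ε) - κ * (y ^ 2 / (1 + y ^ ε) ^ 2)) =
        30 / κ * (y ^ 2 / (1 + y ^ ε)) - 30 * (y ^ 2 / (1 + y ^ ε) ^ 2) := by
      field_simp
    simp only [← Finset.mul_sum]
    linarith

theorem kernSq_le {y : ℝ} (hy : 0 ≤ y) : y ^ 2 * Real.exp (-y) ≤ bigKern y := by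
  unfold bigKern
  gcongr
  nlinarith [pow_nonneg hy 3, pow_nonneg hy 4]

theorem IsParam.summable_kernSq (h : IsParam M p ρ) {y : ℝ} (hy : 0 < y) :
    Summable fun x : List (Fin M × Fin A) =>
      (y * weight p x) ^ 2 * Real.exp (-(y * weight p x)) := by
  obtain ⟨C, -, hC⟩ := h.bigKern_sum
  exact Summable.of_nonneg_of_le (fun x => by positivity)
    (fun x => kernSq_le (mul_pos hy (weight_pos h.pos x)).le) (hC y hy).1

theorem rpow_neg_mul_sq {y ρ : ℝ} (hy : 0 < y) : y ^ (-ρ) * y ^ 2 = y ^ (2 - ρ) := by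
  rw [← Real.rpow_two, ← Real.rpow_add hy]; ring_nf

theorem renewal_nonneg {y : ℝ} (hy : 0 < y) : 0 ≤ renewal M p ρ y := by
  unfold renewal
  refine mul_nonneg (Real.rpow_nonneg hy.le _) (tsum_nonneg fun x => by positivity)

/-- The first bound controls large arguments; the second makes the solution integrable and summable
towards `-∞` in the logarithmic scale. -/
theorem IsParam.renewal_le (h : IsParam M p ρ) : ∃ C : ℝ, 0 < C ∧ ∀ y, 0 < y →
    renewal M p ρ y ≤ C ∧ renewal M p ρ y ≤ C * y ^ (2 - ρ) := by
  obtain ⟨C, hC0, hC⟩ := h.bigKern_sum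
  refine ⟨C, hC0, fun y hy => ?_⟩
  have h1 : renewal M p ρ y ≤ y ^ (-ρ) * (C * (y ^ 2 / (1 + y ^ (2 - ρ)))) := by
    unfold renewal
    gcongr
    exact ((h.summable_kernSq hy).tsum_le_tsum
      (fun x => kernSq_le (mul_pos hy (weight_pos h.pos x)).le) (hC y hy).1).trans (hC y hy).2
  have h2 : y ^ (-ρ) * (C * (y ^ 2 / (1 + y ^ (2 - ρ)))) =
      C * (y ^ (2 - ρ) / (1 + y ^ (2 - ρ))) := by
    rw [← rpow_neg_mul_sq hy]; ring
  have h3 : 0 < y ^ (2 - ρ) := Real.rpow_pos_of_pos hy _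
  rw [h2] at h1
  refine ⟨h1.trans ?_, h1.trans ?_⟩
  · refine mul_le_of_le_one_right hC0.le ?_
    rw [div_le_one (by positivity)]
    linarith
  · gcongr
    exact div_le_self h3.le (by linarith)

/-- The renewal equation. -/
theorem IsParam.renewal_eq (h : IsParam M p ρ) {y : ℝ} (hy : 0 < y) :
    renewal M p ρ y = kern ρ y + ∑ j, tilt M p ρ j * renewal M p ρ (y * p j) := by
  have h1 : ∀ j, tilt M p ρ j * renewal M p ρ (y * p j) = M * (y ^ (-ρ) *
      ∑' x : List (Fin M × Fin A), (y * (p j * weight p x)) ^ 2 *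
        Real.exp (-(y * (p j * weight p x)))) := by
    intro j
    have hpj := (h.pos j).1
    simp only [renewal, tilt, Real.mul_rpow hy.le hpj.le, ← mul_assoc y (p j)]
    have : p j ^ ρ * p j ^ (-ρ) = 1 := by rw [← Real.rpow_add hpj]; simp
    linear_combination (M * y ^ (-ρ) * ∑' x : List (Fin M × Fin A), (y * p j * weight p x) ^ 2 *
        Real.exp (-(y * p j * weight p x))) * this
  simp_rw [h1]
  rw [← Finset.mul_sum, ← sum_prod_snd fun j => y ^ (-ρ) *
      ∑' x : List (Fin M × Fin A), (y * (p j * weight p x)) ^ 2 *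
        Real.exp (-(y * (p j * weight p x))), ← Finset.mul_sum, renewal,
    tsum_list (h.summable_kernSq hy)]
  simp only [weight_nil, weight_cons, mul_one, mul_add, kern, ← rpow_neg_mul_sq hy]
  ring

theorem IsParam.exists_bounds (h : IsParam M p ρ) :
    ∃ b : ℝ, 0 < b ∧ b < 1 ∧ ∀ j, b ≤ p j ∧ p j ≤ 1 - b := by
  have : Nonempty (Fin A) := ⟨⟨0, h.pos_A⟩⟩
  obtain ⟨j0, hj0⟩ := Finite.exists_min fun j => min (p j) (1 - p j)
  refine ⟨min (p j0) (1 - p j0), ?_, ?_, fun j => ?_⟩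
  · exact lt_min (h.pos j0).1 (by linarith [(h.pos j0).2])
  · exact (min_le_left _ _).trans_lt (h.pos j0).2
  · have := hj0 j
    have h1 := this.trans (min_le_left _ _)
    have h2 := this.trans (min_le_right _ _)
    exact ⟨h1, by linarith⟩

theorem kern_nonneg {y : ℝ} (hy : 0 ≤ y) : 0 ≤ kern ρ y := by
  unfold kern; positivity

/-- The solution of the renewal equation is bounded below. -/
theorem IsParam.le_renewal (h : IsParam M p ρ) :
    ∃ c : ℝ, 0 < c ∧ ∀ y, 1 ≤ y → c ≤ renewal M p ρ y := by
  obtain ⟨b, hb0, hb1, hb⟩ := h.exists_bounds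
  refine ⟨Real.exp (-(1 / b)), Real.exp_pos _, ?_⟩
  -- The equation is iterated until the argument lies in `[1, 1 / b]`, where the kernel alone is at
  -- least `exp (-(1 / b))`. This interval cannot be jumped over, since `y * b > 1` implies `y * p j
  -- > 1`; and each step shrinks the argument by at least the factor `1 - b`.
  have key : ∀ N : ℕ, ∀ y, 1 ≤ y → y * (1 - b) ^ N ≤ 1 →
      Real.exp (-(1 / b)) ≤ renewal M p ρ y := by
    intro N
    have hsmall : ∀ y, 1 ≤ y → y * b ≤ 1 → Real.exp (-(1 / b)) ≤ renewal M p ρ y := by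
      intro y hy hyb
      have hy0 : 0 < y := by linarith
      rw [h.renewal_eq hy0]
      have h1 : 0 ≤ ∑ j, tilt M p ρ j * renewal M p ρ (y * p j) := Finset.sum_nonneg fun j _ =>
        mul_nonneg (h.tilt_pos j).le (renewal_nonneg (mul_pos hy0 (h.pos j).1))
      have h2 : Real.exp (-(1 / b)) ≤ kern ρ y := by
        unfold kern
        have h3 : 1 ≤ y ^ (2 - ρ) := Real.one_le_rpow hy (by linarith [h.lt_two])
        have h4 : Real.exp (-(1 / b)) ≤ Real.exp (-y) := by
          rw [Real.exp_le_exp, neg_le_neg_iff, le_div_iff₀ hb0]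
          exact hyb
        nlinarith [Real.exp_pos (-y)]
      linarith
    induction N with
    | zero =>
      intro y hy hyN
      exact hsmall y hy (by nlinarith [show y ≤ 1 by simpa using hyN])
    | succ N ih =>
      intro y hy hyN
      have hy0 : 0 < y := by linarith
      rcases le_or_gt (y * b) 1 with h1 | h1
      · exact hsmall y hy h1
      · rw [h.renewal_eq hy0]
        have h2 : ∀ j, Real.exp (-(1 / b)) ≤ renewal M p ρ (y * p j) := fun j => by
          refine ih _ ?_ ?_
          · exact h1.le.trans (by gcongr; exact (hb j).1)
          · refine le_trans ?_ hyN
            rw [pow_succ', ← mul_assoc]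
            have : (0 : ℝ) ≤ 1 - b := by linarith
            gcongr
            exact (hb j).2
        have h3 : ∑ j, tilt M p ρ j * Real.exp (-(1 / b)) ≤
            ∑ j, tilt M p ρ j * renewal M p ρ (y * p j) :=
          Finset.sum_le_sum fun j _ => mul_le_mul_of_nonneg_left (h2 j) (h.tilt_pos j).le
        rw [← Finset.sum_mul, h.sum_tilt, one_mul] at h3
        linarith [kern_nonneg (ρ := ρ) hy0.le]
  intro y hy
  have hy0 : 0 < y := by linarith
  obtain ⟨N, hN⟩ := exists_pow_lt_of_lt_one (show 0 < 1 / y by positivity)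
    (show 1 - b < 1 by linarith)
  refine key N y hy ?_
  rw [lt_div_iff₀ hy0] at hN
  linarith

/-- Two effects are compared: `lam ^ (2 - ρ)` lies between `1` and `lam`, and the exponential
decreases by at most the fraction `(lam - 1) * z`. The second one is the reason for the cubic term
in `bigKern`. -/
theorem kernSq_sub_le {lam z : ℝ} (hlam : 1 ≤ lam) (hz : 0 < z) (hρ : 1 < ρ) (hρ2 : ρ < 2) :
    |lam ^ (-ρ) * ((lam * z) ^ 2 * Real.exp (-(lam * z))) - z ^ 2 * Real.exp (-z)| ≤
      (lam - 1) * bigKern z := by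
  have hl0 : 0 < lam := by linarith
  have e1 : lam ^ (-ρ) * ((lam * z) ^ 2 * Real.exp (-(lam * z))) =
      lam ^ (2 - ρ) * (z ^ 2 * Real.exp (-(lam * z))) := by
    rw [← rpow_neg_mul_sq hl0]; ring
  rw [e1]
  have h1 : 1 ≤ lam ^ (2 - ρ) := Real.one_le_rpow hlam (by linarith)
  have h2 : lam ^ (2 - ρ) ≤ lam := by
    calc lam ^ (2 - ρ) ≤ lam ^ (1 : ℝ) := Real.rpow_le_rpow_of_exponent_le hlam (by linarith)
      _ = lam := Real.rpow_one _
  have h3 : Real.exp (-(lam * z)) ≤ Real.exp (-z) := Real.exp_le_exp.2 (by nlinarith)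
  have h4 : Real.exp (-z) * (1 - (lam - 1) * z) ≤ Real.exp (-(lam * z)) := by
    have := Real.add_one_le_exp (-((lam - 1) * z))
    calc Real.exp (-z) * (1 - (lam - 1) * z) ≤ Real.exp (-z) * Real.exp (-((lam - 1) * z)) := by
          gcongr; linarith
      _ = Real.exp (-(lam * z)) := by rw [← Real.exp_add]; ring_nf
  have hE := Real.exp_pos (-z)
  have hE' := Real.exp_pos (-(lam * z))
  have hz2 : 0 < z ^ 2 := by positivity
  unfold bigKern
  rw [abs_le]
  constructor
  · have a1 : z ^ 2 * Real.exp (-(lam * z)) ≤ lam ^ (2 - ρ) * (z ^ 2 * Real.exp (-(lam * z))) :=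
      le_mul_of_one_le_left (by positivity) h1
    have a2 : z ^ 2 * (Real.exp (-z) * (1 - (lam - 1) * z)) ≤ z ^ 2 * Real.exp (-(lam * z)) := by
      gcongr
    have a3 : 0 ≤ (lam - 1) * (z ^ 2 * Real.exp (-z)) :=
      mul_nonneg (by linarith) (by positivity)
    have a4 : 0 ≤ (lam - 1) * (z ^ 4 * Real.exp (-z)) :=
      mul_nonneg (by linarith) (by positivity)
    nlinarith
  · have a1 : lam ^ (2 - ρ) * (z ^ 2 * Real.exp (-(lam * z))) ≤ lam * (z ^ 2 * Real.exp (-z)) := by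
      gcongr
    have a3 : 0 ≤ (lam - 1) * (z ^ 3 * Real.exp (-z)) :=
      mul_nonneg (by linarith) (by positivity)
    have a4 : 0 ≤ (lam - 1) * (z ^ 4 * Real.exp (-z)) :=
      mul_nonneg (by linarith) (by positivity)
    nlinarith

/-- The solution of the renewal equation is Lipschitz continuous in the logarithmic scale. -/
theorem IsParam.renewal_lipschitz (h : IsParam M p ρ) : ∃ C : ℝ, 0 < C ∧ ∀ y lam, 0 < y →
    1 ≤ lam → |renewal M p ρ (lam * y) - renewal M p ρ y| ≤ C * (lam - 1) := by
  obtain ⟨C, hC0, hC⟩ := h.bigKern_sum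
  refine ⟨C, hC0, fun y lam hy hl => ?_⟩
  have hl0 : 0 < lam := by linarith
  have hly : 0 < lam * y := mul_pos hl0 hy
  have s1 := (h.summable_kernSq hly).mul_left (lam ^ (-ρ))
  have s2 := h.summable_kernSq hy
  have e1 : renewal M p ρ (lam * y) - renewal M p ρ y = y ^ (-ρ) *
      ∑' x : List (Fin M × Fin A), (lam ^ (-ρ) * ((lam * y * weight p x) ^ 2 *
        Real.exp (-(lam * y * weight p x))) -
          (y * weight p x) ^ 2 * Real.exp (-(y * weight p x))) := by
    rw [s1.tsum_sub s2, tsum_mul_left, renewal, renewal, Real.mul_rpow hl0.le hy.le]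
    ring
  rw [e1, abs_mul, abs_of_nonneg (Real.rpow_nonneg hy.le _)]
  have h2 : |∑' x : List (Fin M × Fin A), (lam ^ (-ρ) * ((lam * y * weight p x) ^ 2 *
        Real.exp (-(lam * y * weight p x))) -
          (y * weight p x) ^ 2 * Real.exp (-(y * weight p x)))| ≤
      ∑' x : List (Fin M × Fin A), (lam - 1) * bigKern (y * weight p x) := by
    rw [← Real.norm_eq_abs]
    refine tsum_of_norm_bounded ((hC y hy).1.mul_left _).hasSum fun x => ?_
    rw [Real.norm_eq_abs]
    have := kernSq_sub_le hl (mul_pos hy (weight_pos h.pos x)) h.one_lt h.lt_two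
    simpa only [mul_assoc] using this
  rw [tsum_mul_left] at h2
  have h3 : 0 < y ^ (2 - ρ) := Real.rpow_pos_of_pos hy _
  calc _ ≤ y ^ (-ρ) * ((lam - 1) * (C * (y ^ 2 / (1 + y ^ (2 - ρ))))) := by
        refine mul_le_mul_of_nonneg_left (h2.trans ?_) (Real.rpow_nonneg hy.le _)
        exact mul_le_mul_of_nonneg_left (hC y hy).2 (by linarith)
    _ = C * (lam - 1) * (y ^ (2 - ρ) / (1 + y ^ (2 - ρ))) := by
        rw [← rpow_neg_mul_sq hy]; ring
    _ ≤ _ := by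
        refine mul_le_of_le_one_right (mul_nonneg hC0.le (by linarith)) ?_
        rw [div_le_one (by positivity)]
        linarith

/-- Poisson approximation. The powers of `1 - q` and `exp (-q)` are compared through a geometric sum
and `exp (-q) - (1 - q) ≤ q ^ 2`. The exponents `n - 1` and `n - 2` instead of `n` cost at most `exp
2`, because `q ≤ 1`. -/
theorem binomial_exp_sub_le {n : ℕ} (hn : 1 ≤ n) {q : ℝ} (hq : 0 < q) (hq1 : q ≤ 1) :
    |n * q ^ 2 * (1 - q) ^ (n - 1) - (n : ℝ)⁻¹ * ((n * q) ^ 2 * Real.exp (-(n * q)))| ≤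
      Real.exp 2 * ((n : ℝ)⁻¹ ^ 2 * bigKern (n * q)) := by
  have hn0 : (0 : ℝ) < n := by exact_mod_cast hn
  set a := 1 - q with ha
  set b := Real.exp (-q) with hb
  have ha0 : 0 ≤ a := by linarith
  have hab : a ≤ b := by have := Real.add_one_le_exp (-q); linarith
  have hb1 : b ≤ 1 := Real.exp_le_one_iff.2 (by linarith)
  have hb0 : 0 < b := Real.exp_pos _
  have hba : b - a ≤ q ^ 2 := by
    have := Real.abs_exp_sub_one_sub_id_le (x := -q) (by rw [abs_neg, abs_of_pos hq]; exact hq1)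
    have := (abs_le.1 this).2
    simp only [neg_sq] at this
    linarith
  have hbn : b ^ n = Real.exp (-(n * q)) := by
    rw [hb, ← Real.exp_nat_mul]; ring_nf
  have hE1 : b ^ (n - 1) ≤ Real.exp 2 * Real.exp (-(n * q)) := by
    rw [hb, ← Real.exp_nat_mul, ← Real.exp_add, Real.exp_le_exp, Nat.cast_sub hn]
    push_cast
    nlinarith
  have hE2 : b ^ (n - 1 - 1) ≤ Real.exp 2 * Real.exp (-(n * q)) := by
    rw [hb, ← Real.exp_nat_mul, ← Real.exp_add, Real.exp_le_exp]
    rcases Nat.lt_or_ge n 2 with h2 | h2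
    · have : n = 1 := by omega
      subst this
      norm_num
      linarith
    · rw [Nat.sub_sub, Nat.cast_sub h2]
      push_cast
      nlinarith
  have hdiff : |a ^ (n - 1) - b ^ n| ≤ Real.exp 2 * Real.exp (-(n * q)) * (q + n * q ^ 2) := by
    have h1 : b ^ (n - 1) - a ^ (n - 1) ≤ n * (q ^ 2 * (Real.exp 2 * Real.exp (-(n * q)))) := by
      rw [← (Commute.all b a).mul_geom_sum₂ (n - 1)]
      have hs : ∑ i ∈ Finset.range (n - 1), b ^ i * a ^ (n - 1 - 1 - i) ≤
          (n - 1 : ℕ) * b ^ (n - 1 - 1) := by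
        refine (Finset.sum_le_card_nsmul _ _ (b ^ (n - 1 - 1)) fun i hi => ?_).trans_eq ?_
        · have hi' := Finset.mem_range.1 hi
          calc b ^ i * a ^ (n - 1 - 1 - i) ≤ b ^ i * b ^ (n - 1 - 1 - i) := by gcongr
            _ = b ^ (n - 1 - 1) := by rw [← pow_add]; congr 1; omega
        · simp
      calc _ ≤ q ^ 2 * ((n - 1 : ℕ) * b ^ (n - 1 - 1)) :=
            mul_le_mul hba hs (Finset.sum_nonneg fun i _ => by positivity) (by positivity)
        _ ≤ q ^ 2 * (n * (Real.exp 2 * Real.exp (-(n * q)))) := by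
            gcongr
            exact_mod_cast Nat.sub_le n 1
        _ = _ := by ring
    have h2 : a ^ (n - 1) ≤ b ^ (n - 1) := by gcongr
    have h3 : b ^ (n - 1) - b ^ n = b ^ (n - 1) * (1 - b) := by
      obtain ⟨k, rfl⟩ : ∃ k, n = k + 1 := ⟨n - 1, by omega⟩
      simp only [Nat.add_sub_cancel]
      ring
    have h4 : b ^ (n - 1) * (1 - b) ≤ (Real.exp 2 * Real.exp (-(n * q))) * q := by
      refine mul_le_mul hE1 (by linarith) (by linarith) (by positivity)
    have h5 : 0 ≤ b ^ (n - 1) * (1 - b) := mul_nonneg (by positivity) (by linarith)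
    have h6 : 0 ≤ (Real.exp 2 * Real.exp (-(n * q))) * q := by positivity
    have h7 : 0 ≤ n * (q ^ 2 * (Real.exp 2 * Real.exp (-(n * q)))) := by positivity
    rw [abs_le]
    constructor <;> nlinarith
  have e : n * q ^ 2 * a ^ (n - 1) - (n : ℝ)⁻¹ * ((n * q) ^ 2 * Real.exp (-(n * q))) =
      n * q ^ 2 * (a ^ (n - 1) - b ^ n) := by
    rw [hbn]; field_simp
  rw [e, abs_mul, abs_of_nonneg (by positivity : (0 : ℝ) ≤ n * q ^ 2)]
  calc _ ≤ n * q ^ 2 * (Real.exp 2 * Real.exp (-(n * q)) * (q + n * q ^ 2)) := by gcongr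
    _ = Real.exp 2 * ((n : ℝ)⁻¹ ^ 2 * (((n * q) ^ 3 + (n * q) ^ 4) * Real.exp (-(n * q)))) := by
        field_simp
    _ ≤ _ := by
        unfold bigKern
        gcongr
        nlinarith [sq_nonneg (n * q)]

/-- The increments of the mean size are approximated by the solution of the renewal equation. -/
theorem IsParam.tsum_sub_renewal_le (h : IsParam M p ρ) : ∃ C : ℝ, 0 < C ∧ ∀ n : ℕ, 1 ≤ n →
    |(n : ℝ) ^ (1 - ρ) * ∑' x : List (Fin M × Fin A),
      n * weight p x ^ 2 * (1 - weight p x) ^ (n - 1) - renewal M p ρ n| ≤ C / n := by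
  obtain ⟨C, hC0, hC⟩ := h.bigKern_sum
  refine ⟨Real.exp 2 * C, by positivity, fun n hn => ?_⟩
  have hn0 : (0 : ℝ) < n := by exact_mod_cast hn
  have s2 := (h.summable_kernSq hn0).mul_left ((n : ℝ)⁻¹)
  have hb := ((hC n hn0).1.mul_left ((n : ℝ)⁻¹ ^ 2)).mul_left (Real.exp 2)
  have hle : ∀ x : List (Fin M × Fin A), ‖n * weight p x ^ 2 * (1 - weight p x) ^ (n - 1) -
      (n : ℝ)⁻¹ * ((n * weight p x) ^ 2 * Real.exp (-(n * weight p x)))‖ ≤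
      Real.exp 2 * ((n : ℝ)⁻¹ ^ 2 * bigKern (n * weight p x)) := fun x => by
    rw [Real.norm_eq_abs]
    exact binomial_exp_sub_le hn (weight_pos h.pos x) (weight_le_one h.pos x)
  have s3 := Summable.of_norm_bounded hb hle
  have s1 : Summable fun x : List (Fin M × Fin A) =>
      n * weight p x ^ 2 * (1 - weight p x) ^ (n - 1) := by
    simpa using s3.add s2
  have e1 : (n : ℝ) ^ (1 - ρ) * ∑' x : List (Fin M × Fin A),
      n * weight p x ^ 2 * (1 - weight p x) ^ (n - 1) - renewal M p ρ n = (n : ℝ) ^ (1 - ρ) *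
      ∑' x : List (Fin M × Fin A), (n * weight p x ^ 2 * (1 - weight p x) ^ (n - 1) -
      (n : ℝ)⁻¹ * ((n * weight p x) ^ 2 * Real.exp (-(n * weight p x)))) := by
    have : (n : ℝ) ^ (-ρ) = n ^ (1 - ρ) * (n : ℝ)⁻¹ := by
      rw [← Real.rpow_neg_one, ← Real.rpow_add hn0]; ring_nf
    rw [s1.tsum_sub s2, tsum_mul_left, renewal, this]
    ring
  rw [e1, abs_mul, abs_of_nonneg (Real.rpow_nonneg hn0.le _), ← Real.norm_eq_abs]
  have h3 : 0 < (n : ℝ) ^ (2 - ρ) := Real.rpow_pos_of_pos hn0 _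
  calc _ ≤ (n : ℝ) ^ (1 - ρ) * (Real.exp 2 * ((n : ℝ)⁻¹ ^ 2 *
        (C * (n ^ 2 / (1 + n ^ (2 - ρ)))))) := by
        gcongr
        refine (tsum_of_norm_bounded hb.hasSum hle).trans ?_
        rw [tsum_mul_left, tsum_mul_left]
        gcongr
        exact (hC n hn0).2
    _ = Real.exp 2 * C / n * ((n : ℝ) ^ (2 - ρ) / (1 + n ^ (2 - ρ))) := by
        have : (n : ℝ) ^ (2 - ρ) = n ^ (1 - ρ) * n := by
          rw [← Real.rpow_add_one hn0.ne']; ring_nf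
        rw [this]
        field_simp
    _ ≤ _ := by
        refine mul_le_of_le_one_right (by positivity) ?_
        rw [div_le_one (by positivity)]
        linarith

end Renewal

/-! ### Asymptotic periodicity of the renewal solution -/

section Periodic

variable {M A : ℕ} {p : Fin A → ℝ} {ρ : ℝ}

theorem tendsto_kern (ρ : ℝ) : Tendsto (kern ρ) atTop (𝓝 0) := by
  have := tendsto_rpow_mul_exp_neg_mul_atTop_nhds_zero (2 - ρ) 1 one_pos
  refine this.congr fun y => ?_
  simp [kern]

theorem IsParam.tendsto_mul (h : IsParam M p ρ) (j : Fin A) :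
    Tendsto (fun y : ℝ => y * p j) atTop atTop :=
  tendsto_id.atTop_mul_const (h.pos j).1

/-- The averaged squared increment of the solution of the renewal equation. -/
def sqIncr (M : ℕ) {A : ℕ} (p : Fin A → ℝ) (ρ y : ℝ) : ℝ :=
  ∑ j, tilt M p ρ j * (renewal M p ρ (y * p j) - renewal M p ρ y) ^ 2

/-- After expanding the square, the renewal equation evaluates the cross term. Thus `sqIncr` is the
gain of the average of the squared solution in one step, up to a kernel term, and such gains
telescope along the walk. -/
theorem IsParam.sqIncr_eq (h : IsParam M p ρ) {y : ℝ} (hy : 0 < y) :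
    sqIncr M p ρ y = ∑ j, tilt M p ρ j * renewal M p ρ (y * p j) ^ 2 - renewal M p ρ y ^ 2 +
      2 * renewal M p ρ y * kern ρ y := by
  have h1 := h.renewal_eq hy
  set v := renewal M p ρ y with hv
  have e : sqIncr M p ρ y = ∑ j, tilt M p ρ j * renewal M p ρ (y * p j) ^ 2 -
      2 * v * ∑ j, tilt M p ρ j * renewal M p ρ (y * p j) + (∑ j, tilt M p ρ j) * v ^ 2 := by
    rw [sqIncr, Finset.mul_sum, Finset.sum_mul, ← Finset.sum_sub_distrib, ← Finset.sum_add_distrib]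
    exact Finset.sum_congr rfl fun j _ => by ring
  rw [e, h.sum_tilt]
  linear_combination (2 * v) * h1

/-- The averaged squared increment is a subsolution of the renewal equation, up to a small
error. -/
theorem IsParam.sqIncr_le (h : IsParam M p ρ) : ∃ e : ℝ → ℝ, Tendsto e atTop (𝓝 0) ∧
    ∀ y, 0 < y → sqIncr M p ρ y ≤ ∑ j, tilt M p ρ j * sqIncr M p ρ (y * p j) + e y := by
  obtain ⟨C, hC0, hC⟩ := h.renewal_le
  refine ⟨fun y => ∑ j, tilt M p ρ j * (8 * C * |kern ρ (y * p j) - kern ρ y|), ?_,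
    fun y hy => ?_⟩
  · have h1 := tendsto_kern ρ
    have : Tendsto (fun y => ∑ j, tilt M p ρ j * (8 * C * |kern ρ (y * p j) - kern ρ y|)) atTop
        (𝓝 (∑ j : Fin A, tilt M p ρ j * (8 * C * |(0 : ℝ) - 0|))) :=
      tendsto_finsetSum _ fun j _ => (((h1.comp (h.tendsto_mul j)).sub h1).abs.const_mul
        (8 * C)).const_mul (tilt M p ρ j)
    simpa using this
  have hb : ∀ z, 0 < z → 0 ≤ renewal M p ρ z ∧ renewal M p ρ z ≤ C := fun z hz =>
    ⟨renewal_nonneg hz, (hC z hz).1⟩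
  have key : ∀ j, (renewal M p ρ (y * p j) - renewal M p ρ y) ^ 2 ≤
      ∑ k, tilt M p ρ k * (renewal M p ρ (y * p k * p j) - renewal M p ρ (y * p k)) ^ 2 +
        8 * C * |kern ρ (y * p j) - kern ρ y| := by
    intro j
    have hj := mul_pos hy (h.pos j).1
    set a := kern ρ (y * p j) - kern ρ y with ha
    set B := ∑ k, tilt M p ρ k * (renewal M p ρ (y * p k * p j) - renewal M p ρ (y * p k)) with hB
    -- Since the factors `p j` and `p k` commute, the increment of the solution in the direction `p
    -- j` satisfies the same renewal equation, with the small source `a`.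
    have e1 : renewal M p ρ (y * p j) - renewal M p ρ y = a + B := by
      rw [h.renewal_eq hj, h.renewal_eq hy, hB]
      simp only [mul_sub, Finset.sum_sub_distrib, mul_right_comm y (p j)]
      ring
    -- Jensen's inequality for the weights `tilt`, in the form that a variance is nonnegative.
    have e2 : B ^ 2 ≤
        ∑ k, tilt M p ρ k * (renewal M p ρ (y * p k * p j) - renewal M p ρ (y * p k)) ^ 2 := by
      have h1 : 0 ≤ ∑ k, tilt M p ρ k *
          (renewal M p ρ (y * p k * p j) - renewal M p ρ (y * p k) - B) ^ 2 :=
        Finset.sum_nonneg fun k _ => mul_nonneg (h.tilt_pos k).le (sq_nonneg _)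
      have h2 : ∑ k, tilt M p ρ k *
          (renewal M p ρ (y * p k * p j) - renewal M p ρ (y * p k) - B) ^ 2 =
          ∑ k, tilt M p ρ k * (renewal M p ρ (y * p k * p j) - renewal M p ρ (y * p k)) ^ 2 -
          2 * B * B + (∑ k, tilt M p ρ k) * B ^ 2 := by
        conv_rhs => rw [hB, ← hB]
        nth_rewrite 3 [hB]
        rw [Finset.mul_sum, Finset.sum_mul, ← Finset.sum_sub_distrib, ← Finset.sum_add_distrib]
        exact Finset.sum_congr rfl fun k _ => by ring
      rw [h.sum_tilt] at h2
      nlinarith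
    have hx := hb _ hj
    have hx' := hb _ hy
    have e3 : |B| ≤ C := by
      have h1 : ∀ k, |renewal M p ρ (y * p k * p j) - renewal M p ρ (y * p k)| ≤ C := fun k => by
        have h2 := hb _ (mul_pos hy (h.pos k).1)
        have h3 := hb _ (mul_pos (mul_pos hy (h.pos k).1) (h.pos j).1)
        rw [abs_le]; constructor <;> linarith
      calc |B| ≤ ∑ k, |tilt M p ρ k *
            (renewal M p ρ (y * p k * p j) - renewal M p ρ (y * p k))| :=
            Finset.abs_sum_le_sum_abs _ _
        _ ≤ ∑ k, tilt M p ρ k * C := Finset.sum_le_sum fun k _ => by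
            rw [abs_mul, abs_of_pos (h.tilt_pos k)]
            exact mul_le_mul_of_nonneg_left (h1 k) (h.tilt_pos k).le
        _ = C := by rw [← Finset.sum_mul, h.sum_tilt, one_mul]
    have e4 : |a + B| ≤ C := by
      rw [← e1, abs_le]; constructor <;> linarith
    have e5 : a * (a + 2 * B) ≤ 8 * C * |a| := by
      calc a * (a + 2 * B) ≤ |a| * |a + 2 * B| := by rw [← abs_mul]; exact le_abs_self _
        _ ≤ |a| * (8 * C) := by
            refine mul_le_mul_of_nonneg_left ?_ (abs_nonneg a)
            rw [abs_le] at e3 e4 ⊢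
            constructor <;> linarith
        _ = _ := by ring
    rw [e1]
    nlinarith
  calc sqIncr M p ρ y ≤ ∑ j, tilt M p ρ j * (∑ k, tilt M p ρ k *
        (renewal M p ρ (y * p k * p j) - renewal M p ρ (y * p k)) ^ 2 +
        8 * C * |kern ρ (y * p j) - kern ρ y|) :=
        Finset.sum_le_sum fun j _ => mul_le_mul_of_nonneg_left (key j) (h.tilt_pos j).le
    _ = _ := by
        simp only [mul_add, Finset.sum_add_distrib, sqIncr, Finset.mul_sum]
        rw [Finset.sum_comm]
        congr 1
        refine Finset.sum_congr rfl fun k _ => Finset.sum_congr rfl fun j _ => by ring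

/-- Since `sqIncr` is nearly a subsolution, its value at `y` is nearly bounded by its average after
any number of steps. Summed over `N` steps, these averages telescope to at most the square of the
bound of the solution. So `N` times `sqIncr` stays bounded up to a null term, for every `N`. -/
theorem IsParam.tendsto_sqIncr (h : IsParam M p ρ) :
    Tendsto (sqIncr M p ρ) atTop (𝓝 0) := by
  obtain ⟨C, hC0, hC⟩ := h.renewal_le
  obtain ⟨e, he, hde⟩ := h.sqIncr_le
  have hv : ∀ z, 0 < z → 0 ≤ renewal M p ρ z ∧ renewal M p ρ z ≤ C := fun z hz =>
    ⟨renewal_nonneg hz, (hC z hz).1⟩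
  have hg : Tendsto (fun y => 2 * renewal M p ρ y * kern ρ y) atTop (𝓝 0) := by
    refine squeeze_zero' (g := fun y => 2 * C * kern ρ y) ?_ ?_
      (by simpa using (tendsto_kern ρ).const_mul (2 * C))
    · filter_upwards [eventually_gt_atTop 0] with y hy
      have := (hv y hy).1
      have := kern_nonneg (ρ := ρ) hy.le
      positivity
    · filter_upwards [eventually_gt_atTop 0] with y hy
      have h1 := (hv y hy).2
      have := kern_nonneg (ρ := ρ) hy.le
      gcongr
  -- `W` is the average of the squared solution after `N` steps of the walk with step probabilities
  -- `tilt`.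
  have key : ∀ N : ℕ, ∃ W κ : ℝ → ℝ, (∀ y, 0 < y → W y ≤ C ^ 2) ∧ Tendsto κ atTop (𝓝 0) ∧
      ∀ y, 0 < y → N * sqIncr M p ρ y ≤ W y - renewal M p ρ y ^ 2 + κ y := by
    intro N
    induction N with
    | zero =>
      refine ⟨fun y => renewal M p ρ y ^ 2, fun _ => 0, fun y hy => ?_, tendsto_const_nhds,
        fun y hy => by simp⟩
      exact pow_le_pow_left₀ (hv y hy).1 (hv y hy).2 2
    | succ N ih =>
      obtain ⟨W, κ, hW, hκ, hN⟩ := ih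
      refine ⟨fun y => ∑ j, tilt M p ρ j * W (y * p j), fun y =>
        2 * renewal M p ρ y * kern ρ y + ∑ j, tilt M p ρ j * κ (y * p j) + N * e y,
        fun y hy => ?_, ?_, fun y hy => ?_⟩
      · calc ∑ j, tilt M p ρ j * W (y * p j) ≤ ∑ j, tilt M p ρ j * C ^ 2 :=
              Finset.sum_le_sum fun j _ =>
                mul_le_mul_of_nonneg_left (hW _ (mul_pos hy (h.pos j).1)) (h.tilt_pos j).le
          _ = C ^ 2 := by rw [← Finset.sum_mul, h.sum_tilt, one_mul]
      · have h1 : Tendsto (fun y => ∑ j, tilt M p ρ j * κ (y * p j)) atTop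
            (𝓝 (∑ j : Fin A, tilt M p ρ j * 0)) :=
          tendsto_finsetSum _ fun j _ => (hκ.comp (h.tendsto_mul j)).const_mul _
        have := (hg.add h1).add (he.const_mul (N : ℝ))
        simpa using this
      · have h1 := hde y hy
        have h2 : ∑ j, tilt M p ρ j * (N * sqIncr M p ρ (y * p j)) ≤
            ∑ j, tilt M p ρ j * (W (y * p j) - renewal M p ρ (y * p j) ^ 2 + κ (y * p j)) :=
          Finset.sum_le_sum fun j _ =>
            mul_le_mul_of_nonneg_left (hN _ (mul_pos hy (h.pos j).1)) (h.tilt_pos j).le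
        simp only [mul_add, mul_sub, Finset.sum_add_distrib, Finset.sum_sub_distrib] at h2
        have h3 : ∑ j, tilt M p ρ j * (N * sqIncr M p ρ (y * p j)) =
            N * ∑ j, tilt M p ρ j * sqIncr M p ρ (y * p j) := by
          rw [Finset.mul_sum]; exact Finset.sum_congr rfl fun j _ => by ring
        have h4 := h.sqIncr_eq hy
        have h5 := mul_le_mul_of_nonneg_left h1 (Nat.cast_nonneg (α := ℝ) N)
        push_cast
        rw [h3] at h2
        linarith
  rw [Metric.tendsto_nhds]
  intro δ hδ
  obtain ⟨N, hN⟩ := exists_nat_gt ((C ^ 2 + 1) / δ)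
  obtain ⟨W, κ, hW, hκ, hNd⟩ := key N
  filter_upwards [eventually_gt_atTop 0, hκ.eventually (gt_mem_nhds (zero_lt_one))] with y hy hκy
  have h0 : 0 ≤ sqIncr M p ρ y :=
    Finset.sum_nonneg fun j _ => mul_nonneg (h.tilt_pos j).le (sq_nonneg _)
  rw [Real.dist_0_eq_abs, abs_of_nonneg h0]
  have h1 := hNd y hy
  have h2 := hW y hy
  have hN0 : (0 : ℝ) < N := lt_trans (by positivity) hN
  rw [div_lt_iff₀ hδ] at hN
  nlinarith [sq_nonneg (renewal M p ρ y)]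

/-- The solution of the renewal equation is asymptotically periodic. -/
theorem IsParam.tendsto_renewal_sub (h : IsParam M p ρ) (j : Fin A) :
    Tendsto (fun y => renewal M p ρ (y * p j) - renewal M p ρ y) atTop (𝓝 0) := by
  have h1 : Tendsto (fun y => (renewal M p ρ (y * p j) - renewal M p ρ y) ^ 2) atTop (𝓝 0) := by
    refine squeeze_zero (g := fun y => (tilt M p ρ j)⁻¹ * sqIncr M p ρ y) (fun y => sq_nonneg _)
      (fun y => ?_) (by simpa using h.tendsto_sqIncr.const_mul (tilt M p ρ j)⁻¹)
    rw [inv_mul_eq_div, le_div_iff₀ (h.tilt_pos j), mul_comm]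
    exact Finset.single_le_sum
      (f := fun j => tilt M p ρ j * (renewal M p ρ (y * p j) - renewal M p ρ y) ^ 2)
      (fun j _ => mul_nonneg (h.tilt_pos j).le (sq_nonneg _)) (Finset.mem_univ j)
  have h2 := h1.sqrt
  simp only [Real.sqrt_sq_eq_abs, Real.sqrt_zero] at h2
  exact (tendsto_zero_iff_abs_tendsto_zero _).2 h2

/-- The logarithms of the probabilities generate the group of asymptotic periods. -/
def logGroup {A : ℕ} (p : Fin A → ℝ) : AddSubgroup ℝ :=
  AddSubgroup.closure (Set.range fun j => Real.log (p j))

theorem IsParam.tendsto_renewal_sub_of_mem (h : IsParam M p ρ) {t : ℝ} (ht : t ∈ logGroup p) :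
    Tendsto (fun y => renewal M p ρ (y * Real.exp t) - renewal M p ρ y) atTop (𝓝 0) := by
  induction ht using AddSubgroup.closure_induction with
  | mem t ht =>
    obtain ⟨j, rfl⟩ := ht
    simpa only [Real.exp_log (h.pos j).1] using h.tendsto_renewal_sub j
  | zero => simp
  | add s t _ _ hs ht =>
    have h1 := (hs.comp (tendsto_id.atTop_mul_const (Real.exp_pos t))).add ht
    rw [add_zero] at h1
    refine h1.congr fun y => ?_
    simp only [Function.comp_apply, id, Real.exp_add]
    ring_nf
  | neg t _ ht =>
    have h1 := (ht.comp (tendsto_id.atTop_mul_const (Real.exp_pos (-t)))).neg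
    rw [neg_zero] at h1
    refine h1.congr fun y => ?_
    simp only [Function.comp_apply, id, mul_assoc, ← Real.exp_add, neg_add_cancel, Real.exp_zero,
      mul_one]
    ring

end Periodic

/-! ### Renewal theorems in the non-lattice and the lattice case -/

/-- The function `kern` in the logarithmic scale. -/
def logKern (ρ u : ℝ) : ℝ := kern ρ (Real.exp u)

/-- The solution of the renewal equation in the logarithmic scale. -/
def logRenewal (M : ℕ) {A : ℕ} (p : Fin A → ℝ) (ρ u : ℝ) : ℝ := renewal M p ρ (Real.exp u)

/-- The mean step `-∑ M p_j ^ ρ log p_j` of the renewal process. -/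
def drift (M : ℕ) {A : ℕ} (p : Fin A → ℝ) (ρ : ℝ) : ℝ := -∑ j, tilt M p ρ j * Real.log (p j)

section Limit

variable {M A : ℕ} {p : Fin A → ℝ} {ρ : ℝ}

theorem logKern_eq (ρ u : ℝ) :
    logKern ρ u = Real.exp ((2 - ρ) * u) * Real.exp (-Real.exp u) := by
  rw [logKern, kern, ← Real.exp_mul, mul_comm u]

theorem logKern_nonneg (ρ u : ℝ) : 0 ≤ logKern ρ u := kern_nonneg (Real.exp_pos u).le

theorem continuous_logKern (ρ : ℝ) : Continuous (logKern ρ) := by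
  simp_rw [funext (logKern_eq ρ)]
  fun_prop

theorem logKern_le (ρ u : ℝ) : logKern ρ u ≤ Real.exp ((2 - ρ) * u) := by
  rw [logKern_eq]
  refine mul_le_of_le_one_right (Real.exp_pos _).le (Real.exp_le_one_iff.2 ?_)
  linarith [Real.exp_pos u]

theorem logKern_le_exp_neg (hρ : 1 < ρ) (hρ2 : ρ < 2) (u : ℝ) :
    logKern ρ u ≤ 3 * Real.exp (-u) := by
  set y := Real.exp u with hy
  have hy0 : 0 < y := Real.exp_pos u
  have h1 : y ^ (2 - ρ) ≤ 1 + y := by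
    rcases le_or_gt y 1 with h | h
    · exact (Real.rpow_le_one hy0.le h (by linarith)).trans (by linarith)
    · calc y ^ (2 - ρ) ≤ y ^ (1 : ℝ) := Real.rpow_le_rpow_of_exponent_le h.le (by linarith)
        _ ≤ 1 + y := by rw [Real.rpow_one]; linarith
  have h2 : y * (1 + y) ≤ 3 * Real.exp y := by
    have := Real.quadratic_le_exp_of_nonneg hy0.le
    nlinarith
  rw [logKern, kern, ← hy, Real.exp_neg u, ← hy, Real.exp_neg, ← div_eq_mul_inv,
    ← div_eq_mul_inv, div_le_div_iff₀ (Real.exp_pos y) hy0]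
  nlinarith

theorem IsParam.drift_pos (h : IsParam M p ρ) : 0 < drift M p ρ := by
  have : Nonempty (Fin A) := ⟨⟨0, h.pos_A⟩⟩
  rw [drift, ← Finset.sum_neg_distrib]
  refine Finset.sum_pos (fun j _ => ?_) Finset.univ_nonempty
  rw [← mul_neg]
  exact mul_pos (h.tilt_pos j) (neg_pos.2 (Real.log_neg (h.pos j).1 (h.pos j).2))

theorem IsParam.logRenewal_eq (h : IsParam M p ρ) (u : ℝ) : logRenewal M p ρ u =
    logKern ρ u + ∑ j, tilt M p ρ j * logRenewal M p ρ (u + Real.log (p j)) := by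
  simp only [logRenewal, logKern, Real.exp_add, Real.exp_log (h.pos _).1]
  exact h.renewal_eq (Real.exp_pos u)

theorem logRenewal_nonneg (u : ℝ) : 0 ≤ logRenewal M p ρ u := renewal_nonneg (Real.exp_pos u)

theorem IsParam.logRenewal_le (h : IsParam M p ρ) : ∃ C : ℝ, 0 < C ∧ ∀ u,
    logRenewal M p ρ u ≤ C ∧ logRenewal M p ρ u ≤ C * Real.exp ((2 - ρ) * u) := by
  obtain ⟨C, hC0, hC⟩ := h.renewal_le
  refine ⟨C, hC0, fun u => ⟨(hC _ (Real.exp_pos u)).1, ?_⟩⟩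
  have := (hC _ (Real.exp_pos u)).2
  rwa [← Real.exp_mul, mul_comm u] at this

theorem IsParam.logRenewal_lipschitz (h : IsParam M p ρ) : ∃ C : ℝ, 0 < C ∧ ∀ u s,
    |logRenewal M p ρ u - logRenewal M p ρ s| ≤ C * (Real.exp |u - s| - 1) := by
  obtain ⟨C, hC0, hC⟩ := h.renewal_lipschitz
  have key : ∀ u s, s ≤ u → |logRenewal M p ρ u - logRenewal M p ρ s| ≤
      C * (Real.exp (u - s) - 1) := by
    intro u s hsu
    have := hC (Real.exp s) (Real.exp (u - s)) (Real.exp_pos s) (Real.one_le_exp (by linarith))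
    rwa [← Real.exp_add, sub_add_cancel] at this
  refine ⟨C, hC0, fun u s => ?_⟩
  rcases le_total s u with hsu | hsu
  · rw [abs_of_nonneg (sub_nonneg.2 hsu)]
    exact key u s hsu
  · rw [abs_sub_comm, abs_of_nonpos (sub_nonpos.2 hsu), neg_sub]
    exact key s u hsu

theorem IsParam.continuous_logRenewal (h : IsParam M p ρ) : Continuous (logRenewal M p ρ) := by
  obtain ⟨C, hC0, hC⟩ := h.logRenewal_lipschitz
  rw [continuous_iff_continuousAt]
  intro s
  rw [ContinuousAt, tendsto_iff_dist_tendsto_zero]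
  refine squeeze_zero (fun _ => dist_nonneg) (fun u => hC u s) ?_
  have : Continuous fun u : ℝ => C * (Real.exp |u - s| - 1) := by fun_prop
  simpa using this.tendsto s

theorem IsParam.tendsto_logRenewal_sub (h : IsParam M p ρ) {t : ℝ} (ht : t ∈ logGroup p) :
    Tendsto (fun u => logRenewal M p ρ (u + t) - logRenewal M p ρ u) atTop (𝓝 0) := by
  have := (h.tendsto_renewal_sub_of_mem ht).comp Real.tendsto_exp_atTop
  refine this.congr fun u => ?_
  simp [logRenewal, Real.exp_add]

/-- The shift is approximated by an element of the group; the Lipschitz bound makes the replacement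
uniform in `u`. -/
theorem IsParam.tendsto_logRenewal_sub_of_dense (h : IsParam M p ρ)
    (hd : Dense (logGroup p : Set ℝ)) (t : ℝ) :
    Tendsto (fun u => logRenewal M p ρ (u + t) - logRenewal M p ρ u) atTop (𝓝 0) := by
  obtain ⟨C, hC0, hC⟩ := h.logRenewal_lipschitz
  rw [Metric.tendsto_nhds]
  intro δ hδ
  have hcont : Tendsto (fun s : ℝ => C * (Real.exp |t - s| - 1)) (𝓝 t) (𝓝 0) := by
    have : Continuous fun s : ℝ => C * (Real.exp |t - s| - 1) := by fun_prop
    simpa using this.tendsto t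
  obtain ⟨s, hsG, hs⟩ := hd.inter_nhds_nonempty
    (hcont.eventually (gt_mem_nhds (half_pos hδ)))
  filter_upwards [(h.tendsto_logRenewal_sub hsG).eventually
    (Metric.ball_mem_nhds 0 (half_pos hδ))] with u hu
  rw [Real.dist_0_eq_abs] at hu
  rw [Real.dist_0_eq_abs]
  have h1 := hC (u + t) (u + s)
  rw [add_sub_add_left_eq_sub] at h1
  have h2 : C * (Real.exp |t - s| - 1) < δ / 2 := hs
  calc _ = |(logRenewal M p ρ (u + t) - logRenewal M p ρ (u + s)) +
        (logRenewal M p ρ (u + s) - logRenewal M p ρ u)| := by ring_nf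
    _ ≤ _ := abs_add_le _ _
    _ < δ := by linarith

theorem IsParam.integrable_logKern (h : IsParam M p ρ) : Integrable (logKern ρ) := by
  rw [← integrableOn_univ, ← Set.Iic_union_Ioi (a := (0 : ℝ)), integrableOn_union]
  constructor
  · refine (integrableOn_exp_mul_Iic (a := 2 - ρ) (by linarith [h.lt_two]) 0).mono'
      (continuous_logKern ρ).aestronglyMeasurable ?_
    exact Filter.Eventually.of_forall fun u => by
      rw [Real.norm_of_nonneg (logKern_nonneg ρ u)]; exact logKern_le ρ u
  · refine ((integrableOn_exp_mul_Ioi (a := -1) (by norm_num) 0).const_mul 3).mono'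
      (continuous_logKern ρ).aestronglyMeasurable ?_
    exact Filter.Eventually.of_forall fun u => by
      rw [Real.norm_of_nonneg (logKern_nonneg ρ u)]
      simpa using logKern_le_exp_neg h.one_lt h.lt_two u

theorem IsParam.integrableOn_logRenewal (h : IsParam M p ρ) (T : ℝ) :
    IntegrableOn (logRenewal M p ρ) (Set.Iic T) := by
  obtain ⟨C, hC0, hC⟩ := h.logRenewal_le
  refine ((integrableOn_exp_mul_Iic (a := 2 - ρ) (by linarith [h.lt_two]) T).const_mul
    C).mono' h.continuous_logRenewal.aestronglyMeasurable ?_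
  exact Filter.Eventually.of_forall fun u => by
    rw [Real.norm_of_nonneg (logRenewal_nonneg u)]; exact (hC u).2

theorem setIntegral_Iic_comp_add (f : ℝ → ℝ) (T c : ℝ) :
    ∫ u in Set.Iic T, f (u + c) = ∫ u in Set.Iic (T + c), f u := by
  have h := (measurePreserving_add_right volume c).setIntegral_preimage_emb
    (measurableEmbedding_addRight c) f (Set.Iic (T + c))
  rw [← h]
  congr 2
  ext u
  simp

/-- The renewal equation integrated over `(-∞, T]`. As the weights `tilt` sum to one, the half-line
integrals of the solution cancel except on the windows of length `-log (p j)` below `T`, and this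
determines the limit once the solution is nearly constant on them. -/
theorem IsParam.sum_intervalIntegral (h : IsParam M p ρ) (T : ℝ) :
    ∑ j, tilt M p ρ j * ∫ s in Real.log (p j)..0, logRenewal M p ρ (T + s) =
      ∫ u in Set.Iic T, logKern ρ u := by
  have h1 : ∀ j, ∫ s in Real.log (p j)..0, logRenewal M p ρ (T + s) =
      (∫ u in Set.Iic T, logRenewal M p ρ u) -
        ∫ u in Set.Iic T, logRenewal M p ρ (u + Real.log (p j)) := by
    intro j
    rw [setIntegral_Iic_comp_add, intervalIntegral.integral_Iic_sub_Iic
      (h.integrableOn_logRenewal _) (h.integrableOn_logRenewal _),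
      intervalIntegral.integral_comp_add_left, add_zero]
  have hi : ∀ j, IntegrableOn (fun u => logRenewal M p ρ (u + Real.log (p j))) (Set.Iic T) := by
    intro j
    have := (measurePreserving_add_right volume (Real.log (p j))).integrableOn_comp_preimage
      (measurableEmbedding_addRight (Real.log (p j))) (f := logRenewal M p ρ)
      (s := Set.Iic (T + Real.log (p j)))
    have h2 := this.2 (h.integrableOn_logRenewal _)
    refine h2.mono_set fun u hu => ?_
    simpa using hu
  simp_rw [h1]
  simp only [mul_sub, Finset.sum_sub_distrib]
  rw [← Finset.sum_mul, h.sum_tilt, one_mul]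
  have h3 : ∫ u in Set.Iic T, logRenewal M p ρ u = (∫ u in Set.Iic T, logKern ρ u) +
      ∑ j, tilt M p ρ j * ∫ u in Set.Iic T, logRenewal M p ρ (u + Real.log (p j)) := by
    rw [integral_congr_ae (Filter.Eventually.of_forall fun u => h.logRenewal_eq u),
      integral_add h.integrable_logKern.integrableOn
        (integrable_finsetSum _ fun j _ => (hi j).const_mul _),
      integral_finsetSum _ fun j _ => (hi j).const_mul _]
    simp only [integral_const_mul]
  linarith

/-- The renewal theorem in the non-lattice case. -/
theorem IsParam.tendsto_logRenewal_of_dense (h : IsParam M p ρ)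
    (hd : Dense (logGroup p : Set ℝ)) :
    Tendsto (logRenewal M p ρ) atTop (𝓝 ((∫ u, logKern ρ u) / drift M p ρ)) := by
  obtain ⟨C, hC0, hC⟩ := h.logRenewal_le
  have h1 : ∀ j, Tendsto (fun T => ∫ s in Real.log (p j)..0,
      (logRenewal M p ρ (T + s) - logRenewal M p ρ T)) atTop (𝓝 0) := by
    intro j
    have := intervalIntegral.tendsto_integral_filter_of_dominated_convergence (μ := volume)
      (F := fun T s => logRenewal M p ρ (T + s) - logRenewal M p ρ T) (f := fun _ => (0 : ℝ))
      (a := Real.log (p j)) (b := 0) (l := atTop) (fun _ => C)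
      (Filter.Eventually.of_forall fun T => by
        have := h.continuous_logRenewal
        exact (by fun_prop : Continuous fun s =>
          logRenewal M p ρ (T + s) - logRenewal M p ρ T).aestronglyMeasurable)
      (Filter.Eventually.of_forall fun T => Filter.Eventually.of_forall fun s _ => by
        rw [Real.norm_eq_abs, abs_le]
        have h1 := logRenewal_nonneg (M := M) (p := p) (ρ := ρ) (T + s)
        have h2 := logRenewal_nonneg (M := M) (p := p) (ρ := ρ) T
        have h3 := (hC (T + s)).1
        have h4 := (hC T).1
        constructor <;> linarith)
      (by simp)
      (Filter.Eventually.of_forall fun s _ => h.tendsto_logRenewal_sub_of_dense hd s)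
    simpa using this
  have h2 : Tendsto (fun T => ∑ j, tilt M p ρ j * ∫ s in Real.log (p j)..0,
      (logRenewal M p ρ (T + s) - logRenewal M p ρ T)) atTop (𝓝 0) := by
    have := tendsto_finsetSum Finset.univ fun j (_ : j ∈ Finset.univ) =>
      (h1 j).const_mul (tilt M p ρ j)
    simpa using this
  -- Replacing the solution on the windows by its value at `T` turns the weighted window lengths
  -- into `drift`.
  have h3 : ∀ T, ∑ j, tilt M p ρ j * ∫ s in Real.log (p j)..0,
      (logRenewal M p ρ (T + s) - logRenewal M p ρ T) =
      (∫ u in Set.Iic T, logKern ρ u) - drift M p ρ * logRenewal M p ρ T := by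
    intro T
    rw [← h.sum_intervalIntegral T, drift, neg_mul, sub_neg_eq_add, Finset.sum_mul,
      ← Finset.sum_add_distrib]
    refine Finset.sum_congr rfl fun j _ => ?_
    rw [intervalIntegral.integral_sub]
    · simp
      ring
    · have := h.continuous_logRenewal
      exact (by fun_prop : Continuous fun s => logRenewal M p ρ (T + s)).intervalIntegrable _ _
    · simp
  have h4 : Tendsto (fun T => ∫ u in Set.Iic T, logKern ρ u) atTop (𝓝 (∫ u, logKern ρ u)) := by
    have := (MeasureTheory.aecover_Iic (μ := volume) (tendsto_id (α := ℝ) (x := atTop)))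
    exact this.integral_tendsto_of_countably_generated h.integrable_logKern
  have h5 := (h4.sub h2).div_const (drift M p ρ)
  rw [sub_zero] at h5
  refine h5.congr fun T => ?_
  rw [h3]
  have := h.drift_pos.ne'
  field_simp
  ring

theorem summable_exp_neg_mul {h : ℝ} (hh : 0 < h) :
    Summable fun l : ℕ => Real.exp (-(h * l)) := by
  have : ∀ l : ℕ, Real.exp (-(h * l)) = Real.exp (-h) ^ l := fun l => by
    rw [← Real.exp_nat_mul]; ring_nf
  simp_rw [this]
  exact summable_geometric_of_lt_one (Real.exp_pos _).le (Real.exp_lt_one_iff.2 (by linarith))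

/-- The renewal theorem in the lattice case. -/
theorem IsParam.tendsto_logRenewal_of_lattice (h : IsParam M p ρ) {η : ℝ} (hη : 0 < η)
    (hG : ∀ t, t ∈ logGroup p ↔ ∃ k : ℤ, t = k * η) :
    Tendsto (fun u => logRenewal M p ρ u -
      η / drift M p ρ * ∑' l : ℤ, logKern ρ (u - l * η)) atTop (𝓝 0) := by
  obtain ⟨C, hC0, hC⟩ := h.logRenewal_le
  have hε : 0 < 2 - ρ := by linarith [h.lt_two]
  have hk : ∀ j, ∃ k : ℕ, Real.log (p j) = -(k * η) := by
    intro j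
    obtain ⟨k, hk⟩ := (hG _).1 (AddSubgroup.subset_closure (Set.mem_range_self j))
    have h1 := Real.log_neg (h.pos j).1 (h.pos j).2
    have hk0 : k ≤ 0 := by
      by_contra hcon
      push Not at hcon
      have : (0 : ℝ) < k := by exact_mod_cast hcon
      nlinarith [mul_pos this hη]
    refine ⟨(-k).toNat, ?_⟩
    have : (((-k).toNat : ℤ) : ℝ) = -k := by
      rw [Int.toNat_of_nonneg (by omega)]; push_cast; ring
    rw [hk, ← Int.cast_natCast, this]
    ring
  choose k hk using hk
  have hdec : ∀ u (l : ℕ), Real.exp ((2 - ρ) * (u - l * η)) =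
      Real.exp ((2 - ρ) * u) * Real.exp (-((2 - ρ) * η * l)) := fun u l => by
    rw [← Real.exp_add]; ring_nf
  have sE : ∀ u, Summable fun l : ℕ => Real.exp ((2 - ρ) * (u - l * η)) := fun u => by
    simp_rw [hdec]
    exact (summable_exp_neg_mul (mul_pos hε hη)).mul_left _
  have sV : ∀ u, Summable fun l : ℕ => logRenewal M p ρ (u - l * η) := fun u =>
    Summable.of_nonneg_of_le (fun l => logRenewal_nonneg _) (fun l => (hC _).2)
      ((sE u).mul_left C)
  have sK : ∀ u, Summable fun l : ℕ => logKern ρ (u - l * η) := fun u =>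
    Summable.of_nonneg_of_le (fun l => logKern_nonneg ρ _) (fun l => logKern_le ρ _) (sE u)
  -- The discrete counterpart of the window identity: the equation is summed over the points `u - l
  -- * η`, and only the first `k j` terms survive the cancellation.
  have hJ : ∀ u, ∑ j, tilt M p ρ j * ∑ l ∈ Finset.range (k j), logRenewal M p ρ (u - l * η) =
      ∑' l : ℕ, logKern ρ (u - l * η) := by
    intro u
    have h1 : ∀ j, ∑ l ∈ Finset.range (k j), logRenewal M p ρ (u - l * η) =
        ∑' l : ℕ, logRenewal M p ρ (u - l * η) -
          ∑' l : ℕ, logRenewal M p ρ (u - l * η + Real.log (p j)) := by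
      intro j
      rw [← (sV u).sum_add_tsum_nat_add (k j), eq_sub_iff_add_eq]
      congr 1
      refine tsum_congr fun l => ?_
      rw [hk j]
      push_cast
      ring_nf
    have s1 : ∀ j, Summable fun l : ℕ => logRenewal M p ρ (u - l * η + Real.log (p j)) := by
      intro j
      refine (sV (u + Real.log (p j))).congr fun l => ?_
      ring_nf
    simp_rw [h1]
    simp only [mul_sub, Finset.sum_sub_distrib]
    rw [← Finset.sum_mul, h.sum_tilt, one_mul]
    have h3 : ∑' l : ℕ, logRenewal M p ρ (u - l * η) = ∑' l : ℕ, logKern ρ (u - l * η) +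
        ∑ j, tilt M p ρ j * ∑' l : ℕ, logRenewal M p ρ (u - l * η + Real.log (p j)) := by
      rw [tsum_congr fun l : ℕ => h.logRenewal_eq (u - l * η),
        (sK u).tsum_add (summable_sum fun j _ => (s1 j).mul_left _),
        Summable.tsum_finsetSum fun j _ => (s1 j).mul_left _]
      simp only [tsum_mul_left]
    linarith
  have hdrift : drift M p ρ = (∑ j, tilt M p ρ j * k j) * η := by
    rw [drift, ← Finset.sum_neg_distrib, Finset.sum_mul]
    refine Finset.sum_congr rfl fun j _ => ?_
    rw [hk j]; ring
  have hlim1 : Tendsto (fun u => ∑ j, tilt M p ρ j * ∑ l ∈ Finset.range (k j),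
      (logRenewal M p ρ (u + -(l * η)) - logRenewal M p ρ u)) atTop (𝓝 0) := by
    have : ∀ l : ℕ, Tendsto (fun u => logRenewal M p ρ (u + -(l * η)) - logRenewal M p ρ u) atTop
        (𝓝 0) := fun l => h.tendsto_logRenewal_sub ((hG _).2 ⟨-l, by push_cast; ring⟩)
    have := tendsto_finsetSum Finset.univ fun j (_ : j ∈ Finset.univ) =>
      (tendsto_finsetSum (Finset.range (k j)) fun l _ => this l).const_mul (tilt M p ρ j)
    simpa using this
  have hpos : ∀ u (l : ℕ), logKern ρ (u + (l + 1 : ℕ) * η) ≤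
      3 * Real.exp (-u) * Real.exp (-(η * l)) := by
    intro u l
    refine (logKern_le_exp_neg h.one_lt h.lt_two _).trans ?_
    rw [mul_assoc, ← Real.exp_add]
    gcongr
    push_cast
    nlinarith
  have sP : ∀ u, Summable fun l : ℕ => logKern ρ (u + (l + 1 : ℕ) * η) := fun u =>
    Summable.of_nonneg_of_le (fun l => logKern_nonneg ρ _) (hpos u)
      ((summable_exp_neg_mul hη).mul_left _)
  -- The terms that complete the sum over natural numbers to a sum over all integers are negligible
  -- for large `u`, because the kernel decays exponentially to the right.
  have hlim2 : Tendsto (fun u => ∑' l : ℕ, logKern ρ (u + (l + 1 : ℕ) * η)) atTop (𝓝 0) := by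
    refine squeeze_zero (fun u => tsum_nonneg fun l => logKern_nonneg ρ _)
      (fun u => (sP u).tsum_le_tsum (hpos u) ((summable_exp_neg_mul hη).mul_left _)) ?_
    simp_rw [tsum_mul_left]
    have := (Real.tendsto_exp_neg_atTop_nhds_zero.const_mul 3).mul_const
      (∑' l : ℕ, Real.exp (-(η * l)))
    simpa using this
  have hZ : ∀ u, ∑' l : ℤ, logKern ρ (u - l * η) =
      ∑' l : ℕ, logKern ρ (u - l * η) + ∑' l : ℕ, logKern ρ (u + (l + 1 : ℕ) * η) := by
    intro u
    refine HasSum.tsum_eq (HasSum.of_nat_of_neg_add_one ?_ ?_)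
    · simpa using (sK u).hasSum
    · convert (sP u).hasSum using 3 with l
      push_cast
      ring
  have hfin := ((hlim1.neg.sub hlim2).mul_const (η / drift M p ρ))
  rw [neg_zero, sub_zero, zero_mul] at hfin
  refine hfin.congr fun u => ?_
  have e1 : ∑ j, tilt M p ρ j * ∑ l ∈ Finset.range (k j),
      (logRenewal M p ρ (u + -(l * η)) - logRenewal M p ρ u) =
      ∑' l : ℕ, logKern ρ (u - l * η) - (∑ j, tilt M p ρ j * k j) * logRenewal M p ρ u := by
    rw [← hJ u, Finset.sum_mul, ← Finset.sum_sub_distrib]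
    refine Finset.sum_congr rfl fun j _ => ?_
    rw [Finset.sum_sub_distrib, Finset.sum_const, Finset.card_range, nsmul_eq_mul]
    simp only [← sub_eq_add_neg]
    ring
  have hK : (∑ j, tilt M p ρ j * k j) ≠ 0 := by
    intro h0
    have := h.drift_pos
    rw [hdrift, h0, zero_mul] at this
    exact lt_irrefl _ this
  rw [e1, hZ, hdrift]
  generalize ∑' l : ℕ, logKern ρ (u - l * η) = a
  generalize ∑' l : ℕ, logKern ρ (u + (l + 1 : ℕ) * η) = b
  field_simp
  ring

end Limit

/-! ### Poisson summation and the zeros of `P` on the critical line -/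

section Fourier

variable {M A : ℕ} {p : Fin A → ℝ} {ρ : ℝ}

/-- The Gamma integral is a Mellin transform, hence a Fourier transform in the logarithmic scale.
The reflection `-u` and the frequency `t / (2 * π)` come from the conventions of
`mellin_eq_fourier`. -/
theorem fourier_logKern (hρ2 : ρ < 2) (t : ℝ) :
    𝓕 (fun u : ℝ => ((logKern ρ (-u) : ℝ) : ℂ)) (t / (2 * Real.pi)) =
      Complex.Gamma (((2 - ρ : ℝ) : ℂ) + t * Complex.I) := by
  have hre : (((2 - ρ : ℝ) : ℂ) + t * Complex.I).re = 2 - ρ := by simp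
  have him : (((2 - ρ : ℝ) : ℂ) + t * Complex.I).im = t := by simp
  rw [Complex.Gamma_eq_integral (by rw [hre]; linarith), Complex.GammaIntegral_eq_mellin,
    mellin_eq_fourier, hre, him]
  refine congrArg (fun f : ℝ → ℂ => 𝓕 f (t / (2 * Real.pi))) (funext fun u => ?_)
  rw [logKern_eq, Complex.real_smul, ← Complex.ofReal_mul]
  ring_nf

theorem integral_logKern (hρ2 : ρ < 2) : ∫ u, logKern ρ u = Real.Gamma (2 - ρ) := by
  have h1 := fourier_logKern hρ2 0
  rw [zero_div, Real.fourier_eq'] at h1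
  simp only [inner_zero_right, mul_zero, Complex.ofReal_zero, zero_mul, Complex.exp_zero, one_smul,
    add_zero, Complex.Gamma_ofReal] at h1
  rw [integral_neg_eq_self (fun u : ℝ => ((logKern ρ u : ℝ) : ℂ)), integral_complex_ofReal] at h1
  exact_mod_cast h1

theorem norm_Gamma_le {s : ℂ} (hs : 0 < s.re) : ‖Complex.Gamma s‖ ≤ Real.Gamma s.re := by
  rw [Complex.Gamma_eq_integral hs, Real.Gamma_eq_integral hs, Complex.GammaIntegral]
  refine (norm_integral_le_integral_norm _).trans_eq ?_
  refine setIntegral_congr_fun measurableSet_Ioi fun x hx => ?_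
  simp only [norm_mul, Complex.norm_real, Real.norm_eq_abs, Real.abs_exp]
  rw [Complex.norm_cpow_eq_rpow_re_of_pos hx]
  simp

/-- Two applications of the functional equation gain the factor `t ^ (-2)`, which suffices for
absolute convergence of the Fourier series. -/
theorem norm_Gamma_le_div {σ t : ℝ} (hσ : 0 < σ) (ht : t ≠ 0) :
    ‖Complex.Gamma ((σ : ℂ) + t * Complex.I)‖ ≤ Real.Gamma (σ + 2) / t ^ 2 := by
  set s := (σ : ℂ) + t * Complex.I with hs
  have hre : s.re = σ := by simp [hs]
  have him : s.im = t := by simp [hs]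
  have h0 : s ≠ 0 := fun h => by rw [h] at hre; simp at hre; linarith
  have h1 : s + 1 ≠ 0 := fun h => by
    have := congrArg Complex.re h
    simp [hre] at this
    linarith
  have e : Complex.Gamma (s + 1 + 1) = (s + 1) * (s * Complex.Gamma s) := by
    rw [Complex.Gamma_add_one _ h1, Complex.Gamma_add_one _ h0]
  have hn1 : |t| ≤ ‖s‖ := by rw [← him]; exact Complex.abs_im_le_norm s
  have hn2 : |t| ≤ ‖s + 1‖ := by
    have := Complex.abs_im_le_norm (s + 1)
    simpa [him] using this
  have hb := norm_Gamma_le (s := s + 1 + 1) (by simp [hre]; linarith)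
  rw [e, norm_mul, norm_mul] at hb
  have hre2 : (s + 1 + 1).re = σ + 2 := by simp [hre]; ring
  rw [hre2] at hb
  rw [le_div_iff₀ (by positivity), ← sq_abs]
  calc ‖Complex.Gamma s‖ * |t| ^ 2 = |t| * (|t| * ‖Complex.Gamma s‖) := by ring
    _ ≤ ‖s + 1‖ * (‖s‖ * ‖Complex.Gamma s‖) := by gcongr
    _ ≤ _ := hb

theorem summable_norm_Gamma {σ η : ℝ} (hσ : 0 < σ) (hη : 0 < η) :
    Summable fun k : ℤ => ‖Complex.Gamma ((σ : ℂ) + (2 * Real.pi * k / η : ℝ) * Complex.I)‖ := by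
  have h1 : Summable fun k : ℤ =>
      Real.Gamma (σ + 2) * (η / (2 * Real.pi)) ^ 2 * (1 / (k : ℝ) ^ 2) :=
    (Real.summable_one_div_int_pow.2 one_lt_two).mul_left _
  refine h1.of_norm_bounded_eventually ?_
  have : ∀ᶠ k : ℤ in cofinite, k ≠ 0 := by
    rw [Filter.eventually_cofinite]
    simp
  filter_upwards [this] with k hk
  have hk' : (k : ℝ) ≠ 0 := by exact_mod_cast hk
  rw [norm_norm]
  refine (norm_Gamma_le_div hσ (by positivity)).trans_eq ?_
  field_simp

theorem logKern_le_exp_abs (hρ : 1 < ρ) (hρ2 : ρ < 2) (u : ℝ) :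
    logKern ρ u ≤ 3 * Real.exp (-((2 - ρ) * |u|)) := by
  rcases le_total 0 u with hu | hu
  · rw [abs_of_nonneg hu]
    refine (logKern_le_exp_neg hρ hρ2 u).trans ?_
    gcongr
    nlinarith
  · rw [abs_of_nonpos hu]
    refine (logKern_le ρ u).trans ?_
    have := Real.exp_pos (-((2 - ρ) * -u))
    rw [show (2 - ρ) * u = -((2 - ρ) * -u) by ring]
    linarith

/-- The Poisson summation formula for `logKern`. -/
theorem tsum_logKern (hρ : 1 < ρ) (hρ2 : ρ < 2) {η : ℝ} (hη : 0 < η) (u : ℝ) :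
    ((∑' l : ℤ, logKern ρ (u - l * η) : ℝ) : ℂ) = (η : ℂ)⁻¹ * ∑' k : ℤ,
      Complex.Gamma (((2 - ρ : ℝ) : ℂ) + (2 * Real.pi * k / η : ℝ) * Complex.I) *
        Complex.exp (-(2 * Real.pi * k / η : ℝ) * Complex.I * u) := by
  set f : ℝ → ℂ := fun x => ((logKern ρ (-(η * x)) : ℝ) : ℂ) with hf
  have hF : ∀ k : ℝ, 𝓕 f k = (η : ℂ)⁻¹ *
      Complex.Gamma (((2 - ρ : ℝ) : ℂ) + (2 * Real.pi * k / η : ℝ) * Complex.I) := by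
    intro k
    rw [← fourier_logKern hρ2, Real.fourier_eq', Real.fourier_eq']
    have := Measure.integral_comp_mul_left (fun v : ℝ => Complex.exp
      (((-2 * Real.pi * inner ℝ v (2 * Real.pi * k / η / (2 * Real.pi)) : ℝ) : ℂ) * Complex.I) •
        ((logKern ρ (-v) : ℝ) : ℂ)) η
    rw [abs_of_pos (inv_pos.2 hη), Complex.real_smul, Complex.ofReal_inv] at this
    rw [← this]
    refine integral_congr_ae (Filter.Eventually.of_forall fun v => ?_)
    simp only [hf]
    congr 4
    simp only [RCLike.inner_apply, conj_trivial]
    field_simp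
  have hc : Continuous f := by
    have := continuous_logKern ρ
    fun_prop
  -- The constant comes from `exp x ≥ x ^ 2 / 2`, applied to the two-sided exponential bound
  -- `logKern_le_exp_abs`.
  have hdecay : IsBigO (cocompact ℝ) f fun x : ℝ => |x| ^ (-2 : ℝ) := by
    refine IsBigO.of_bound (3 * (2 / ((2 - ρ) * η) ^ 2)) ?_
    filter_upwards [(isCompact_singleton (x := (0 : ℝ))).compl_mem_cocompact] with x hx
    have hx' : 0 < |x| := abs_pos.2 hx
    have hε : 0 < 2 - ρ := by linarith
    simp only [hf, Complex.norm_real, Real.norm_eq_abs, abs_of_nonneg (logKern_nonneg _ _)]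
    rw [abs_of_nonneg (Real.rpow_nonneg hx'.le _)]
    refine (logKern_le_exp_abs hρ hρ2 _).trans ?_
    rw [abs_neg, abs_mul, abs_of_pos hη, mul_assoc]
    gcongr
    rw [Real.rpow_neg hx'.le, Real.rpow_two, Real.exp_neg, ← div_eq_mul_inv, div_div,
      ← mul_pow, inv_eq_one_div, div_le_div_iff₀ (Real.exp_pos _) (by positivity), one_mul]
    have := Real.quadratic_le_exp_of_nonneg (x := (2 - ρ) * (η * |x|)) (by positivity)
    have : 0 ≤ (2 - ρ) * (η * |x|) := by positivity
    nlinarith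
  have hs : Summable fun k : ℤ => 𝓕 f k := by
    simp_rw [hF]
    exact ((summable_norm_Gamma (by linarith) hη).of_norm).mul_left _
  -- The evaluation point is `-(u / η)` because `f (-(u / η) + l)` is `logKern ρ (u - l * η)`.
  have hP := Real.tsum_eq_tsum_fourier_of_rpow_decay_of_summable hc one_lt_two hdecay hs (-(u / η))
  rw [Complex.ofReal_tsum, ← tsum_mul_left]
  refine Eq.trans ?_ (hP.trans ?_)
  · refine tsum_congr fun l => ?_
    simp only [hf]
    congr 2
    field_simp
    ring
  · refine tsum_congr fun k => ?_
    rw [hF, fourier_coe_apply]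
    rw [mul_assoc]
    congr 3
    push_cast
    field_simp

/-- On the line `Re s = ρ`, vanishing of `P` says that an average of points of the unit circle with
positive weights `tilt` equals one; by comparison of real parts all these points equal one. -/
theorem IsParam.mem_zeros_iff (h : IsParam M p ρ) (t : ℝ) :
    ((ρ : ℂ) + t * Complex.I) ∈ zeros M p ρ ↔
      ∀ j, Complex.exp (t * Real.log (p j) * Complex.I) = 1 := by
  have hpow : ∀ j, (p j : ℂ) ^ ((ρ : ℂ) + t * Complex.I) =
      ((p j ^ ρ : ℝ) : ℂ) * Complex.exp (t * Real.log (p j) * Complex.I) := by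
    intro j
    have hpj := (h.pos j).1
    have hne : (p j : ℂ) ≠ 0 := by exact_mod_cast hpj.ne'
    rw [Complex.cpow_add _ _ hne, Complex.ofReal_cpow hpj.le, Complex.cpow_def_of_ne_zero hne (t * _),
      ← Complex.ofReal_log hpj.le]
    ring_nf
  have hP : P M p ((ρ : ℂ) + t * Complex.I) =
      1 - ∑ j, (tilt M p ρ j : ℂ) * Complex.exp (t * Real.log (p j) * Complex.I) := by
    simp only [P, hpow, Finset.mul_sum, tilt]
    push_cast
    simp only [mul_assoc]
  constructor
  · rintro ⟨h0, -⟩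
    rw [hP, sub_eq_zero] at h0
    have h1 := congrArg Complex.re h0
    simp only [Complex.one_re, Complex.re_sum, Complex.re_ofReal_mul] at h1
    have hre : ∀ j, (Complex.exp (t * Real.log (p j) * Complex.I)).re =
        Real.cos (t * Real.log (p j)) := fun j => by
      rw [← Complex.ofReal_mul, Complex.exp_ofReal_mul_I_re]
    simp only [hre] at h1
    have h2 : ∑ j, tilt M p ρ j * (1 - Real.cos (t * Real.log (p j))) = 0 := by
      simp only [mul_sub, mul_one, Finset.sum_sub_distrib, h.sum_tilt]
      linarith
    have h3 := (Finset.sum_eq_zero_iff_of_nonneg fun j _ => mul_nonneg (h.tilt_pos j).le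
      (by linarith [Real.cos_le_one (t * Real.log (p j))])).1 h2
    intro j
    have h4 := h3 j (Finset.mem_univ j)
    have h5 : Real.cos (t * Real.log (p j)) = 1 := by
      rcases mul_eq_zero.1 h4 with h6 | h6
      · exact absurd h6 (h.tilt_pos j).ne'
      · linarith
    have h6 : Real.sin (t * Real.log (p j)) = 0 := by
      have := Real.sin_sq_add_cos_sq (t * Real.log (p j))
      rw [h5] at this
      nlinarith
    rw [← Complex.ofReal_mul, Complex.exp_mul_I, ← Complex.ofReal_cos, ← Complex.ofReal_sin, h5, h6]
    simp
  · intro h1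
    refine ⟨?_, by simp⟩
    rw [hP]
    simp only [h1, mul_one]
    rw [← Complex.ofReal_sum, h.sum_tilt]
    simp

theorem exp_eq_one_of_mem_logGroup {t : ℝ}
    (ht : ∀ j, Complex.exp (t * Real.log (p j) * Complex.I) = 1) {s : ℝ} (hs : s ∈ logGroup p) :
    Complex.exp (t * s * Complex.I) = 1 := by
  induction hs using AddSubgroup.closure_induction with
  | mem s hs =>
    obtain ⟨j, rfl⟩ := hs
    exact ht j
  | zero => simp
  | add s s' _ _ hs hs' =>
    rw [Complex.ofReal_add, mul_add, add_mul, Complex.exp_add, hs, hs', one_mul]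
  | neg s _ hs => rw [Complex.ofReal_neg, mul_neg, neg_mul, Complex.exp_neg, hs, inv_one]

/-- At a zero `β` each `p j ^ β` equals `p j ^ ρ`, so the denominator of `GE` is `-drift`. The
functional equation, used twice, gives `β (1 - β) Γ(-β) = -Γ(2 - β)`, and the signs cancel. -/
theorem IsParam.mul_GE (h : IsParam M p ρ) {t : ℝ}
    (ht : ((ρ : ℂ) + t * Complex.I) ∈ zeros M p ρ) {n : ℕ} (hn : 1 ≤ n) :
    meanDerivTerm M p n ((ρ : ℂ) + t * Complex.I) =
      (((n : ℝ) ^ (ρ - 1) / drift M p ρ : ℝ) : ℂ) *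
        (Complex.Gamma (((2 - ρ : ℝ) : ℂ) + (-t : ℝ) * Complex.I) *
          Complex.exp (t * Complex.I * Real.log n)) := by
  have hexp := (h.mem_zeros_iff t).1 ht
  set β := (ρ : ℂ) + t * Complex.I with hβ
  have hre : β.re = ρ := by simp [hβ]
  have hden : (M : ℂ) * ∑ j, (p j : ℂ) ^ β * (Real.log (p j) : ℂ) = -(drift M p ρ : ℂ) := by
    rw [drift, Complex.ofReal_neg, neg_neg, Complex.ofReal_sum, Finset.mul_sum]
    refine Finset.sum_congr rfl fun j _ => ?_
    have hpj := (h.pos j).1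
    have hne : (p j : ℂ) ≠ 0 := by exact_mod_cast hpj.ne'
    have : (p j : ℂ) ^ β = ((p j ^ ρ : ℝ) : ℂ) := by
      rw [hβ, Complex.cpow_add _ _ hne, Complex.ofReal_cpow hpj.le,
        Complex.cpow_def_of_ne_zero hne (t * _), ← Complex.ofReal_log hpj.le]
      have := hexp j
      rw [show (Real.log (p j) : ℂ) * (t * Complex.I) = t * Real.log (p j) * Complex.I by ring, this,
        mul_one]
    rw [this, tilt]
    push_cast
    ring
  have hg1 : Complex.Gamma (-β + 1) = -β * Complex.Gamma (-β) := Complex.Gamma_add_one _ (by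
    intro h0
    have := congrArg Complex.re h0
    simp [hre] at this
    linarith [h.one_lt])
  have hg2 : Complex.Gamma (-β + 1 + 1) = (-β + 1) * Complex.Gamma (-β + 1) :=
    Complex.Gamma_add_one _ (by
      intro h0
      have := congrArg Complex.re h0
      simp [hre] at this
      linarith [h.one_lt])
  have hg : Complex.Gamma (((2 - ρ : ℝ) : ℂ) + (-t : ℝ) * Complex.I) =
      -(β * (1 - β) * Complex.Gamma (-β)) := by
    rw [show ((2 - ρ : ℝ) : ℂ) + (-t : ℝ) * Complex.I = -β + 1 + 1 by
      rw [hβ]; push_cast; ring, hg2, hg1]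
    ring
  have hn0 : (0 : ℝ) < n := by exact_mod_cast hn
  have hnC : (n : ℂ) ≠ 0 := by exact_mod_cast hn0.ne'
  have hnp : (n : ℂ) ^ (β - 1) = (((n : ℝ) ^ (ρ - 1) : ℝ) : ℂ) *
      Complex.exp (t * Complex.I * Real.log n) := by
    rw [show β - 1 = ((ρ - 1 : ℝ) : ℂ) + t * Complex.I by rw [hβ]; push_cast; ring,
      Complex.cpow_add _ _ hnC, Complex.ofReal_cpow hn0.le,
      Complex.cpow_def_of_ne_zero hnC (t * _), Complex.ofReal_natCast, ← Complex.natCast_log,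
      mul_comm (Real.log n : ℂ)]
  have hd : (drift M p ρ : ℂ) ≠ 0 := by exact_mod_cast h.drift_pos.ne'
  rw [meanDerivTerm, GE, hden, hnp, hg]
  push_cast
  field_simp

/-- The series over the zeros of `P` on the line `Re s = ρ` is real and asymptotically equal to the
solution of the renewal equation. -/
theorem IsParam.exists_meanDeriv (h : IsParam M p ρ) :
    (∀ n : ℕ, 1 ≤ n → Summable fun β : zeros M p ρ => ‖meanDerivTerm M p n (β : ℂ)‖) ∧
    ∃ d : ℕ → ℝ, (∀ n : ℕ, 1 ≤ n → meanDeriv M p ρ n = (((n : ℝ) ^ (ρ - 1) * d n : ℝ) : ℂ)) ∧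
      Tendsto (fun n : ℕ => renewal M p ρ n - d n) atTop (𝓝 0) := by
  have hform : ∀ β : ℂ, β.re = ρ → β = (ρ : ℂ) + β.im * Complex.I := fun β hβ => by
    conv_lhs => rw [← Complex.re_add_im β, hβ]
  have hlog : ∀ᶠ n : ℕ in atTop, logRenewal M p ρ (Real.log n) = renewal M p ρ n := by
    filter_upwards [eventually_ge_atTop 1] with n hn
    rw [logRenewal, Real.exp_log (by exact_mod_cast hn)]
  have hlogn : Tendsto (fun n : ℕ => Real.log n) atTop atTop :=
    Real.tendsto_log_atTop.comp tendsto_natCast_atTop_atTop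
  -- If the group is dense, `ρ` is the only zero on the line and the renewal solution converges. If
  -- it is cyclic, the zeros form an arithmetic progression and the solution approaches a periodic
  -- function of `log y`.
  rcases (logGroup p).dense_or_cyclic with hd | ⟨a, ha⟩
  · have hz : ∀ t : ℝ, ((ρ : ℂ) + t * Complex.I) ∈ zeros M p ρ ↔ t = 0 := by
      intro t
      rw [h.mem_zeros_iff]
      constructor
      · intro h1
        by_contra ht
        have h2 : ∀ s : ℝ, Complex.exp (t * s * Complex.I) = 1 := by
          have hc : Continuous fun s : ℝ => Complex.exp (t * s * Complex.I) := by fun_prop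
          intro s
          have := hd.closure_eq ▸ Set.mem_univ s
          refine closure_minimal (s := (logGroup p : Set ℝ))
            (t := {s : ℝ | Complex.exp (t * s * Complex.I) = 1})
            (fun s hs => exp_eq_one_of_mem_logGroup h1 hs) (isClosed_eq hc continuous_const) this
        have h3 := h2 (Real.pi / t)
        have ht' : (t : ℂ) ≠ 0 := by exact_mod_cast ht
        rw [Complex.ofReal_div, mul_div_cancel₀ _ ht', Complex.exp_pi_mul_I] at h3
        norm_num at h3
      · rintro rfl j
        simp
    have hzs : zeros M p ρ = {(ρ : ℂ)} := by
      ext β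
      constructor
      · intro hβ
        have h1 := hform β hβ.2
        rw [h1, hz] at hβ
        rw [h1, hβ]
        simp
      · rintro rfl
        have := (hz 0).2 rfl
        simpa using this
    have hmem : (ρ : ℂ) ∈ zeros M p ρ := by rw [hzs]; rfl
    let _ : Unique (zeros M p ρ) := ⟨⟨⟨ρ, hmem⟩⟩, fun β => Subtype.ext (hzs.subset β.2)⟩
    refine ⟨fun n _ => Summable.of_finite, fun n => Real.Gamma (2 - ρ) / drift M p ρ,
      fun n hn => ?_, ?_⟩
    · rw [meanDeriv, tsum_fintype, Fintype.sum_unique]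
      have h1 := h.mul_GE (t := 0) (by simpa using hmem) hn
      simp only [Complex.ofReal_zero, zero_mul, add_zero, neg_zero, Complex.exp_zero, mul_one,
        Complex.Gamma_ofReal] at h1
      change meanDerivTerm M p n (ρ : ℂ) =
        (((n : ℝ) ^ (ρ - 1) * (Real.Gamma (2 - ρ) / drift M p ρ) : ℝ) : ℂ)
      rw [h1]
      push_cast
      ring
    · have h1 := ((h.tendsto_logRenewal_of_dense hd).comp hlogn)
      rw [integral_logKern h.lt_two] at h1
      have h2 := h1.sub_const (Real.Gamma (2 - ρ) / drift M p ρ)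
      rw [sub_self] at h2
      refine h2.congr' ?_
      filter_upwards [hlog] with n hn
      simp [hn]
  · set η := |a| with hη
    have ha0 : a ≠ 0 := by
      rintro rfl
      obtain ⟨j⟩ : Nonempty (Fin A) := ⟨⟨0, h.pos_A⟩⟩
      have hmem : Real.log (p j) ∈ logGroup p :=
        AddSubgroup.subset_closure (Set.mem_range_self j)
      rw [ha] at hmem
      simp only [AddSubgroup.closure_singleton_zero, AddSubgroup.mem_bot] at hmem
      have := Real.log_neg (h.pos j).1 (h.pos j).2
      linarith
    have hη0 : 0 < η := abs_pos.2 ha0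
    have hG : ∀ t, t ∈ logGroup p ↔ ∃ k : ℤ, t = k * η := by
      intro t
      rw [ha, AddSubgroup.mem_closure_singleton]
      simp only [zsmul_eq_mul]
      rcases abs_choice a with hs | hs
      · rw [hη, hs]
        exact exists_congr fun k => eq_comm
      · rw [hη, hs]
        constructor
        · rintro ⟨k, hk⟩
          exact ⟨-k, by push_cast; linarith⟩
        · rintro ⟨k, hk⟩
          exact ⟨-k, by push_cast; linarith⟩
    have hz : ∀ t : ℝ, ((ρ : ℂ) + t * Complex.I) ∈ zeros M p ρ ↔
        ∃ k : ℤ, t = -(2 * Real.pi * k / η) := by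
      intro t
      rw [h.mem_zeros_iff]
      constructor
      · intro h1
        have h2 := exp_eq_one_of_mem_logGroup h1 ((hG η).2 ⟨1, by simp⟩)
        obtain ⟨k, hk⟩ := Complex.exp_eq_one_iff.1 h2
        refine ⟨-k, ?_⟩
        have h3 : ((t * η : ℝ) : ℂ) * Complex.I = ((k * (2 * Real.pi) : ℝ) : ℂ) * Complex.I := by
          push_cast
          rw [hk]; ring
        have h4 : t * η = k * (2 * Real.pi) := by
          have := mul_right_cancel₀ Complex.I_ne_zero h3
          exact_mod_cast this
        push_cast
        field_simp
        linarith
      · rintro ⟨k, rfl⟩ j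
        obtain ⟨l, hl⟩ := (hG (Real.log (p j))).1
          (AddSubgroup.subset_closure (Set.mem_range_self j))
        rw [hl, Complex.exp_eq_one_iff]
        refine ⟨-(k * l), ?_⟩
        have : (η : ℂ) ≠ 0 := by exact_mod_cast hη0.ne'
        push_cast
        field_simp
    -- The minus sign in the enumeration of the zeros makes the Gamma arguments agree term by term
    -- with those in `tsum_logKern`.
    let e : ℤ ≃ zeros M p ρ := Equiv.ofBijective
      (fun k => ⟨(ρ : ℂ) + (-(2 * Real.pi * k / η) : ℝ) * Complex.I, (hz _).2 ⟨k, rfl⟩⟩) (by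
        constructor
        · intro k l hkl
          have h1 := congrArg (fun z : zeros M p ρ => (z : ℂ).im) hkl
          simp only [Complex.add_im, Complex.ofReal_im, Complex.mul_im, Complex.ofReal_re,
            Complex.I_im, Complex.I_re, mul_one, mul_zero, zero_add, add_zero] at h1
          field_simp at h1
          have h2 : (k : ℝ) = l := by linarith
          exact_mod_cast h2
        · rintro ⟨β, hβ⟩
          have h1 := hform β hβ.2
          have h2 := hβ
          rw [h1] at h2
          obtain ⟨k, hk⟩ := (hz _).1 h2
          refine ⟨k, Subtype.ext ?_⟩
          simp only
          rw [h1, hk])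
    have hterm : ∀ n : ℕ, 1 ≤ n → ∀ k : ℤ, meanDerivTerm M p n (e k : ℂ) =
        (((n : ℝ) ^ (ρ - 1) / drift M p ρ : ℝ) : ℂ) *
        (Complex.Gamma (((2 - ρ : ℝ) : ℂ) + (2 * Real.pi * k / η : ℝ) * Complex.I) *
        Complex.exp (-(2 * Real.pi * k / η : ℝ) * Complex.I * Real.log n)) := by
      intro n hn k
      have := h.mul_GE (t := -(2 * Real.pi * k / η)) ((hz _).2 ⟨k, rfl⟩) hn
      rw [neg_neg] at this
      refine this.trans ?_
      rw [Complex.ofReal_neg]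
    refine ⟨fun n hn => ?_, fun n => η / drift M p ρ * ∑' l : ℤ, logKern ρ (Real.log n - l * η),
      fun n hn => ?_, ?_⟩
    · rw [← e.summable_iff]
      have h1 := (summable_norm_Gamma (σ := 2 - ρ) (by linarith [h.lt_two]) hη0).mul_left
        ‖(((n : ℝ) ^ (ρ - 1) / drift M p ρ : ℝ) : ℂ)‖
      refine h1.congr fun k => ?_
      simp only [Function.comp_apply]
      rw [hterm n hn k, norm_mul, norm_mul]
      have : ‖Complex.exp (-(2 * Real.pi * k / η : ℝ) * Complex.I * Real.log n)‖ = 1 := by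
        rw [show (-(2 * Real.pi * k / η : ℝ) * Complex.I * Real.log n : ℂ) =
          ((-(2 * Real.pi * k / η) * Real.log n : ℝ) : ℂ) * Complex.I by push_cast; ring,
          Complex.norm_exp_ofReal_mul_I]
      rw [this, mul_one]
    · rw [meanDeriv, ← e.tsum_eq, tsum_congr (hterm n hn), tsum_mul_left]
      have h1 := tsum_logKern h.one_lt h.lt_two hη0 (Real.log n)
      have hηC : (η : ℂ) ≠ 0 := by exact_mod_cast hη0.ne'
      have h2 := (eq_inv_mul_iff_mul_eq₀ hηC).1 h1
      rw [← h2]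
      push_cast
      ring
    · refine ((h.tendsto_logRenewal_of_lattice hη0 hG).comp hlogn).congr' ?_
      filter_upwards [hlog] with n hn
      simp only [Function.comp_apply, hn]

end Fourier

/-! ### Moments of independent sums and Gaussian moments -/

section BinomialConvolution

variable {Ω : Type*} [MeasurableSpace Ω] {μ : Measure Ω} [IsProbabilityMeasure μ]

theorem integral_add_pow {Y Z : Ω → ℝ} (hYZ : IndepFun Y Z μ) (hY : ∀ k : ℕ, MemLp Y k μ)
    (hZ : ∀ k : ℕ, MemLp Z k μ) (m : ℕ) :
    ∫ ω, (Y ω + Z ω) ^ m ∂μ = ∑ k ∈ Finset.range (m + 1),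
      (m.choose k : ℝ) * (∫ ω, Y ω ^ k ∂μ) * ∫ ω, Z ω ^ (m - k) ∂μ := by
  have hind : ∀ k l : ℕ, IndepFun (fun ω => Y ω ^ k) (fun ω => Z ω ^ l) μ := fun k l =>
    hYZ.comp (φ := fun x => x ^ k) (ψ := fun x => x ^ l) (by fun_prop) (by fun_prop)
  have hint : ∀ k l : ℕ, Integrable (fun ω => Y ω ^ k * Z ω ^ l) μ := fun k l =>
    (hind k l).integrable_mul (integrable_pow_of_memLp (hY k)) (integrable_pow_of_memLp (hZ l))
  simp_rw [add_pow]
  rw [integral_finsetSum _ fun k _ => (hint _ _).mul_const _]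
  refine Finset.sum_congr rfl fun k _ => ?_
  rw [integral_mul_const, (hind k (m - k)).integral_fun_mul_eq_mul_integral
    ((hY k).1.pow k) ((hZ (m - k)).1.pow _)]
  ring

end BinomialConvolution

section GaussianMoments

theorem normalMoment_of_odd {k : ℕ} (hk : Odd k) : normalMoment k = 0 := by
  have h1 := gaussianReal_map_neg (μ := 0) (v := 1)
  have h2 : normalMoment k = -normalMoment k := by
    conv_lhs => rw [normalMoment, ← neg_zero (G := ℝ), ← h1,
      integral_map (by fun_prop) (by fun_prop)]
    simp_rw [hk.neg_pow]
    rw [integral_neg, normalMoment]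
  linarith

theorem normalMoment_zero : normalMoment 0 = 1 := by simp [normalMoment]

theorem normalMoment_two : normalMoment 2 = 1 := by
  have := variance_id_gaussianReal (μ := 0) (v := 1)
  rw [variance_eq_integral (by fun_prop)] at this
  simpa [normalMoment] using this

/-- The `k`-th moment of the centered normal distribution with variance `V`. -/
def gaussMoment (k : ℕ) (V : ℝ) : ℝ := normalMoment k * V ^ (k / 2)

theorem gaussMoment_zero (V : ℝ) : gaussMoment 0 V = 1 := by
  simp [gaussMoment, normalMoment_zero]

theorem gaussMoment_one (V : ℝ) : gaussMoment 1 V = 0 := by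
  simp [gaussMoment, normalMoment_of_odd odd_one]

theorem gaussMoment_two (V : ℝ) : gaussMoment 2 V = V := by
  simp [gaussMoment, normalMoment_two]

theorem gaussMoment_of_zero {k : ℕ} (hk : k ≠ 0) : gaussMoment k 0 = 0 := by
  rcases Nat.even_or_odd k with h | h
  · have : k / 2 ≠ 0 := by obtain ⟨l, rfl⟩ := h; omega
    simp [gaussMoment, this]
  · simp [gaussMoment, normalMoment_of_odd h]

/-- Valid for `a` of either sign and despite the rounding in `k / 2`, since the odd normal moments
vanish. -/
theorem gaussMoment_sq_mul (k : ℕ) (a V : ℝ) :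
    gaussMoment k (a ^ 2 * V) = a ^ k * gaussMoment k V := by
  rcases Nat.even_or_odd k with h | h
  · obtain ⟨l, rfl⟩ := h
    have : (l + l) / 2 = l := by omega
    rw [gaussMoment, gaussMoment, this, mul_pow, ← pow_mul, two_mul]
    ring
  · simp [gaussMoment, normalMoment_of_odd h]

theorem integral_pow_gaussianReal (k : ℕ) (v : ℝ≥0) :
    ∫ x, x ^ k ∂(gaussianReal 0 v) = gaussMoment k v := by
  have h1 := gaussianReal_map_const_mul (μ := 0) (v := 1) (√(v : ℝ))
  have h2 : gaussianReal (√(v : ℝ) * 0) (NNReal.mk (√(v : ℝ) ^ 2) (sq_nonneg _) * 1) = gaussianReal 0 v := by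
    rw [mul_zero, mul_one]
    congr 1
    exact NNReal.eq (Real.sq_sqrt v.coe_nonneg)
  rw [← h1.trans h2, integral_map (by fun_prop) (by fun_prop)]
  simp_rw [mul_pow]
  rw [integral_const_mul, ← normalMoment]
  have := gaussMoment_sq_mul k (√(v : ℝ)) 1
  rw [Real.sq_sqrt v.coe_nonneg, mul_one] at this
  rw [this]
  simp [gaussMoment]

/-- The convolution of two centered normal laws is normal. This identity is all that the moment
recurrences need; explicit values of the moments are never used beyond order two. -/
theorem gaussMoment_add {V W : ℝ} (hV : 0 ≤ V) (hW : 0 ≤ W) (m : ℕ) :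
    gaussMoment m (V + W) = ∑ k ∈ Finset.range (m + 1),
      (m.choose k : ℝ) * gaussMoment k V * gaussMoment (m - k) W := by
  lift V to ℝ≥0 using hV
  lift W to ℝ≥0 using hW
  have h1 := gaussianReal_conv_gaussianReal (m₁ := 0) (m₂ := 0) (v₁ := V) (v₂ := W)
  rw [add_zero] at h1
  have hlaw : ∀ v : ℝ≥0, ∀ k : ℕ, MemLp (fun x : ℝ => x) k (gaussianReal 0 v) := fun v k =>
    memLp_id_gaussianReal' k (by simp)
  have h2 := integral_add_pow (μ := (gaussianReal 0 V).prod (gaussianReal 0 W)) (Y := Prod.fst)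
    (Z := Prod.snd) (indepFun_prod (X := fun x => x) (Y := fun x => x) measurable_id measurable_id)
    (fun k => (hlaw V k).comp_measurePreserving measurePreserving_fst)
    (fun k => (hlaw W k).comp_measurePreserving measurePreserving_snd) m
  rw [← NNReal.coe_add, ← integral_pow_gaussianReal, ← h1, Measure.conv,
    integral_map (by fun_prop) (by fun_prop), h2]
  refine Finset.sum_congr rfl fun k _ => ?_
  rw [← integral_pow_gaussianReal, ← integral_pow_gaussianReal, integral_fun_fst fun x => x ^ k,
    integral_fun_snd fun x => x ^ (m - k)]
  simp

/-- The binomial recurrence for the moments of sums of independent identically distributed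
centered random variables implies that these moments are asymptotically Gaussian. -/
theorem exists_abs_sub_gaussMoment_le {D : ℕ → ℕ → ℝ} {κ : ℕ → ℝ} (hκ0 : κ 0 = 1) (hκ1 : κ 1 = 0)
    (hκ2 : 0 ≤ κ 2) (hD0 : ∀ m, D m 0 = 0 ^ m)
    (hD : ∀ m n, D m (n + 1) = ∑ k ∈ Finset.range (m + 1),
      (m.choose k : ℝ) * κ k * D (m - k) n) (m : ℕ) :
    ∃ C, 0 ≤ C ∧ ∀ n : ℕ, |D m n - gaussMoment m (n * κ 2)| ≤ C * √n ^ (m - 1) := by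
  have h0 : ∀ n, D 0 n = 1 := by
    intro n
    induction n with
    | zero => simp [hD0]
    | succ n ih => simp [hD, hκ0, ih]
  have h1 : ∀ n, D 1 n = 0 := by
    intro n
    induction n with
    | zero => simp [hD0]
    | succ n ih => simp [hD, Finset.sum_range_succ, hκ0, hκ1, ih]
  have h2 : ∀ n : ℕ, D 2 n = n * κ 2 := by
    intro n
    induction n with
    | zero => simp [hD0]
    | succ n ih => simp [hD, Finset.sum_range_succ, hκ0, hκ1, ih, h0]; ring
  have hg : ∀ (j n : ℕ), gaussMoment j (n * κ 2) = √n ^ j * gaussMoment j (κ 2) := by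
    intro j n
    rw [← gaussMoment_sq_mul, Real.sq_sqrt (Nat.cast_nonneg n)]
  induction m using Nat.strong_induction_on with
  | _ m ih =>
  rcases lt_or_ge m 3 with hm | hm
  · refine ⟨0, le_rfl, fun n => ?_⟩
    interval_cases m
    · simp [h0, gaussMoment_zero]
    · simp [h1, gaussMoment_one]
    · simp [h2, gaussMoment_two]
  have hmono : ∀ (n i : ℕ), i ≤ m - 3 → √(n : ℝ) ^ i ≤ √((n + 1 : ℕ) : ℝ) ^ (m - 3) := by
    intro n i hi
    have h1 : √(n : ℝ) ≤ √((n + 1 : ℕ) : ℝ) := Real.sqrt_le_sqrt (by push_cast; linarith)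
    have h2 : 1 ≤ √((n + 1 : ℕ) : ℝ) := Real.one_le_sqrt.2 (by push_cast; linarith [n.cast_nonneg (α := ℝ)])
    exact (pow_le_pow_left₀ (Real.sqrt_nonneg _) h1 _).trans (pow_le_pow_right₀ h2 hi)
  have hbd : ∀ j < m, ∃ B, 0 ≤ B ∧ ∀ n : ℕ, |D j n| ≤ B * √n ^ j := by
    intro j hj
    obtain ⟨C, hC, hC'⟩ := ih j hj
    refine ⟨C + |gaussMoment j (κ 2)|, by positivity, fun n => ?_⟩
    rcases Nat.eq_zero_or_pos n with rfl | hn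
    · rcases Nat.eq_zero_or_pos j with rfl | hj0
      · simp [h0, gaussMoment_zero, hC]
      · simp [hD0, hj0.ne']
    have h3 := hC' n
    rw [hg] at h3
    have h4 : √(n : ℝ) ^ (j - 1) ≤ √n ^ j :=
      pow_le_pow_right₀ (Real.one_le_sqrt.2 (by exact_mod_cast hn)) (by omega)
    have h5 := mul_le_mul_of_nonneg_left h4 hC
    have h6 : |√(n : ℝ) ^ j * gaussMoment j (κ 2)| = √n ^ j * |gaussMoment j (κ 2)| := by
      rw [abs_mul, abs_of_nonneg (by positivity)]
    have h7 := abs_sub_abs_le_abs_sub (D j n) (√(n : ℝ) ^ j * gaussMoment j (κ 2))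
    linarith
  -- The index is shifted by one. For `k = 0` the term vanishes by centering; for `k = 1` the second
  -- moments agree and the error is inductive; for `k ≥ 2` both terms already have order at most `(m
  -- - 3) / 2` in `n`.
  have hterm : ∀ k : ℕ, ∃ K, 0 ≤ K ∧ ∀ n : ℕ,
      |(m.choose (k + 1) : ℝ) * κ (k + 1) * D (m - (k + 1)) n -
        m.choose (k + 1) * gaussMoment (k + 1) (κ 2) * gaussMoment (m - (k + 1)) (n * κ 2)| ≤
        K * √((n + 1 : ℕ) : ℝ) ^ (m - 3) := by
    intro k
    rcases Nat.lt_or_ge k 2 with hk | hk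
    · interval_cases k
      · exact ⟨0, le_rfl, fun n => by simp [hκ1, gaussMoment_one]⟩
      · obtain ⟨C, hC, hC'⟩ := ih (m - 2) (by omega)
        refine ⟨m.choose 2 * κ 2 * C, by positivity, fun n => ?_⟩
        have h3 := (hC' n).trans (mul_le_mul_of_nonneg_left (hmono n (m - 2 - 1) (by omega)) hC)
        simp only [one_add_one_eq_two, gaussMoment_two]
        rw [← mul_sub, abs_mul, abs_of_nonneg (by positivity), mul_assoc _ C]
        exact mul_le_mul_of_nonneg_left h3 (by positivity)
    · obtain ⟨B, hB, hB'⟩ := hbd (m - (k + 1)) (by omega)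
      refine ⟨m.choose (k + 1) * |κ (k + 1)| * B + m.choose (k + 1) *
        |gaussMoment (k + 1) (κ 2)| * |gaussMoment (m - (k + 1)) (κ 2)|, by positivity,
        fun n => ?_⟩
      have h3 := hmono n (m - (k + 1)) (by omega)
      have h4 := (hB' n).trans (mul_le_mul_of_nonneg_left h3 hB)
      refine (abs_sub _ _).trans ?_
      rw [hg, abs_mul, abs_mul, abs_mul, abs_mul, abs_mul, Nat.abs_cast,
        abs_of_nonneg (show 0 ≤ √(n : ℝ) ^ (m - (k + 1)) by positivity), add_mul]
      refine add_le_add ?_ ?_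
      · rw [mul_assoc _ B]
        exact mul_le_mul_of_nonneg_left h4 (by positivity)
      · rw [mul_comm (√(n : ℝ) ^ (m - (k + 1))), ← mul_assoc]
        exact mul_le_mul_of_nonneg_left h3 (by positivity)
  choose K hK hK' using hterm
  have hstep : ∀ n : ℕ, |(D m (n + 1) - gaussMoment m ((n + 1 : ℕ) * κ 2)) -
      (D m n - gaussMoment m (n * κ 2))| ≤
      (∑ k ∈ Finset.range m, K k) * √((n + 1 : ℕ) : ℝ) ^ (m - 3) := by
    intro n
    have e : ((n + 1 : ℕ) : ℝ) * κ 2 = κ 2 + n * κ 2 := by push_cast; ring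
    rw [hD, e, gaussMoment_add hκ2 (by positivity), ← Finset.sum_sub_distrib,
      Finset.sum_range_succ']
    simp only [Nat.choose_zero_right, Nat.cast_one, hκ0, gaussMoment_zero, one_mul, Nat.sub_zero,
      add_sub_cancel_right]
    rw [Finset.sum_mul]
    exact (Finset.abs_sum_le_sum_abs _ _).trans (Finset.sum_le_sum fun k _ => hK' k n)
  have hKs : 0 ≤ ∑ k ∈ Finset.range m, K k := Finset.sum_nonneg fun k _ => hK k
  set S := ∑ k ∈ Finset.range m, K k
  refine ⟨S, hKs, fun n => ?_⟩
  -- The errors of `n` steps of order `√n ^ (m - 3)` are added, which gives the exponent `m - 1`.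
  have hfin : |D m n - gaussMoment m (n * κ 2)| ≤ S * (n * √n ^ (m - 3)) := by
    induction n with
    | zero =>
      have : m ≠ 0 := by omega
      simp [hD0, this, gaussMoment_of_zero]
    | succ n ihn =>
      have h3 := hstep n
      have h4 := mul_le_mul_of_nonneg_left (hmono n (m - 3) le_rfl) (n.cast_nonneg (α := ℝ))
      have h5 := mul_le_mul_of_nonneg_left h4 hKs
      have h6 := abs_sub_abs_le_abs_sub (D m (n + 1) - gaussMoment m ((n + 1 : ℕ) * κ 2))
        (D m n - gaussMoment m (n * κ 2))
      have e : S * (((n + 1 : ℕ) : ℝ) * √((n + 1 : ℕ) : ℝ) ^ (m - 3)) =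
        S * (n * √((n + 1 : ℕ) : ℝ) ^ (m - 3)) + S * √((n + 1 : ℕ) : ℝ) ^ (m - 3) := by
        push_cast; ring
      rw [e]
      linarith
  have e : √(n : ℝ) ^ (m - 1) = n * √n ^ (m - 3) := by
    rw [show m - 1 = 2 + (m - 3) by omega, pow_add, Real.sq_sqrt (Nat.cast_nonneg n)]
  rw [e]
  exact hfin

end GaussianMoments

/-! ### Calculus of functions of the root labels, asymptotically in all `L^k` -/

section RootFunctions

variable {M A : ℕ} {p : Fin A → ℝ} {Ω : Type*} [MeasurableSpace Ω] {μ : Measure Ω}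
  [IsProbabilityMeasure μ] {X : ℕ → Edge M → Ω → Fin A}

/-- A sequence of functions of the labels at the root. -/
abbrev RootFun (M A : ℕ) : Type := ∀ n : ℕ, (Fin n → Fin M → Fin A) → ℝ

/-- The expectation of a function of the labels at the root. -/
def rootMean (μ : Measure Ω) (X : ℕ → Edge M → Ω → Fin A) (φ : RootFun M A) (n : ℕ) : ℝ :=
  ∫ ω, φ n (rootLabels X n ω) ∂μ

/-- The sequence is bounded in all the spaces `L^k`. -/
def LpBounded (μ : Measure Ω) (X : ℕ → Edge M → Ω → Fin A) (φ : RootFun M A) : Prop :=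
  ∀ k : ℕ, ∃ C, ∀ᶠ n in atTop, rootMean μ X (fun n r => |φ n r| ^ k) n ≤ C

/-- The sequence tends to zero in all the spaces `L^k`. -/
def LpNull (μ : Measure Ω) (X : ℕ → Edge M → Ω → Fin A) (φ : RootFun M A) : Prop :=
  ∀ k : ℕ, k ≠ 0 → Tendsto (rootMean μ X fun n r => |φ n r| ^ k) atTop (𝓝 0)

variable {φ ψ φ' ψ' : RootFun M A}

theorem IsModel.rootMean_mono (h : IsModel p μ X) {n : ℕ} (hle : ∀ r, φ n r ≤ ψ n r) :
    rootMean μ X φ n ≤ rootMean μ X ψ n :=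
  integral_mono (h.integrable_comp_rootLabels _) (h.integrable_comp_rootLabels _) fun _ => hle _

theorem rootMean_nonneg {n : ℕ} (hφ : ∀ r, 0 ≤ φ n r) : 0 ≤ rootMean μ X φ n :=
  integral_nonneg fun _ => hφ _

theorem IsModel.rootMean_add (h : IsModel p μ X) (φ ψ : RootFun M A) (n : ℕ) :
    rootMean μ X (fun n r => φ n r + ψ n r) n = rootMean μ X φ n + rootMean μ X ψ n :=
  integral_add (h.integrable_comp_rootLabels _) (h.integrable_comp_rootLabels _)

theorem IsModel.rootMean_sub (h : IsModel p μ X) (φ ψ : RootFun M A) (n : ℕ) :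
    rootMean μ X (fun n r => φ n r - ψ n r) n = rootMean μ X φ n - rootMean μ X ψ n :=
  integral_sub (h.integrable_comp_rootLabels _) (h.integrable_comp_rootLabels _)

theorem rootMean_mul (μ : Measure Ω) (X : ℕ → Edge M → Ω → Fin A) (c : ℕ → ℝ) (φ : RootFun M A)
    (n : ℕ) : rootMean μ X (fun n r => c n * φ n r) n = c n * rootMean μ X φ n :=
  integral_const_mul _ _

theorem rootMean_const (c : ℕ → ℝ) (n : ℕ) : rootMean μ X (fun n _ => c n) n = c n := by
  simp [rootMean]

theorem IsModel.rootMean_sum (h : IsModel p μ X) {ι : Type*} (s : Finset ι) (φ : ι → RootFun M A)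
    (n : ℕ) : rootMean μ X (fun n r => ∑ i ∈ s, φ i n r) n = ∑ i ∈ s, rootMean μ X (φ i) n :=
  integral_finsetSum _ fun _ _ => h.integrable_comp_rootLabels _

theorem tendsto_zero_of_le_add {f g : ℕ → ℝ} {C : ℝ} (hf : ∀ n, 0 ≤ f n)
    (hg : Tendsto g atTop (𝓝 0))
    (hle : ∀ ε > 0, ∃ K, ∀ᶠ n in atTop, f n ≤ ε * C + K * g n) : Tendsto f atTop (𝓝 0) := by
  rw [Metric.tendsto_nhds]
  intro ε hε
  obtain ⟨K, hK⟩ := hle (ε / (2 * (|C| + 1))) (by positivity)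
  have h1 : Tendsto (fun n => K * g n) atTop (𝓝 0) := by simpa using hg.const_mul K
  filter_upwards [hK, h1.eventually_lt_const (half_pos hε)] with n hn hn'
  rw [Real.dist_eq, sub_zero, abs_of_nonneg (hf n)]
  have h2 : ε / (2 * (|C| + 1)) * C ≤ ε / 2 := by
    rw [div_mul_eq_mul_div, div_le_div_iff₀ (by positivity) two_pos]
    nlinarith [le_abs_self C]
  linarith

theorem IsModel.lpBounded_of_le (h : IsModel p μ X) (hψ : LpBounded μ X ψ)
    (hle : ∀ᶠ n in atTop, ∀ r, |φ n r| ≤ |ψ n r|) : LpBounded μ X φ := by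
  intro k
  obtain ⟨C, hC⟩ := hψ k
  refine ⟨C, ?_⟩
  filter_upwards [hC, hle] with n h1 h2
  exact (h.rootMean_mono (φ := fun n r => |φ n r| ^ k) (ψ := fun n r => |ψ n r| ^ k)
    fun r => pow_le_pow_left₀ (abs_nonneg _) (h2 r) k).trans h1

theorem lpBounded_const (μ : Measure Ω) [IsProbabilityMeasure μ] (X : ℕ → Edge M → Ω → Fin A)
    (C : ℝ) : LpBounded μ X fun _ _ => C := by
  intro k
  exact ⟨|C| ^ k, Eventually.of_forall fun n => (rootMean_const (fun _ => |C| ^ k) n).le⟩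

theorem IsModel.lpBounded_of_abs_le (h : IsModel p μ X) {C : ℝ}
    (hle : ∀ᶠ n in atTop, ∀ r, |φ n r| ≤ C) : LpBounded μ X φ :=
  h.lpBounded_of_le (lpBounded_const μ X C) <| hle.mono fun _ hn r => (hn r).trans (le_abs_self _)

/-- The form in which regularity of the mean is used: for typical root labels the error is a small
multiple of something bounded, and for atypical ones it is a possibly large multiple of something
null. -/
theorem IsModel.lpNull_of_le (h : IsModel p μ X) (hψ : LpBounded μ X ψ) (hφ' : LpNull μ X φ')
    (hle : ∀ ε > 0, ∃ K, ∀ᶠ n in atTop, ∀ r, |φ n r| ≤ ε * |ψ n r| + K * |φ' n r|) :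
    LpNull μ X φ := by
  intro k hk
  obtain ⟨C, hC⟩ := hψ k
  refine tendsto_zero_of_le_add (C := C) (fun n => rootMean_nonneg fun r => by positivity)
    (hφ' k hk) fun ε hε => ?_
  obtain ⟨δ, hδ, hδε⟩ : ∃ δ > 0, 2 ^ (k - 1) * δ ^ k ≤ ε := by
    have h1 : Tendsto (fun δ : ℝ => 2 ^ (k - 1) * δ ^ k) (𝓝[>] 0) (𝓝 0) := by
      have : Continuous fun δ : ℝ => 2 ^ (k - 1) * δ ^ k := by fun_prop
      have h2 := this.tendsto 0
      rw [zero_pow hk, mul_zero] at h2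
      exact h2.mono_left nhdsWithin_le_nhds
    obtain ⟨δ, h2, h3⟩ := ((h1.eventually_le_const hε).and self_mem_nhdsWithin).exists
    exact ⟨δ, h3, h2⟩
  obtain ⟨K, hK⟩ := hle δ hδ
  refine ⟨2 ^ (k - 1) * |K| ^ k, ?_⟩
  filter_upwards [hK, hC] with n hn hn'
  have h1 : rootMean μ X (fun n r => |φ n r| ^ k) n ≤ rootMean μ X
      (fun n r => 2 ^ (k - 1) * δ ^ k * |ψ n r| ^ k + 2 ^ (k - 1) * |K| ^ k * |φ' n r| ^ k) n := by
    refine h.rootMean_mono fun r => ?_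
    have h2 : |φ n r| ≤ δ * |ψ n r| + |K| * |φ' n r| :=
      (hn r).trans (add_le_add le_rfl (mul_le_mul_of_nonneg_right (le_abs_self K) (abs_nonneg _)))
    refine (pow_le_pow_left₀ (abs_nonneg _) h2 k).trans
      ((add_pow_le (by positivity) (by positivity) k).trans_eq ?_)
    rw [mul_pow, mul_pow]
    ring
  rw [h.rootMean_add (fun n r => 2 ^ (k - 1) * δ ^ k * |ψ n r| ^ k),
    rootMean_mul μ X (fun _ => 2 ^ (k - 1) * δ ^ k) fun n r => |ψ n r| ^ k,
    rootMean_mul μ X (fun _ => 2 ^ (k - 1) * |K| ^ k) fun n r => |φ' n r| ^ k] at h1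
  refine h1.trans (add_le_add ?_ le_rfl)
  have h3 : 0 ≤ rootMean μ X (fun n r => |ψ n r| ^ k) n := rootMean_nonneg fun r => by positivity
  exact (mul_le_mul_of_nonneg_left hn' (by positivity)).trans
    (mul_le_mul_of_nonneg_right hδε (h3.trans hn'))

theorem lpNull_zero : LpNull μ X fun _ _ => 0 := by
  intro k hk
  have e : (rootMean μ X fun (_ : ℕ) _ => |(0 : ℝ)| ^ k) = fun _ => 0 := by
    funext n
    simp [rootMean, zero_pow hk]
  rw [e]
  exact tendsto_const_nhds

theorem IsModel.lpNull_of_abs_le (h : IsModel p μ X)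
    (hle : ∀ ε > 0, ∀ᶠ n in atTop, ∀ r, |φ n r| ≤ ε) : LpNull μ X φ := by
  refine h.lpNull_of_le (lpBounded_const μ X 1) lpNull_zero fun ε hε => ⟨0, ?_⟩
  filter_upwards [hle ε hε] with n hn r
  simpa using hn r

theorem IsModel.lpNull_of_tendsto (h : IsModel p μ X) {c : ℕ → ℝ} (hc : Tendsto c atTop (𝓝 0)) :
    LpNull μ X fun n _ => c n := by
  refine h.lpNull_of_abs_le fun ε hε => ?_
  have h1 : Tendsto (fun n => |c n|) atTop (𝓝 0) := by simpa using hc.abs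
  exact (h1.eventually_le_const hε).mono fun n hn _ => hn

theorem IsModel.lpNull_add (h : IsModel p μ X) (hφ : LpNull μ X φ) (hψ : LpNull μ X ψ) :
    LpNull μ X (φ + ψ) := by
  intro k hk
  have h1 : Tendsto (fun n => 2 ^ (k - 1) * rootMean μ X (fun n r => |φ n r| ^ k) n +
      2 ^ (k - 1) * rootMean μ X (fun n r => |ψ n r| ^ k) n) atTop (𝓝 0) := by
    simpa using ((hφ k hk).const_mul (2 ^ (k - 1))).add ((hψ k hk).const_mul (2 ^ (k - 1)))
  refine squeeze_zero (fun n => rootMean_nonneg fun r => by positivity) (fun n => ?_) h1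
  rw [← rootMean_mul μ X (fun _ => 2 ^ (k - 1)), ← rootMean_mul μ X (fun _ => 2 ^ (k - 1)),
    ← h.rootMean_add]
  refine h.rootMean_mono fun r => ?_
  refine (pow_le_pow_left₀ (abs_nonneg _) (abs_add_le _ _) k).trans
    ((add_pow_le (abs_nonneg _) (abs_nonneg _) k).trans_eq (by ring))

theorem IsModel.lpBounded_add (h : IsModel p μ X) (hφ : LpBounded μ X φ) (hψ : LpBounded μ X ψ) :
    LpBounded μ X (φ + ψ) := by
  intro k
  obtain ⟨C, hC⟩ := hφ k
  obtain ⟨C', hC'⟩ := hψ k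
  refine ⟨2 ^ (k - 1) * C + 2 ^ (k - 1) * C', ?_⟩
  filter_upwards [hC, hC'] with n hn hn'
  refine le_trans ?_ (add_le_add (mul_le_mul_of_nonneg_left hn (by positivity))
    (mul_le_mul_of_nonneg_left hn' (by positivity)))
  rw [← rootMean_mul μ X (fun _ => 2 ^ (k - 1)), ← rootMean_mul μ X (fun _ => 2 ^ (k - 1)),
    ← h.rootMean_add]
  refine h.rootMean_mono fun r => ?_
  refine (pow_le_pow_left₀ (abs_nonneg _) (abs_add_le _ _) k).trans
    ((add_pow_le (abs_nonneg _) (abs_nonneg _) k).trans_eq (by ring))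

theorem LpNull.lpBounded (hφ : LpNull μ X φ) :
    LpBounded μ X φ := by
  intro k
  rcases Nat.eq_zero_or_pos k with rfl | hk
  · exact ⟨1, Eventually.of_forall fun n => by simp [rootMean]⟩
  · exact ⟨1, (hφ k hk.ne').eventually_le_const one_pos⟩

theorem IsModel.lpBounded_mul (h : IsModel p μ X) (hφ : LpBounded μ X φ) (hψ : LpBounded μ X ψ) :
    LpBounded μ X (φ * ψ) := by
  intro k
  obtain ⟨C, hC⟩ := hφ (k * 2)
  obtain ⟨C', hC'⟩ := hψ (k * 2)
  refine ⟨C + C', ?_⟩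
  filter_upwards [hC, hC'] with n hn hn'
  refine le_trans ?_ (add_le_add hn hn')
  rw [← h.rootMean_add]
  refine h.rootMean_mono fun r => ?_
  simp only [Pi.mul_apply, abs_mul, mul_pow, pow_mul]
  nlinarith [sq_nonneg (|φ n r| ^ k - |ψ n r| ^ k), sq_nonneg (|φ n r| ^ k), sq_nonneg (|ψ n r| ^ k)]

/-- The weighted inequality `2 a b ≤ ε b ^ 2 + ε⁻¹ a ^ 2` plays the role of the Cauchy–Schwarz
inequality. -/
theorem IsModel.lpNull_mul (h : IsModel p μ X) (hφ : LpNull μ X φ) (hψ : LpBounded μ X ψ) :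
    LpNull μ X (φ * ψ) := by
  intro k hk
  obtain ⟨C, hC⟩ := hψ (k * 2)
  refine tendsto_zero_of_le_add (C := C) (fun n => rootMean_nonneg fun r => by positivity)
    (hφ (k * 2) (by omega)) fun ε hε => ⟨ε⁻¹, ?_⟩
  filter_upwards [hC] with n hn
  refine le_trans ?_ (add_le_add (mul_le_mul_of_nonneg_left hn hε.le) le_rfl)
  rw [← rootMean_mul μ X (fun _ => ε), ← rootMean_mul μ X (fun _ => ε⁻¹), ← h.rootMean_add]
  refine h.rootMean_mono fun r => ?_
  simp only [Pi.mul_apply, abs_mul, mul_pow, pow_mul]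
  set a := |φ n r| ^ k
  set b := |ψ n r| ^ k
  have e : ε * b ^ 2 + ε⁻¹ * a ^ 2 - 2 * (a * b) = ε * (b - ε⁻¹ * a) ^ 2 := by
    field_simp
    ring
  have h1 : 0 ≤ ε * (b - ε⁻¹ * a) ^ 2 := by positivity
  have h2 : 0 ≤ a * b := by positivity
  linarith

theorem LpNull.tendsto_rootMean (hφ : LpNull μ X φ) :
    Tendsto (rootMean μ X φ) atTop (𝓝 0) := by
  have h1 := hφ 1 one_ne_zero
  simp only [pow_one] at h1
  refine squeeze_zero_norm (fun n => ?_) h1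
  exact norm_integral_le_integral_norm _

/-- The difference of the two sequences tends to zero in all the spaces `L^k`. -/
def LpEquiv (μ : Measure Ω) (X : ℕ → Edge M → Ω → Fin A) (φ ψ : RootFun M A) : Prop :=
  LpNull μ X (φ - ψ)

theorem LpEquiv.refl (μ : Measure Ω) [IsProbabilityMeasure μ] (X : ℕ → Edge M → Ω → Fin A)
    (φ : RootFun M A) : LpEquiv μ X φ φ := by
  rw [LpEquiv, sub_self]
  exact lpNull_zero

theorem IsModel.lpEquiv_trans (h : IsModel p μ X) {χ : RootFun M A} (h1 : LpEquiv μ X φ ψ)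
    (h2 : LpEquiv μ X ψ χ) : LpEquiv μ X φ χ := by
  rw [LpEquiv, ← sub_add_sub_cancel φ ψ χ]
  exact h.lpNull_add h1 h2

theorem IsModel.lpBounded_of_lpEquiv (h : IsModel p μ X) (h1 : LpEquiv μ X φ ψ)
    (hψ : LpBounded μ X ψ) : LpBounded μ X φ := by
  rw [← sub_add_cancel φ ψ]
  exact h.lpBounded_add (LpNull.lpBounded h1) hψ

theorem IsModel.lpEquiv_add (h : IsModel p μ X) (h1 : LpEquiv μ X φ ψ)
    (h2 : LpEquiv μ X φ' ψ') : LpEquiv μ X (φ + φ') (ψ + ψ') := by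
  rw [LpEquiv, add_sub_add_comm]
  exact h.lpNull_add h1 h2

theorem IsModel.lpEquiv_mul (h : IsModel p μ X) (h1 : LpEquiv μ X φ ψ)
    (h2 : LpEquiv μ X φ' ψ') (hψ : LpBounded μ X ψ) (hψ' : LpBounded μ X ψ') :
    LpEquiv μ X (φ * φ') (ψ * ψ') := by
  have e : φ * φ' - ψ * ψ' = (φ - ψ) * φ' + (φ' - ψ') * ψ := by ring
  rw [LpEquiv, e]
  exact h.lpNull_add (h.lpNull_mul h1 (h.lpBounded_of_lpEquiv h2 hψ')) (h.lpNull_mul h2 hψ)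

theorem IsModel.lpBounded_pow (h : IsModel p μ X) (hφ : LpBounded μ X φ) (k : ℕ) :
    LpBounded μ X (φ ^ k) := by
  induction k with
  | zero => exact lpBounded_const μ X 1
  | succ k ih =>
    rw [pow_succ]
    exact h.lpBounded_mul ih hφ

theorem IsModel.lpEquiv_pow (h : IsModel p μ X) (h1 : LpEquiv μ X φ ψ) (hψ : LpBounded μ X ψ)
    (k : ℕ) : LpEquiv μ X (φ ^ k) (ψ ^ k) := by
  induction k with
  | zero => simpa using LpEquiv.refl μ X 1
  | succ k ih =>
    rw [pow_succ, pow_succ]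
    exact h.lpEquiv_mul ih h1 (h.lpBounded_pow hψ k) hψ

theorem IsModel.lpEquiv_sum (h : IsModel p μ X) {ι : Type*} {s : Finset ι} {φ ψ : ι → RootFun M A}
    (h1 : ∀ i ∈ s, LpEquiv μ X (φ i) (ψ i)) : LpEquiv μ X (∑ i ∈ s, φ i) (∑ i ∈ s, ψ i) := by
  classical
  induction s using Finset.induction_on with
  | empty => simpa using LpEquiv.refl μ X 0
  | insert i s hi ih =>
    rw [Finset.sum_insert hi, Finset.sum_insert hi]
    exact h.lpEquiv_add (h1 i (Finset.mem_insert_self _ _))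
      (ih fun j hj => h1 j (Finset.mem_insert_of_mem hj))

theorem IsModel.lpBounded_sum (h : IsModel p μ X) {ι : Type*} {s : Finset ι} {φ : ι → RootFun M A}
    (h1 : ∀ i ∈ s, LpBounded μ X (φ i)) : LpBounded μ X (∑ i ∈ s, φ i) := by
  classical
  induction s using Finset.induction_on with
  | empty => exact lpBounded_const μ X 0
  | insert i s hi ih =>
    rw [Finset.sum_insert hi]
    exact h.lpBounded_add (h1 i (Finset.mem_insert_self _ _))
      (ih fun j hj => h1 j (Finset.mem_insert_of_mem hj))

theorem IsModel.lpEquiv_const_mul (h : IsModel p μ X) (c : ℝ) (h1 : LpEquiv μ X φ ψ) :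
    LpEquiv μ X (fun n r => c * φ n r) (fun n r => c * ψ n r) := by
  have := h.lpNull_mul h1 (lpBounded_const μ X c)
  have e : (fun n r => c * φ n r) - (fun n r => c * ψ n r) = (φ - ψ) * fun _ _ => c := by
    funext n r
    simp only [Pi.sub_apply, Pi.mul_apply]
    ring
  rw [LpEquiv, e]
  exact this

theorem IsModel.lpBounded_const_mul (h : IsModel p μ X) (c : ℝ) (h1 : LpBounded μ X φ) :
    LpBounded μ X (fun n r => c * φ n r) :=
  h.lpBounded_mul (lpBounded_const μ X c) h1

theorem IsModel.tendsto_rootMean_sub (h : IsModel p μ X) (h1 : LpEquiv μ X φ ψ) :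
    Tendsto (fun n => rootMean μ X φ n - rootMean μ X ψ n) atTop (𝓝 0) := by
  refine (LpNull.tendsto_rootMean h1).congr fun n => ?_
  exact h.rootMean_sub φ ψ n

end RootFunctions

/-! ### Normalized sums over the root labels -/

section RootSums

theorem IsParam.sum_mul_rpow {M A : ℕ} {p : Fin A → ℝ} {ρ : ℝ} (hP : IsParam M p ρ) :
    ∑ j, p j * p j ^ (ρ - 1) = 1 / M := by
  have hM : (M : ℝ) ≠ 0 := by exact_mod_cast hP.pos_M.ne'
  rw [eq_div_iff hM, mul_comm]
  refine Eq.trans ?_ hP.root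
  congr 1
  refine Finset.sum_congr rfl fun j _ => ?_
  rw [mul_comm, ← Real.rpow_add_one (hP.pos j).1.ne', sub_add_cancel]

variable {M A : ℕ} {p : Fin A → ℝ} {Ω : Type*} [MeasurableSpace Ω] {μ : Measure Ω}
  [IsProbabilityMeasure μ] {X : ℕ → Edge M → Ω → Fin A}

/-- The sum of a function of the labels at the root over the labelings. -/
def rootSum (φ : (Fin M → Fin A) → ℝ) {n : ℕ} (r : Fin n → Fin M → Fin A) : ℝ := ∑ k, φ (r k)

theorem rootSum_succ (X : ℕ → Edge M → Ω → Fin A) (φ : (Fin M → Fin A) → ℝ) (n : ℕ) (ω : Ω) :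
    rootSum φ (rootLabels X (n + 1) ω) =
      φ (fun i => X n ([], i) ω) + rootSum φ (rootLabels X n ω) := by
  rw [rootSum, Fin.sum_univ_castSucc, add_comm]
  rfl

theorem IsModel.measurable_root (h : IsModel p μ X) (n : ℕ) :
    Measurable fun ω (i : Fin M) => X n ([], i) ω :=
  measurable_pi_iff.2 fun _ => h.meas _ _

theorem IsModel.iIndepFun_root_apply (h : IsModel p μ X) (n : ℕ) :
    iIndepFun (fun (i : Fin M) ω => X n ([], i) ω) μ :=
  h.indep.precomp (g := fun i : Fin M => (n, ([], i))) fun i j hij => by simpa using hij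

theorem IsModel.map_root (h : IsModel p μ X) (n : ℕ) :
    μ.map (fun ω (i : Fin M) => X n ([], i) ω) = μ.map (fun ω (i : Fin M) => X 0 ([], i) ω) := by
  rw [(iIndepFun_iff_map_fun_eq_pi_map fun i => (h.meas _ _).aemeasurable).1
    (h.iIndepFun_root_apply n),
    (iIndepFun_iff_map_fun_eq_pi_map fun i => (h.meas _ _).aemeasurable).1
    (h.iIndepFun_root_apply 0)]
  congr 1
  funext i
  exact h.map_eq _ _ _ _

theorem IsModel.integral_root (h : IsModel p μ X) (φ : (Fin M → Fin A) → ℝ) (n : ℕ) :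
    ∫ ω, φ (fun i => X n ([], i) ω) ∂μ = ∫ ω, φ (fun i => X 0 ([], i) ω) ∂μ := by
  rw [← integral_map (h.measurable_root n).aemeasurable
    (measurable_of_finite φ).aestronglyMeasurable, h.map_root,
    integral_map (h.measurable_root 0).aemeasurable (measurable_of_finite φ).aestronglyMeasurable]

theorem IsModel.integral_label (h : IsModel p μ X) (hp : ∀ j, 0 < p j ∧ p j < 1) (g : Fin A → ℝ)
    (k : ℕ) (e : Edge M) : ∫ ω, g (X k e ω) ∂μ = ∑ j, p j * g j := by
  rw [← integral_map (h.meas k e).aemeasurable (measurable_of_finite g).aestronglyMeasurable,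
    integral_fintype (Integrable.of_finite)]
  refine Finset.sum_congr rfl fun j _ => ?_
  rw [map_measureReal_apply (h.meas k e) (MeasurableSet.singleton j), smul_eq_mul]
  congr 1
  exact h.measureReal_eq hp k e j

theorem memLp_comp_of_finite {α : Type*} [Finite α] [MeasurableSpace α]
    [MeasurableSingletonClass α] {Y : Ω → α} (hY : Measurable Y) (g : α → ℝ) (q : ℝ≥0∞) :
    MemLp (fun ω => g (Y ω)) q μ := by
  obtain ⟨C, hC⟩ := (Set.finite_range fun a => ‖g a‖).bddAbove
  exact MemLp.of_bound ((measurable_of_finite g).comp hY).aestronglyMeasurable C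
    (ae_of_all _ fun ω => hC (Set.mem_range_self _))

theorem IsModel.integral_rootSum_pow_succ (h : IsModel p μ X) (φ : (Fin M → Fin A) → ℝ)
    (m n : ℕ) : ∫ ω, rootSum φ (rootLabels X (n + 1) ω) ^ m ∂μ = ∑ k ∈ Finset.range (m + 1),
      (m.choose k : ℝ) * (∫ ω, φ (fun i => X 0 ([], i) ω) ^ k ∂μ) *
        ∫ ω, rootSum φ (rootLabels X n ω) ^ (m - k) ∂μ := by
  simp_rw [rootSum_succ]
  rw [integral_add_pow (Y := fun ω => φ fun i => X n ([], i) ω)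
    (Z := fun ω => rootSum φ (rootLabels X n ω)) ((h.indepFun_root_rootLabels n).comp (φ := φ) (ψ := fun r => rootSum φ r)
    (measurable_of_finite _) (measurable_of_finite _))
    (fun k => memLp_comp_of_finite (h.measurable_root n) φ k)
    (fun k => memLp_comp_of_finite (h.measurable_rootLabels n) _ k)]
  refine Finset.sum_congr rfl fun k _ => ?_
  rw [← h.integral_root fun ℓ => φ ℓ ^ k]

/-- The sum of a function of the labels at the root, divided by the square root of the number of
labelings. -/
def scaledRootSum (φ : (Fin M → Fin A) → ℝ) : RootFun M A := fun n r => rootSum φ r / √n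

/-- The moments of a normalized sum of centered random variables. -/
theorem IsModel.tendsto_rootMean_scaledRootSum (h : IsModel p μ X) {φ : (Fin M → Fin A) → ℝ}
    (hφ : ∫ ω, φ (fun i => X 0 ([], i) ω) ∂μ = 0) (m : ℕ) :
    Tendsto (rootMean μ X (scaledRootSum φ ^ m)) atTop
      (𝓝 (gaussMoment m (∫ ω, φ (fun i => X 0 ([], i) ω) ^ 2 ∂μ))) := by
  set κ : ℕ → ℝ := fun k => ∫ ω, φ (fun i => X 0 ([], i) ω) ^ k ∂μ with hκ
  rcases Nat.eq_zero_or_pos m with rfl | hm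
  · have e : rootMean μ X (scaledRootSum φ ^ 0) = fun _ => 1 := by
      funext n
      rw [pow_zero]
      exact rootMean_const (fun _ => 1) n
    rw [e, gaussMoment_zero]
    exact tendsto_const_nhds
  obtain ⟨C, hC, hC'⟩ := exists_abs_sub_gaussMoment_le
    (D := fun m n => ∫ ω, rootSum φ (rootLabels X n ω) ^ m ∂μ) (κ := κ) (by simp [hκ])
    (by simpa [hκ] using hφ) (integral_nonneg fun ω => by positivity)
    (fun m => by simp [rootSum]) (fun m n => h.integral_rootSum_pow_succ φ m n) m
  rw [tendsto_iff_dist_tendsto_zero]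
  have hlim : Tendsto (fun n : ℕ => C * (√(n : ℝ))⁻¹) atTop (𝓝 0) := by
    have h1 := (tendsto_inv_atTop_zero.comp
      (Real.tendsto_sqrt_atTop.comp tendsto_natCast_atTop_atTop)).const_mul C
    rw [mul_zero] at h1
    exact h1
  refine squeeze_zero' (Eventually.of_forall fun n => dist_nonneg) ?_ hlim
  filter_upwards [eventually_ge_atTop 1] with n hn
  have hn0 : 0 < √(n : ℝ) := Real.sqrt_pos.2 (by exact_mod_cast hn)
  have h1 : rootMean μ X (scaledRootSum φ ^ m) n =
      (√(n : ℝ) ^ m)⁻¹ * ∫ ω, rootSum φ (rootLabels X n ω) ^ m ∂μ := by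
    rw [rootMean, ← integral_const_mul]
    refine integral_congr_ae (ae_of_all _ fun ω => ?_)
    simp only [scaledRootSum, Pi.pow_apply, div_pow]
    ring
  have h2 : gaussMoment m (n * κ 2) = √(n : ℝ) ^ m * gaussMoment m (κ 2) := by
    rw [← gaussMoment_sq_mul, Real.sq_sqrt (Nat.cast_nonneg n)]
  have h3 := hC' n
  rw [h2] at h3
  rw [Real.dist_eq, h1]
  have h4 : (√(n : ℝ) ^ m)⁻¹ * ∫ ω, rootSum φ (rootLabels X n ω) ^ m ∂μ - gaussMoment m (κ 2) =
      (√(n : ℝ) ^ m)⁻¹ * (∫ ω, rootSum φ (rootLabels X n ω) ^ m ∂μ -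
        √(n : ℝ) ^ m * gaussMoment m (κ 2)) := by
    field_simp
  rw [h4, abs_mul, abs_of_pos (by positivity)]
  refine (mul_le_mul_of_nonneg_left h3 (by positivity)).trans_eq ?_
  obtain ⟨l, rfl⟩ : ∃ l, m = l + 1 := ⟨m - 1, by omega⟩
  rw [Nat.add_sub_cancel, pow_succ]
  field_simp

/-- Absolute moments are dominated by even ones, `|z| ^ k ≤ 1 + z ^ (2 k)`, and the even moments
converge. -/
theorem IsModel.lpBounded_scaledRootSum (h : IsModel p μ X) {φ : (Fin M → Fin A) → ℝ}
    (hφ : ∫ ω, φ (fun i => X 0 ([], i) ω) ∂μ = 0) : LpBounded μ X (scaledRootSum φ) := by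
  intro k
  have h1 := h.tendsto_rootMean_scaledRootSum hφ (k * 2)
  refine ⟨1 + (gaussMoment (k * 2) (∫ ω, φ (fun i => X 0 ([], i) ω) ^ 2 ∂μ) + 1), ?_⟩
  filter_upwards [h1.eventually_le_const (lt_add_one _)] with n hn
  refine le_trans ?_ (add_le_add (rootMean_const (μ := μ) (X := X) (fun _ => 1) n).le hn)
  rw [← h.rootMean_add]
  refine h.rootMean_mono fun r => ?_
  simp only [Pi.pow_apply]
  rw [pow_mul, ← sq_abs (scaledRootSum φ n r ^ k), abs_pow]
  nlinarith [sq_nonneg (|scaledRootSum φ n r| ^ k - 1)]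

/-- The centered indicator that the letter `a.2` is on the edge from the root to its child `a.1`. -/
def letterDev (p : Fin A → ℝ) (a : Fin M × Fin A) (ℓ : Fin M → Fin A) : ℝ :=
  (if ℓ a.1 = a.2 then 1 else 0) - p a.2

theorem rootSum_letterDev (p : Fin A → ℝ) (a : Fin M × Fin A) {n : ℕ}
    (r : Fin n → Fin M → Fin A) : rootSum (letterDev p a) r = rootCount r a - n * p a.2 := by
  simp only [rootSum, letterDev, Finset.sum_sub_distrib, Finset.sum_const, Finset.card_univ,
    Fintype.card_fin, nsmul_eq_mul]
  rw [Finset.sum_boole, rootCount, fiber]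

theorem IsModel.integral_letterDev (h : IsModel p μ X) (hp : ∀ j, 0 < p j ∧ p j < 1)
    (a : Fin M × Fin A) : ∫ ω, letterDev p a (fun i => X 0 ([], i) ω) ∂μ = 0 := by
  simp only [letterDev]
  rw [integral_sub ((memLp_comp_of_finite (h.meas 0 ([], a.1))
    (fun j => if j = a.2 then (1 : ℝ) else 0) 1).integrable le_rfl) (integrable_const _),
    h.integral_indicator hp]
  simp

/-- The linearized toll. -/
def linearToll (p : Fin A → ℝ) (ρ : ℝ) (ℓ : Fin M → Fin A) : ℝ := ∑ i, p (ℓ i) ^ (ρ - 1) - 1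

/-- The weights `p a.2 ^ (ρ - 1)` are the asymptotic ratios of the increments of the mean at `n * p
a.2` and at `n`. The centering terms add up to the `-1` in `linearToll`, by the defining equation of
`ρ`. -/
theorem rootSum_linearToll {ρ : ℝ} (hP : IsParam M p ρ) {n : ℕ} (r : Fin n → Fin M → Fin A) :
    rootSum (linearToll p ρ) r =
      ∑ a : Fin M × Fin A, p a.2 ^ (ρ - 1) * rootSum (letterDev p a) r := by
  have h1 : ∀ ℓ : Fin M → Fin A, linearToll p ρ ℓ =
      ∑ a : Fin M × Fin A, p a.2 ^ (ρ - 1) * letterDev p a ℓ := by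
    intro ℓ
    simp only [letterDev, mul_sub, Finset.sum_sub_distrib, linearToll]
    congr 1
    · rw [Fintype.sum_prod_type]
      refine Finset.sum_congr rfl fun i _ => ?_
      simp
    · rw [sum_prod_snd fun j => p j ^ (ρ - 1) * p j]
      have hM : (M : ℝ) ≠ 0 := by exact_mod_cast hP.pos_M.ne'
      have := hP.sum_mul_rpow
      simp only [mul_comm (p _)] at this
      rw [this]
      field_simp
  simp only [rootSum, h1]
  rw [Finset.sum_comm]
  simp only [Finset.mul_sum]

theorem IsModel.integral_linearToll (h : IsModel p μ X) {ρ : ℝ} (hP : IsParam M p ρ) :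
    ∫ ω, linearToll p ρ (fun i => X 0 ([], i) ω) ∂μ = 0 := by
  have hint : ∀ i : Fin M, Integrable (fun ω => p (X 0 ([], i) ω) ^ (ρ - 1)) μ := fun i =>
    (memLp_comp_of_finite (h.meas 0 ([], i)) (fun j => p j ^ (ρ - 1)) 1).integrable le_rfl
  simp only [linearToll]
  rw [integral_sub (integrable_finsetSum _ fun i _ => hint i) (integrable_const _),
    integral_finsetSum _ fun i _ => hint i]
  simp only [h.integral_label hP.pos fun j => p j ^ (ρ - 1)]
  simp only [Finset.sum_const, Finset.card_univ, Fintype.card_fin, nsmul_eq_mul,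
    integral_const, probReal_univ, smul_eq_mul, mul_one]
  have hM : (M : ℝ) ≠ 0 := by exact_mod_cast hP.pos_M.ne'
  rw [hP.sum_mul_rpow]
  field_simp
  simp

/-- The `M` labels of one labeling at the root are independent, so their variances add. -/
theorem IsModel.integral_linearToll_sq (h : IsModel p μ X) {ρ : ℝ} (hP : IsParam M p ρ) :
    ∫ ω, linearToll p ρ (fun i => X 0 ([], i) ω) ^ 2 ∂μ =
      M * ∑ j, p j ^ (2 * ρ - 1) - 1 / M := by
  have hL : ∀ i : Fin M, MemLp (fun ω => p (X 0 ([], i) ω) ^ (ρ - 1)) 2 μ := fun i =>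
    memLp_comp_of_finite (h.meas 0 ([], i)) (fun j => p j ^ (ρ - 1)) 2
  have hM : (M : ℝ) ≠ 0 := by exact_mod_cast hP.pos_M.ne'
  have hmean : ∀ i : Fin M, ∫ ω, p (X 0 ([], i) ω) ^ (ρ - 1) ∂μ = 1 / M := by
    intro i
    rw [h.integral_label hP.pos fun j => p j ^ (ρ - 1), hP.sum_mul_rpow]
  have hvar : ∀ i : Fin M, Var[fun ω => p (X 0 ([], i) ω) ^ (ρ - 1); μ] =
      ∑ j, p j ^ (2 * ρ - 1) - (1 / M) ^ 2 := by
    intro i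
    rw [variance_eq_sub (hL i), hmean i]
    congr 1
    simp only [Pi.pow_apply]
    rw [h.integral_label hP.pos fun j => (p j ^ (ρ - 1)) ^ 2]
    refine Finset.sum_congr rfl fun j _ => ?_
    rw [← Real.rpow_natCast, ← Real.rpow_mul (hP.pos j).1.le, mul_comm,
      ← Real.rpow_add_one (hP.pos j).1.ne']
    congr 1
    push_cast
    ring
  have hsum : Var[∑ i : Fin M, fun ω => p (X 0 ([], i) ω) ^ (ρ - 1); μ] =
      M * ∑ j, p j ^ (2 * ρ - 1) - 1 / M := by
    rw [IndepFun.variance_sum (fun i _ => hL i) fun i _ j _ hij =>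
      ((h.iIndepFun_root_apply 0).indepFun hij).comp (φ := fun j => p j ^ (ρ - 1))
        (ψ := fun j => p j ^ (ρ - 1)) (measurable_of_finite _) (measurable_of_finite _)]
    simp only [hvar, Finset.sum_const, Finset.card_univ, Fintype.card_fin, nsmul_eq_mul]
    field_simp
  have h0 := h.integral_linearToll hP
  rw [← hsum, variance_eq_integral (by
    refine (Finset.aestronglyMeasurable_sum _ fun i _ => (hL i).1).aemeasurable)]
  have h1 : μ[∑ i : Fin M, fun ω => p (X 0 ([], i) ω) ^ (ρ - 1)] = 1 := by
    simp only [Finset.sum_apply]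
    rw [integral_finsetSum _ fun i _ => (hL i).integrable one_le_two]
    simp only [hmean, Finset.sum_const, Finset.card_univ, Fintype.card_fin, nsmul_eq_mul]
    field_simp
  rw [h1]
  simp [linearToll]

end RootSums

/-! ### Size and slow variation of the increments of the mean -/

section Increments

variable {M A : ℕ} {p : Fin A → ℝ} {ρ : ℝ} {Ω : Type*} [MeasurableSpace Ω] {μ : Measure Ω}
  [IsProbabilityMeasure μ] {X : ℕ → Edge M → Ω → Fin A}

/-- The increments of the expected size. -/
def meanIncr (μ : Measure Ω) (X : ℕ → Edge M → Ω → Fin A) (n : ℕ) : ℝ :=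
  meanSize μ X (n + 1) - meanSize μ X n

/-- The increments of the expected size, divided by their order of magnitude. -/
def scaledIncr (μ : Measure Ω) (X : ℕ → Edge M → Ω → Fin A) (ρ : ℝ) (n : ℕ) : ℝ :=
  (n : ℝ) ^ (1 - ρ) * meanIncr μ X n

/-- The assumptions on the random labelings. -/
structure IsTrie (p : Fin A → ℝ) (ρ : ℝ) (μ : Measure Ω) (X : ℕ → Edge M → Ω → Fin A) :
    Prop where
  model : IsModel p μ X
  param : IsParam M p ρ
  nonexplosive : (M : ℝ) * ∑ j, p j ^ 2 < 1

theorem meanIncr_zero : meanIncr μ X 0 = 0 := by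
  simp [meanIncr, meanSize_of_lt_two]

theorem meanIncr_eq (μ : Measure Ω) [IsProbabilityMeasure μ] (X : ℕ → Edge M → Ω → Fin A) (ρ : ℝ)
    (n : ℕ) :
    meanIncr μ X n = (n : ℝ) ^ (ρ - 1) * scaledIncr μ X ρ n := by
  rcases Nat.eq_zero_or_pos n with rfl | hn
  · simp [scaledIncr, meanIncr_zero]
  · have hn0 : (0 : ℝ) < n := by exact_mod_cast hn
    rw [scaledIncr, ← mul_assoc, ← Real.rpow_add hn0]
    simp

theorem IsTrie.scaledIncr_sub_le (h : IsTrie p ρ μ X) : ∃ C : ℝ, 0 < C ∧ ∀ n : ℕ, 1 ≤ n →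
    |scaledIncr μ X ρ n - renewal M p ρ n| ≤ C / n := by
  obtain ⟨C, hC0, hC⟩ := h.param.tsum_sub_renewal_le
  refine ⟨C, hC0, fun n hn => ?_⟩
  rw [scaledIncr, meanIncr, h.model.meanSize_succ_sub h.param.pos h.nonexplosive]
  exact hC n hn

theorem IsTrie.tendsto_scaledIncr_sub (h : IsTrie p ρ μ X) :
    Tendsto (fun n => scaledIncr μ X ρ n - renewal M p ρ n) atTop (𝓝 0) := by
  obtain ⟨C, hC0, hC⟩ := h.scaledIncr_sub_le
  refine squeeze_zero_norm' ?_ (tendsto_const_div_atTop_nhds_zero_nat C)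
  filter_upwards [eventually_ge_atTop 1] with n hn using hC n hn

theorem IsTrie.abs_scaledIncr_le (h : IsTrie p ρ μ X) : ∃ C : ℝ, 0 < C ∧ ∀ n : ℕ,
    |scaledIncr μ X ρ n| ≤ C := by
  obtain ⟨C, hC0, hC⟩ := h.scaledIncr_sub_le
  obtain ⟨C', hC0', hC'⟩ := h.param.renewal_le
  refine ⟨C + C', by positivity, fun n => ?_⟩
  rcases Nat.eq_zero_or_pos n with rfl | hn
  · simp only [scaledIncr, meanIncr_zero, mul_zero, abs_zero]
    positivity
  · have hn0 : (0 : ℝ) < n := by exact_mod_cast hn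
    have h1 := hC n hn
    have h2 : C / n ≤ C := div_le_self hC0.le (by exact_mod_cast hn)
    have h3 := (hC' n hn0).1
    have h4 : 0 ≤ renewal M p ρ n := renewal_nonneg hn0
    rw [abs_le] at h1 ⊢
    constructor <;> linarith [h1.1, h1.2]

theorem IsTrie.le_scaledIncr (h : IsTrie p ρ μ X) :
    ∃ c : ℝ, 0 < c ∧ ∀ᶠ n in atTop, c ≤ scaledIncr μ X ρ n := by
  obtain ⟨c, hc0, hc⟩ := h.param.le_renewal
  refine ⟨c / 2, by positivity, ?_⟩
  filter_upwards [h.tendsto_scaledIncr_sub.eventually_const_lt (show -(c / 2) < 0 by linarith),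
    eventually_ge_atTop 1] with n hn hn1
  have := hc n (by exact_mod_cast hn1)
  linarith

theorem IsTrie.abs_meanIncr_le (h : IsTrie p ρ μ X) : ∃ C : ℝ, 0 < C ∧ ∀ n N : ℕ, N ≤ n →
    |meanIncr μ X N| ≤ C * (n : ℝ) ^ (ρ - 1) := by
  obtain ⟨C, hC0, hC⟩ := h.abs_scaledIncr_le
  refine ⟨C, hC0, fun n N hN => ?_⟩
  rw [meanIncr_eq μ X ρ, abs_mul, abs_of_nonneg (by positivity), mul_comm C]
  exact mul_le_mul (Real.rpow_le_rpow (by positivity) (by exact_mod_cast hN)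
    (by linarith [h.param.one_lt])) (hC N) (abs_nonneg _) (by positivity)

theorem IsParam.abs_renewal_sub_le (h : IsParam M p ρ) : ∃ C : ℝ, 0 < C ∧ ∀ x y z, 0 < z →
    z ≤ x → z ≤ y → |renewal M p ρ x - renewal M p ρ y| ≤ C * (|x - y| / z) := by
  obtain ⟨C, hC0, hC⟩ := h.renewal_lipschitz
  have key : ∀ x y z, 0 < z → z ≤ x → z ≤ y → y ≤ x →
      |renewal M p ρ x - renewal M p ρ y| ≤ C * (|x - y| / z) := by
    intro x y z hz hx hy hxy
    have hy0 : 0 < y := hz.trans_le hy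
    have h1 := hC y (x / y) hy0 ((one_le_div hy0).2 hxy)
    rw [div_mul_cancel₀ _ hy0.ne'] at h1
    refine h1.trans (mul_le_mul_of_nonneg_left ?_ hC0.le)
    have e : x / y - 1 = (x - y) / y := by field_simp
    rw [e, abs_of_nonneg (by linarith)]
    exact div_le_div_of_nonneg_left (by linarith) hz hy
  refine ⟨C, hC0, fun x y z hz hx hy => ?_⟩
  rcases le_total y x with hxy | hxy
  · exact key x y z hz hx hy hxy
  · rw [abs_sub_comm, abs_sub_comm x]
    exact key y x z hz hy hx hxy

/-- The increments of the expected size vary slowly, also between `n` and `n * p j`. -/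
theorem IsTrie.meanIncr_regular (h : IsTrie p ρ μ X) (j : Fin A) {ε : ℝ} (hε : 0 < ε) :
    ∃ δ > 0, ∀ᶠ n : ℕ in atTop, ∀ N : ℕ, |(N : ℝ) - n * p j| ≤ δ * n →
      |meanIncr μ X N - p j ^ (ρ - 1) * scaledIncr μ X ρ n * (n : ℝ) ^ (ρ - 1)| ≤
        ε * (n : ℝ) ^ (ρ - 1) := by
  obtain ⟨C, hC0, hC⟩ := h.abs_scaledIncr_le
  obtain ⟨L, hL0, hL⟩ := h.param.abs_renewal_sub_le
  have hp0 := (h.param.pos j).1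
  -- `C * ε'` pays for the error of the power of `N / n`. The other `4 * ε'` pay for the chain from
  -- `scaledIncr` at `N` through `renewal` at `N`, `n * p j` and `n` to `scaledIncr` at `n`.
  set ε' := ε / (C + 4) with hε'
  have hε0 : 0 < ε' := by positivity
  have hεe : ε' * (C + 4) = ε := by rw [hε']; field_simp
  have hcont : ContinuousAt (fun x : ℝ => x ^ (ρ - 1)) (p j) :=
    Real.continuousAt_rpow_const _ _ (Or.inl hp0.ne')
  obtain ⟨δ₁, hδ₁, hδ₁'⟩ := Metric.continuousAt_iff.1 hcont ε' hε0
  -- The three conditions keep `N` above `n * (p j / 2)`, control the power of `N / n` by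
  -- continuity, and control the renewal solution by its Lipschitz bound.
  obtain ⟨δ, hδ, hδp, hδ1, hδL⟩ : ∃ δ > 0, δ ≤ p j / 2 ∧ δ < δ₁ ∧ L * (δ / (p j / 2)) ≤ ε' := by
    refine ⟨min (p j / 2) (min (δ₁ / 2) (ε' * (p j / 2) / L)), by positivity, min_le_left _ _,
      ?_, ?_⟩
    · exact ((min_le_right _ _).trans (min_le_left _ _)).trans_lt (by linarith)
    · have : min (p j / 2) (min (δ₁ / 2) (ε' * (p j / 2) / L)) ≤ ε' * (p j / 2) / L :=
        (min_le_right _ _).trans (min_le_right _ _)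
      rw [mul_div_assoc', div_le_iff₀ (by positivity)]
      rw [le_div_iff₀ hL0] at this
      linarith
  refine ⟨δ, hδ, ?_⟩
  have e1 := h.tendsto_scaledIncr_sub
  have e2 := (h.param.tendsto_renewal_sub j).comp tendsto_natCast_atTop_atTop (α := ℕ)
  rw [Metric.tendsto_atTop] at e1
  obtain ⟨N₀, hN₀⟩ := e1 ε' hε0
  have e3 : Tendsto (fun n : ℕ => (n : ℝ) * (p j / 2)) atTop atTop :=
    tendsto_natCast_atTop_atTop.atTop_mul_const (by positivity)
  filter_upwards [Metric.tendsto_nhds.1 e2 ε' hε0, e3.eventually_ge_atTop (N₀ : ℝ),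
    eventually_ge_atTop N₀, eventually_ge_atTop 1] with n h2 h3 h4 h5 N hN
  have hn0 : (0 : ℝ) < n := by exact_mod_cast h5
  rw [abs_le] at hN
  have hNlow : n * (p j / 2) ≤ (N : ℝ) := by nlinarith [hN.1]
  have hNN₀ : N₀ ≤ N := by exact_mod_cast h3.trans hNlow
  have b1 := hN₀ N hNN₀
  have b2 := hN₀ n h4
  rw [Real.dist_eq, sub_zero] at b1 b2
  simp only [Function.comp_apply, Real.dist_eq, sub_zero] at h2
  have b3 := hL N (n * p j) (n * (p j / 2)) (by positivity) hNlow (by nlinarith)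
  have b4 : |(N : ℝ) - n * p j| / (n * (p j / 2)) ≤ δ / (p j / 2) := by
    rw [div_le_div_iff₀ (by positivity) (by positivity)]
    have : |(N : ℝ) - n * p j| ≤ δ * n := abs_le.2 hN
    nlinarith
  have b5 := b3.trans ((mul_le_mul_of_nonneg_left b4 hL0.le).trans hδL)
  have hu : |scaledIncr μ X ρ N - scaledIncr μ X ρ n| ≤ 4 * ε' := by
    rw [abs_le] at b5 ⊢
    rw [abs_lt] at b1 b2 h2
    constructor <;> linarith [b1.1, b1.2, b2.1, b2.2, b5.1, b5.2, h2.1, h2.2]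
  have hpow : |((N : ℝ) / n) ^ (ρ - 1) - p j ^ (ρ - 1)| ≤ ε' := by
    refine (hδ₁' (x := (N : ℝ) / n) ?_).le
    rw [Real.dist_eq]
    have e : (N : ℝ) / n - p j = (N - n * p j) / n := by field_simp
    rw [e, abs_div, abs_of_pos hn0, div_lt_iff₀ hn0]
    exact (abs_le.2 hN).trans_lt (mul_lt_mul_of_pos_right hδ1 hn0)
  have e : meanIncr μ X N = ((N : ℝ) / n) ^ (ρ - 1) * scaledIncr μ X ρ N * (n : ℝ) ^ (ρ - 1) := by
    rw [meanIncr_eq μ X ρ, Real.div_rpow (Nat.cast_nonneg _) hn0.le]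
    field_simp
  have hpj : p j ^ (ρ - 1) ≤ 1 := Real.rpow_le_one hp0.le (h.param.pos j).2.le
    (by linarith [h.param.one_lt])
  have hpj0 : 0 < p j ^ (ρ - 1) := Real.rpow_pos_of_pos hp0 _
  rw [e, ← sub_mul, abs_mul, abs_of_pos (Real.rpow_pos_of_pos hn0 _)]
  refine mul_le_mul_of_nonneg_right ?_ (by positivity)
  have e' : ((N : ℝ) / n) ^ (ρ - 1) * scaledIncr μ X ρ N - p j ^ (ρ - 1) * scaledIncr μ X ρ n =
      (((N : ℝ) / n) ^ (ρ - 1) - p j ^ (ρ - 1)) * scaledIncr μ X ρ N +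
      p j ^ (ρ - 1) * (scaledIncr μ X ρ N - scaledIncr μ X ρ n) := by ring
  rw [e', ← hεe]
  refine (abs_add_le _ _).trans ?_
  rw [abs_mul, abs_mul, abs_of_pos hpj0]
  have c1 := mul_le_mul hpow (hC N) (abs_nonneg _) hε0.le
  have c2 := mul_le_mul hpj hu (abs_nonneg _) zero_le_one
  linarith

/-- A discrete mean value inequality, for both orders of `N` and `m`. -/
theorem abs_sub_sub_le_of_incr {f : ℕ → ℝ} {s B : ℝ} {N m : ℕ}
    (hB : ∀ k, min N m ≤ k → k < max N m → |f (k + 1) - f k - s| ≤ B) :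
    |f N - f m - s * ((N : ℝ) - m)| ≤ B * |(N : ℝ) - m| := by
  have key : ∀ d m : ℕ, (∀ k, m ≤ k → k < m + d → |f (k + 1) - f k - s| ≤ B) →
      |f (m + d) - f m - s * d| ≤ B * d := by
    intro d m hk
    induction d with
    | zero => simp
    | succ d ih =>
      have h1 := ih fun k h1 h2 => hk k h1 (by omega)
      have h2 := hk (m + d) (by omega) (by omega)
      have e : f (m + (d + 1)) - f m - s * ((d + 1 : ℕ) : ℝ) =
          (f (m + d) - f m - s * d) + (f (m + d + 1) - f (m + d) - s) := by
        push_cast [← add_assoc]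
        ring
      rw [e]
      refine (abs_add_le _ _).trans ?_
      push_cast
      linarith
  rcases le_total m N with hmN | hmN
  · obtain ⟨d, rfl⟩ := Nat.exists_eq_add_of_le hmN
    have h1 := key d m fun k h1 h2 => hB k ((min_le_right _ _).trans h1) (h2.trans_le (le_max_left _ _))
    have e : ((m + d : ℕ) : ℝ) - m = d := by push_cast; ring
    rw [e, Nat.abs_cast]
    exact h1
  · obtain ⟨d, rfl⟩ := Nat.exists_eq_add_of_le hmN
    have h1 := key d N fun k h1 h2 => hB k ((min_le_left _ _).trans h1) (h2.trans_le (le_max_right _ _))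
    have e : (N : ℝ) - ((N + d : ℕ) : ℝ) = -d := by push_cast; ring
    rw [e, abs_neg, Nat.abs_cast, ← abs_neg]
    convert h1 using 2
    ring

end Increments

/-! ### Linearization of the toll -/

section RootLimits

variable {M A : ℕ} {p : Fin A → ℝ} {ρ : ℝ} {Ω : Type*} [MeasurableSpace Ω] {μ : Measure Ω}
  [IsProbabilityMeasure μ] {X : ℕ → Edge M → Ω → Fin A}

theorem tendsto_inv_sqrt_natCast : Tendsto (fun n : ℕ => (√(n : ℝ))⁻¹) atTop (𝓝 0) :=
  tendsto_inv_atTop_zero.comp (Real.tendsto_sqrt_atTop.comp tendsto_natCast_atTop_atTop)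

/-- The normalized deviation of the number of labelings in a subtrie from its mean. -/
def countDev (p : Fin A → ℝ) (a : Fin M × Fin A) : RootFun M A := scaledRootSum (letterDev p a)

theorem countDev_eq (p : Fin A → ℝ) (a : Fin M × Fin A) {n : ℕ} (r : Fin n → Fin M → Fin A) :
    countDev p a n r = (rootCount r a - n * p a.2) / √n := by
  rw [countDev, scaledRootSum, rootSum_letterDev]

theorem IsTrie.lpBounded_countDev (h : IsTrie p ρ μ X) (a : Fin M × Fin A) :
    LpBounded μ X (countDev p a) :=
  h.model.lpBounded_scaledRootSum (h.model.integral_letterDev h.param.pos a)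

theorem IsModel.lpNull_div_sqrt (h : IsModel p μ X) {φ : RootFun M A} (hφ : LpBounded μ X φ) :
    LpNull μ X fun n r => φ n r / √n := by
  have := h.lpNull_mul (h.lpNull_of_tendsto tendsto_inv_sqrt_natCast) hφ
  have e : (fun n (r : Fin n → Fin M → Fin A) => φ n r / √n) =
      (fun (n : ℕ) _ => (√(n : ℝ))⁻¹) * φ := by
    funext n r
    simp only [Pi.mul_apply]
    ring
  rw [e]
  exact this

theorem abs_countDev_div (p : Fin A → ℝ) (a : Fin M × Fin A) {n : ℕ} (hn : 1 ≤ n)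
    (r : Fin n → Fin M → Fin A) :
    countDev p a n r / √n = rootCount r a / n - p a.2 := by
  have hn0 : (0 : ℝ) < n := by exact_mod_cast hn
  rw [countDev_eq, div_div, Real.mul_self_sqrt hn0.le]
  field_simp

/-- The proportion of the labelings in a subtrie. -/
def countRatio (a : Fin M × Fin A) : RootFun M A := fun n r => rootCount r a / n

theorem countRatio_mem (a : Fin M × Fin A) {n : ℕ} (r : Fin n → Fin M → Fin A) :
    0 ≤ countRatio a n r ∧ countRatio a n r ≤ 1 := by
  refine ⟨by unfold countRatio; positivity, div_le_one_of_le₀ ?_ (Nat.cast_nonneg n)⟩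
  exact_mod_cast rootCount_le r a

theorem IsTrie.lpEquiv_countRatio (h : IsTrie p ρ μ X) (a : Fin M × Fin A) :
    LpEquiv μ X (countRatio a) fun _ _ => p a.2 := by
  refine h.model.lpNull_of_le (ψ := fun _ _ => 0) (lpBounded_const μ X 0)
    (h.model.lpNull_div_sqrt (h.lpBounded_countDev a)) fun ε hε => ⟨1, ?_⟩
  filter_upwards [eventually_ge_atTop 1] with n hn r
  rw [abs_countDev_div p a hn]
  simp [countRatio]

theorem abs_rpow_sub_rpow_le {x y θ : ℝ} (hx : 0 ≤ x) (hx1 : x ≤ 1) (hy : 0 ≤ y) (hy1 : y ≤ 1)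
    (hθ : 1 ≤ θ) : |x ^ θ - y ^ θ| ≤ θ * |x - y| := by
  have := (convex_Icc (0 : ℝ) 1).norm_image_sub_le_of_norm_hasDerivWithin_le
    (f := fun x => x ^ θ) (f' := fun x => θ * x ^ (θ - 1)) (C := θ)
    (fun z _ => (Real.hasDerivAt_rpow_const (Or.inr hθ)).hasDerivWithinAt) (fun z hz => ?_)
    (show y ∈ Set.Icc (0 : ℝ) 1 from ⟨hy, hy1⟩) (show x ∈ Set.Icc (0 : ℝ) 1 from ⟨hx, hx1⟩)
  · exact this
  · rw [Real.norm_eq_abs, abs_of_nonneg (mul_nonneg (by linarith) (Real.rpow_nonneg hz.1 _))]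
    have := Real.rpow_le_one hz.1 hz.2 (show 0 ≤ θ - 1 by linarith)
    nlinarith

theorem IsTrie.lpEquiv_countRatio_rpow (h : IsTrie p ρ μ X) (a : Fin M × Fin A) {θ : ℝ}
    (hθ : 1 ≤ θ) :
    LpEquiv μ X (fun n r => countRatio a n r ^ θ) fun _ _ => p a.2 ^ θ := by
  refine h.model.lpNull_of_le (ψ := fun _ _ => 0) (lpBounded_const μ X 0)
    (h.lpEquiv_countRatio a) fun ε hε => ⟨θ, Eventually.of_forall fun n r => ?_⟩
  have h1 := countRatio_mem a r
  have h2 := h.param.pos a.2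
  have := abs_rpow_sub_rpow_le h1.1 h1.2 h2.1.le h2.2.le hθ
  simpa using this

theorem IsTrie.lpEquiv_meanIncr (h : IsTrie p ρ μ X) (a : Fin M × Fin A) :
    LpEquiv μ X (fun n r => meanIncr μ X (rootCount r a) / (n : ℝ) ^ (ρ - 1))
      fun n _ => p a.2 ^ (ρ - 1) * scaledIncr μ X ρ n := by
  obtain ⟨C, hC0, hC⟩ := h.abs_meanIncr_le
  obtain ⟨C', hC0', hC'⟩ := h.abs_scaledIncr_le
  refine h.model.lpNull_of_le (ψ := fun _ _ => 1) (lpBounded_const μ X 1)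
    (h.model.lpNull_div_sqrt (h.lpBounded_countDev a)) fun ε hε => ?_
  obtain ⟨δ, hδ, hreg⟩ := h.meanIncr_regular a.2 hε
  refine ⟨(C + C') / δ, ?_⟩
  filter_upwards [hreg, eventually_ge_atTop 1] with n hn hn1 r
  have hn0 : (0 : ℝ) < n := by exact_mod_cast hn1
  have hs : (0 : ℝ) < (n : ℝ) ^ (ρ - 1) := Real.rpow_pos_of_pos hn0 _
  simp only [Pi.sub_apply]
  have e : ∀ N : ℕ, meanIncr μ X N / (n : ℝ) ^ (ρ - 1) - p a.2 ^ (ρ - 1) * scaledIncr μ X ρ n =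
      (meanIncr μ X N - p a.2 ^ (ρ - 1) * scaledIncr μ X ρ n * (n : ℝ) ^ (ρ - 1)) /
        (n : ℝ) ^ (ρ - 1) := by
    intro N
    field_simp
  rw [abs_countDev_div p a hn1]
  -- Close to the mean count the increments are regular. Far from it the null variable exceeds `δ`,
  -- so the trivial bound `C + C'` is at most `(C + C') / δ` times that variable.
  rcases le_or_gt |(rootCount r a : ℝ) - n * p a.2| (δ * n) with hN | hN
  · have h1 := hn _ hN
    rw [e, abs_div, abs_of_pos hs, abs_one, mul_one]
    have h2 : |meanIncr μ X (rootCount r a) -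
        p a.2 ^ (ρ - 1) * scaledIncr μ X ρ n * (n : ℝ) ^ (ρ - 1)| / (n : ℝ) ^ (ρ - 1) ≤ ε :=
      (div_le_iff₀ hs).2 h1
    have h3 : 0 ≤ (C + C') / δ * |(rootCount r a : ℝ) / n - p a.2| := by positivity
    linarith
  · have h1 : δ < |(rootCount r a : ℝ) / n - p a.2| := by
      have e : (rootCount r a : ℝ) / n - p a.2 = (rootCount r a - n * p a.2) / n := by field_simp
      rw [e, abs_div, abs_of_pos hn0, lt_div_iff₀ hn0]
      exact hN
    have h2 : |meanIncr μ X (rootCount r a) / (n : ℝ) ^ (ρ - 1)| ≤ C := by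
      rw [abs_div, abs_of_pos hs, div_le_iff₀ hs]
      exact hC n _ (rootCount_le r a)
    have h3 : |p a.2 ^ (ρ - 1) * scaledIncr μ X ρ n| ≤ C' := by
      rw [abs_mul, abs_of_nonneg (Real.rpow_nonneg (h.param.pos a.2).1.le _)]
      have h4 := Real.rpow_le_one (h.param.pos a.2).1.le (h.param.pos a.2).2.le
        (show 0 ≤ ρ - 1 by linarith [h.param.one_lt])
      have h5 := mul_le_mul h4 (hC' n) (abs_nonneg _) zero_le_one
      linarith
    have h4 : C + C' ≤ (C + C') / δ * |(rootCount r a : ℝ) / n - p a.2| := by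
      rw [div_mul_eq_mul_div, le_div_iff₀ hδ]
      exact mul_le_mul_of_nonneg_left h1.le (by positivity)
    have h5 := abs_sub (meanIncr μ X (rootCount r a) / (n : ℝ) ^ (ρ - 1))
      (p a.2 ^ (ρ - 1) * scaledIncr μ X ρ n)
    have h6 : 0 ≤ ε * |(1 : ℝ)| := by positivity
    linarith

theorem IsTrie.lpBounded_scaledIncr (h : IsTrie p ρ μ X) :
    LpBounded μ X fun n _ => scaledIncr μ X ρ n := by
  obtain ⟨C, hC0, hC⟩ := h.abs_scaledIncr_le
  exact h.model.lpBounded_of_abs_le (C := C) (Eventually.of_forall fun n _ => hC n)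

/-- The order of magnitude of the standard deviation of the size. -/
def devScale (ρ : ℝ) (n : ℕ) : ℝ := (n : ℝ) ^ (ρ - 1) * √n

theorem devScale_pos (ρ : ℝ) {n : ℕ} (hn : 1 ≤ n) : 0 < devScale ρ n := by
  have hn0 : (0 : ℝ) < n := by exact_mod_cast hn
  unfold devScale
  positivity

/-- A first-order expansion of the mean around `n * p a.2`. The floor provides a deterministic
integer as base point; its rounding error is of order `1 / √n` after normalization. -/
theorem IsTrie.lpEquiv_meanSize (h : IsTrie p ρ μ X) (a : Fin M × Fin A) :
    LpEquiv μ X (fun n r => (meanSize μ X (rootCount r a) - meanSize μ X ⌊n * p a.2⌋₊) /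
        devScale ρ n)
      fun n r => p a.2 ^ (ρ - 1) * scaledIncr μ X ρ n * countDev p a n r := by
  obtain ⟨C, hC0, hC⟩ := h.abs_meanIncr_le
  obtain ⟨C', hC0', hC'⟩ := h.abs_scaledIncr_le
  have hcd := h.lpBounded_countDev a
  have hp0 := h.param.pos a.2
  have hb1 : LpBounded μ X fun n r => |countDev p a n r| + 1 :=
    h.model.lpBounded_add (h.model.lpBounded_of_le hcd
      (φ := fun n r => |countDev p a n r|) (Eventually.of_forall fun n r => by simp))
      (lpBounded_const μ X 1)
  have hb2 : LpBounded μ X fun n r => countDev p a n r ^ 2 + 1 :=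
    h.model.lpBounded_add (h.model.lpBounded_pow hcd 2) (lpBounded_const μ X 1)
  refine h.model.lpNull_of_le hb1 (h.model.lpNull_div_sqrt hb2) fun ε hε => ?_
  obtain ⟨δ, hδ, hreg⟩ := h.meanIncr_regular a.2 hε
  refine ⟨C' + 2 * (C + C') / δ, ?_⟩
  have hlarge : Tendsto (fun n : ℕ => δ * n) atTop atTop :=
    tendsto_natCast_atTop_atTop.const_mul_atTop hδ
  filter_upwards [hreg, eventually_ge_atTop 1, hlarge.eventually_ge_atTop 1] with n hn hn1 hn2 r
  have hn0 : (0 : ℝ) < n := by exact_mod_cast hn1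
  have hs : (0 : ℝ) < (n : ℝ) ^ (ρ - 1) := Real.rpow_pos_of_pos hn0 _
  have hq : 0 < √(n : ℝ) := Real.sqrt_pos.2 hn0
  have hq1 : 1 ≤ √(n : ℝ) := Real.one_le_sqrt.2 (by exact_mod_cast hn1)
  set N := rootCount r a
  set m := ⌊n * p a.2⌋₊
  set s := p a.2 ^ (ρ - 1) * scaledIncr μ X ρ n with hsdef
  set η := countDev p a n r with hη
  have hηe : (N : ℝ) - n * p a.2 = η * √n := by
    rw [hη, countDev_eq]
    field_simp
    rfl
  have hnp : 0 ≤ n * p a.2 := by have := hp0.1; positivity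
  have hm1 : (m : ℝ) ≤ n * p a.2 := Nat.floor_le hnp
  have hm2 : n * p a.2 < m + 1 := Nat.lt_floor_add_one _
  have hmn : m ≤ n := by
    have : (m : ℝ) ≤ n := hm1.trans (by nlinarith [hp0.2])
    exact_mod_cast this
  have hNn : N ≤ n := rootCount_le r a
  have hs3 : |s| ≤ C' := by
    rw [hsdef, abs_mul, abs_of_nonneg (Real.rpow_nonneg hp0.1.le _)]
    have h4 := Real.rpow_le_one hp0.1.le hp0.2.le (show 0 ≤ ρ - 1 by linarith [h.param.one_lt])
    have h5 := mul_le_mul h4 (hC' n) (abs_nonneg _) zero_le_one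
    linarith
  have hNm : |(N : ℝ) - m| ≤ |η| * √n + 1 := by
    have e : (N : ℝ) - m = η * √n + (n * p a.2 - m) := by rw [← hηe]; ring
    rw [e]
    refine (abs_add_le _ _).trans (add_le_add (by rw [abs_mul, abs_of_pos hq]) ?_)
    rw [abs_of_nonneg (by linarith)]
    linarith
  -- For small deviations the regular increments give the `ε` term. For large ones `|η| ≥ δ * √n`,
  -- so `|N - m|` is at most `2 * η ^ 2 / δ`, which becomes a null variable after the remaining
  -- division by `√n`.
  have hmain : |meanSize μ X N - meanSize μ X m - s * (n : ℝ) ^ (ρ - 1) * ((N : ℝ) - m)| ≤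
      (n : ℝ) ^ (ρ - 1) * (ε * (|η| * √n + 1) + 2 * (C + C') / δ * η ^ 2) := by
    rcases le_or_gt |(N : ℝ) - n * p a.2| (δ * n) with hN | hN
    · have h1 := abs_sub_sub_le_of_incr (f := meanSize μ X) (s := s * (n : ℝ) ^ (ρ - 1))
        (B := ε * (n : ℝ) ^ (ρ - 1)) (N := N) (m := m) fun k hk1 hk2 => by
          refine hn k ?_
          rw [abs_le] at hN ⊢
          rcases le_total N m with hle | hle
          · rw [min_eq_left hle] at hk1
            rw [max_eq_right hle] at hk2
            have c1 : (N : ℝ) ≤ k := by exact_mod_cast hk1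
            have c2 : (k : ℝ) ≤ m := by exact_mod_cast hk2.le
            constructor <;> linarith [hN.1, hN.2]
          · rw [min_eq_right hle] at hk1
            rw [max_eq_left hle] at hk2
            have c1 : (m : ℝ) ≤ k := by exact_mod_cast hk1
            have c2 : (k : ℝ) ≤ N := by exact_mod_cast hk2.le
            constructor <;> linarith [hN.1, hN.2]
      refine h1.trans ?_
      have h2 := mul_le_mul_of_nonneg_left hNm hε.le
      have h3 : 0 ≤ 2 * (C + C') / δ * η ^ 2 := by positivity
      calc ε * (n : ℝ) ^ (ρ - 1) * |(N : ℝ) - m| = (n : ℝ) ^ (ρ - 1) * (ε * |(N : ℝ) - m|) := by ring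
        _ ≤ _ := mul_le_mul_of_nonneg_left (by linarith) hs.le
    · have h1 := abs_sub_sub_le_of_incr (f := meanSize μ X) (s := s * (n : ℝ) ^ (ρ - 1))
        (B := (C + C') * (n : ℝ) ^ (ρ - 1)) (N := N) (m := m) fun k hk1 hk2 => by
          have hkn : k ≤ n := hk2.le.trans (max_le hNn hmn)
          refine (abs_sub _ _).trans ?_
          rw [abs_mul, abs_of_pos hs, add_mul]
          exact add_le_add (hC n k hkn) (mul_le_mul_of_nonneg_right hs3 hs.le)
      refine h1.trans ?_
      rw [hηe, abs_mul, abs_of_pos hq] at hN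
      have h2 : δ * √n ≤ |η| := by
        have e : δ * n = δ * √n * √n := by rw [mul_assoc, Real.mul_self_sqrt hn0.le]
        rw [e] at hN
        exact (lt_of_mul_lt_mul_right hN hq.le).le
      have h3 : 1 ≤ |η| * √n := by linarith
      have h4 : |(N : ℝ) - m| ≤ 2 * (|η| ^ 2 / δ) := by
        have h5 : |η| * √n ≤ |η| ^ 2 / δ := by
          rw [le_div_iff₀ hδ]
          nlinarith [abs_nonneg η]
        linarith
      have h5 : 0 ≤ ε * (|η| * √n + 1) := by positivity
      have h6 : (C + C') * |(N : ℝ) - m| ≤ 2 * (C + C') / δ * η ^ 2 := by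
        refine (mul_le_mul_of_nonneg_left h4 (by positivity)).trans_eq ?_
        rw [sq_abs]
        ring
      calc (C + C') * (n : ℝ) ^ (ρ - 1) * |(N : ℝ) - m| =
          (n : ℝ) ^ (ρ - 1) * ((C + C') * |(N : ℝ) - m|) := by ring
        _ ≤ _ := mul_le_mul_of_nonneg_left (by linarith) hs.le
  have hdiff : (meanSize μ X N - meanSize μ X m) / devScale ρ n - s * η =
      (meanSize μ X N - meanSize μ X m - s * (n : ℝ) ^ (ρ - 1) * ((N : ℝ) - m)) / devScale ρ n +
        s * ((n * p a.2 - m) / √n) := by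
    have e : (N : ℝ) - m = η * √n + (n * p a.2 - m) := by rw [← hηe]; ring
    rw [e, devScale]
    field_simp
    ring
  simp only [Pi.sub_apply]
  change |(meanSize μ X N - meanSize μ X m) / devScale ρ n - s * η| ≤ _
  rw [hdiff]
  have hA : |(meanSize μ X N - meanSize μ X m - s * (n : ℝ) ^ (ρ - 1) * ((N : ℝ) - m)) /
      devScale ρ n| ≤ ε * (|η| + 1) + 2 * (C + C') / δ * (η ^ 2 / √n) := by
    rw [abs_div, abs_of_pos (devScale_pos ρ hn1), div_le_iff₀ (devScale_pos ρ hn1), devScale]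
    refine hmain.trans ?_
    have e : (ε * (|η| + 1) + 2 * (C + C') / δ * (η ^ 2 / √n)) * ((n : ℝ) ^ (ρ - 1) * √n) =
        (n : ℝ) ^ (ρ - 1) * (ε * (|η| * √n + √n) + 2 * (C + C') / δ * η ^ 2) := by
      field_simp
    rw [e]
    refine mul_le_mul_of_nonneg_left ?_ hs.le
    have := mul_le_mul_of_nonneg_left hq1 hε.le
    linarith
  have hB : |s * ((n * p a.2 - m) / √n)| ≤ C' * (1 / √n) := by
    rw [abs_mul]
    refine mul_le_mul hs3 ?_ (abs_nonneg _) hC0'.le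
    rw [abs_div, abs_of_pos hq, abs_of_nonneg (by linarith)]
    exact div_le_div_of_nonneg_right (by linarith) hq.le
  rw [abs_of_nonneg (show 0 ≤ |η| + 1 by positivity),
    abs_of_nonneg (show 0 ≤ (η ^ 2 + 1) / √(n : ℝ) by positivity)]
  refine (abs_add_le _ _).trans ((add_le_add hA hB).trans ?_)
  have e : (C' + 2 * (C + C') / δ) * ((η ^ 2 + 1) / √(n : ℝ)) =
      C' * (1 / √n) + 2 * (C + C') / δ * (η ^ 2 / √n) +
      (C' * (η ^ 2 / √n) + 2 * (C + C') / δ * (1 / √n)) := by ring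
  have h9 : 0 ≤ C' * (η ^ 2 / √(n : ℝ)) + 2 * (C + C') / δ * (1 / √n) := by positivity
  rw [e]
  linarith

/-- The toll is asymptotically linear in the numbers of labelings in the subtries. -/
theorem IsTrie.lpEquiv_toll (h : IsTrie p ρ μ X) :
    LpEquiv μ X (fun n r => toll μ X r / devScale ρ n)
      fun n r => scaledIncr μ X ρ n * scaledRootSum (linearToll p ρ) n r := by
  set D : Fin M × Fin A → RootFun M A := fun a n r =>
    (meanSize μ X (rootCount r a) - meanSize μ X ⌊n * p a.2⌋₊) / devScale ρ n with hD
  set b : ℕ → ℝ := fun n => (1 + ∑ a : Fin M × Fin A, meanSize μ X ⌊n * p a.2⌋₊ -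
    meanSize μ X n) / devScale ρ n with hb
  set Z : RootFun M A := fun n r => scaledIncr μ X ρ n * scaledRootSum (linearToll p ρ) n r with hZ
  have h1 : LpEquiv μ X (∑ a, D a) Z := by
    have h2 := h.model.lpEquiv_sum (s := Finset.univ) fun a _ => h.lpEquiv_meanSize a
    have e : ∑ a : Fin M × Fin A, (fun n (r : Fin n → Fin M → Fin A) =>
        p a.2 ^ (ρ - 1) * scaledIncr μ X ρ n * countDev p a n r) = Z := by
      funext n r
      simp only [Finset.sum_apply, hZ, scaledRootSum, rootSum_linearToll h.param, countDev,
        Finset.mul_sum, Finset.sum_div]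
      exact Finset.sum_congr rfl fun a _ => by ring
    rw [e] at h2
    exact h2
  have e1 : (fun n (r : Fin n → Fin M → Fin A) => toll μ X r / devScale ρ n) =
      (∑ a, D a) + fun n _ => b n := by
    funext n r
    simp only [Pi.add_apply, Finset.sum_apply, hD, hb, toll, ← Finset.sum_div, ← add_div,
      Finset.sum_sub_distrib]
    congr 1
    ring
  -- The deterministic part `b` needs no estimate of its own: the toll has mean zero by the
  -- recurrence of the mean, and so has `Z`. Hence `b` is minus a difference of means, which
  -- vanishes in the limit by `h1`.
  have hmean : ∀ n, 2 ≤ n → rootMean μ X (∑ a, D a) n - rootMean μ X Z n = -b n := by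
    intro n hn
    have m1 : rootMean μ X (fun n (r : Fin n → Fin M → Fin A) => toll μ X r / devScale ρ n) n =
        0 := by
      have hint : Integrable (fun ω => 1 + ∑ a, meanSize μ X (rootCount (rootLabels X n ω) a)) μ :=
        h.model.integrable_comp_rootLabels fun r => 1 + ∑ a, meanSize μ X (rootCount r a)
      simp only [rootMean, toll]
      rw [integral_div, integral_sub hint (integrable_const _),
        ← h.model.meanSize_eq h.param.pos h.nonexplosive hn]
      simp
    have m2 : rootMean μ X Z n = 0 := by
      rw [hZ, rootMean_mul]
      have hz : ∀ n, ∫ ω, rootSum (linearToll p ρ) (rootLabels X n ω) ∂μ = 0 := by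
        intro n
        induction n with
        | zero => simp [rootSum]
        | succ n ih =>
          have := h.model.integral_rootSum_pow_succ (linearToll p ρ) 1 n
          simpa [Finset.sum_range_succ, ih, h.model.integral_linearToll h.param] using this
      simp only [rootMean, scaledRootSum]
      rw [integral_div, hz]
      simp
    rw [e1] at m1
    have m3 := h.model.rootMean_add (∑ a, D a) (fun n _ => b n) n
    rw [rootMean_const] at m3
    have m4 : rootMean μ X (∑ a, D a) n + b n = 0 := m3.symm.trans m1
    linarith
  have hb0 : Tendsto b atTop (𝓝 0) := by
    have h2 := (h.model.tendsto_rootMean_sub h1).neg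
    rw [neg_zero] at h2
    refine h2.congr' ?_
    filter_upwards [eventually_ge_atTop 2] with n hn
    rw [hmean n hn, neg_neg]
  rw [e1]
  have h3 := h.model.lpNull_add h1 (h.model.lpNull_of_tendsto hb0)
  rw [LpEquiv]
  have e2 : ((∑ a, D a) + fun n _ => b n) - Z = ((∑ a, D a) - Z) + fun n _ => b n := by ring
  rw [e2]
  exact h3

end RootLimits

/-! ### Asymptotic transfer for the trie recurrence -/

section Transfer

variable {M A : ℕ} {p : Fin A → ℝ} {ρ : ℝ} {Ω : Type*} [MeasurableSpace Ω] {μ : Measure Ω}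
  [IsProbabilityMeasure μ] {X : ℕ → Edge M → Ω → Fin A}

theorem IsParam.sum_rpow_lt_one (h : IsParam M p ρ) {θ : ℝ} (hθ : ρ < θ) :
    (M : ℝ) * ∑ j, p j ^ θ < 1 := by
  rw [← h.root]
  have hM : (0 : ℝ) < M := by exact_mod_cast h.pos_M
  refine mul_lt_mul_of_pos_left ?_ hM
  exact Finset.sum_lt_sum_of_nonempty ⟨⟨0, h.pos_A⟩, Finset.mem_univ _⟩ fun j _ =>
    Real.rpow_lt_rpow_of_exponent_gt (h.pos j).1 (h.pos j).2 hθ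

/-- The proportions of labelings in the subtries converge to the letter probabilities, so the
contraction factor at exponent `θ` approaches `M * ∑ j, p j ^ θ`. -/
theorem IsTrie.rootMean_rpow_le (h : IsTrie p ρ μ X) {θ q : ℝ} (hθ : ρ < θ)
    (hq : (M : ℝ) * ∑ j, p j ^ θ < q) :
    ∀ᶠ n in atTop, rootMean μ X (fun _ r => ∑ a, (rootCount r a : ℝ) ^ θ) n ≤ q * (n : ℝ) ^ θ := by
  have h1 : Tendsto (fun n => ∑ a : Fin M × Fin A,
      rootMean μ X (fun n r => countRatio a n r ^ θ) n) atTop (𝓝 (M * ∑ j, p j ^ θ)) := by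
    rw [← sum_prod_snd fun j => p j ^ θ]
    refine tendsto_finsetSum _ fun a _ => ?_
    have h2 := h.model.tendsto_rootMean_sub (h.lpEquiv_countRatio_rpow a
      (by linarith [h.param.one_lt] : 1 ≤ θ))
    have h3 := h2.add_const (p a.2 ^ θ)
    rw [zero_add] at h3
    refine h3.congr fun n => ?_
    rw [rootMean_const (fun _ => p a.2 ^ θ) n, sub_add_cancel]
  filter_upwards [h1.eventually_le_const hq, eventually_ge_atTop 1] with n hn hn1
  have hn0 : (0 : ℝ) < n := by exact_mod_cast hn1
  rw [← h.model.rootMean_sum] at hn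
  have e : rootMean μ X (fun _ r => ∑ a, (rootCount r a : ℝ) ^ θ) n =
      (n : ℝ) ^ θ * rootMean μ X (fun n r => ∑ a, countRatio a n r ^ θ) n := by
    rw [← rootMean_mul μ X fun n => (n : ℝ) ^ θ]
    unfold rootMean
    congr 1
    funext ω
    simp only [Finset.mul_sum]
    refine Finset.sum_congr rfl fun a _ => ?_
    rw [countRatio, Real.div_rpow (Nat.cast_nonneg _) hn0.le]
    field_simp
  rw [e, mul_comm q]
  exact mul_le_mul_of_nonneg_left hn (by positivity)

/-- A sequence which satisfies the recurrence of the G-trie with a toll of order `o(n ^ θ)`, where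
`ρ < θ`, is of order `o(n ^ θ)`. -/
theorem IsTrie.transfer (h : IsTrie p ρ μ X) {θ : ℝ} (hθ : ρ < θ) {x : ℕ → ℝ} (hx0 : x 0 = 0)
    (hx : Tendsto (fun n : ℕ => (x n - rootMean μ X (fun _ r => ∑ a, x (rootCount r a)) n) /
      (n : ℝ) ^ θ) atTop (𝓝 0)) :
    Tendsto (fun n : ℕ => x n / (n : ℝ) ^ θ) atTop (𝓝 0) := by
  -- At this intermediate exponent the recurrence still contracts. A multiple of `n ^ θ'` can thus
  -- absorb the finitely many initial values while being `o(n ^ θ)`.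
  set θ' := (ρ + θ) / 2 with hθ'
  have hρθ' : ρ < θ' := by linarith
  have hθ'θ : θ' < θ := by linarith
  have hθ'0 : 0 < θ' := by linarith [h.param.one_lt]
  obtain ⟨q, hq, hq1⟩ : ∃ q, max ((M : ℝ) * ∑ j, p j ^ θ) (M * ∑ j, p j ^ θ') < q ∧ q < 1 :=
    exists_between (max_lt (h.param.sum_rpow_lt_one hθ) (h.param.sum_rpow_lt_one hρθ'))
  have c1 := h.rootMean_rpow_le hθ ((le_max_left _ _).trans_lt hq)
  have c2 := h.rootMean_rpow_le hρθ' ((le_max_right _ _).trans_lt hq)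
  have key : ∀ ε > 0, ∃ K, ∀ n : ℕ, |x n| ≤ ε * (n : ℝ) ^ θ + K * (n : ℝ) ^ θ' := by
    intro ε hε
    have hε1 : 0 < ε * (1 - q) := mul_pos hε (by linarith)
    have hr := (Metric.tendsto_nhds.1 hx (ε * (1 - q)) hε1)
    obtain ⟨n₀, hn₀⟩ := eventually_atTop.1 ((c1.and c2).and (hr.and (eventually_ge_atTop 1)))
    set K := ∑ n ∈ Finset.range n₀, |x n| with hK
    have hK0 : 0 ≤ K := Finset.sum_nonneg fun _ _ => abs_nonneg _
    refine ⟨K, fun n => ?_⟩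
    set g : ℕ → ℝ := fun n => ε * (n : ℝ) ^ θ + K * (n : ℝ) ^ θ' with hg
    have hg0 : ∀ n : ℕ, 0 ≤ g n := fun n => by positivity
    induction n using Nat.strong_induction_on with
    | _ n ih =>
    rcases Nat.eq_zero_or_pos n with rfl | hn
    · rw [hx0, abs_zero]
      exact hg0 0
    have hn0 : (0 : ℝ) < n := by exact_mod_cast hn
    rcases lt_or_ge n n₀ with hlt | hge
    · have h1 : |x n| ≤ K := Finset.single_le_sum (f := fun n => |x n|)
        (fun _ _ => abs_nonneg _) (Finset.mem_range.2 hlt)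
      have h2 : 1 ≤ (n : ℝ) ^ θ' := Real.one_le_rpow (by exact_mod_cast hn) hθ'0.le
      have h3 : 0 ≤ ε * (n : ℝ) ^ θ := by positivity
      nlinarith
    obtain ⟨⟨d1, d2⟩, d3, -⟩ := hn₀ n hge
    have hnθ : 0 < (n : ℝ) ^ θ := Real.rpow_pos_of_pos hn0 _
    rw [Real.dist_eq, sub_zero, abs_div, abs_of_pos hnθ, div_lt_iff₀ hnθ] at d3
    by_contra! hcon
    have hgn : 0 < g n := by
      have : 0 ≤ K * (n : ℝ) ^ θ' := by positivity
      have : 0 < ε * (n : ℝ) ^ θ := by positivity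
      linarith
    -- One subtrie may contain all `n` labelings, so `x n` also occurs on the right of its own
    -- recurrence. If the claim fails at `n`, then `lam > 1` and `lam * g` bounds `x` up to and
    -- including `n`; contraction contradicts the choice of `lam`.
    set lam := |x n| / g n with hlam
    have hlam1 : 1 < lam := (one_lt_div hgn).2 hcon
    have hlamg : |x n| = lam * g n := by rw [hlam]; field_simp
    have hle : ∀ N ≤ n, |x N| ≤ lam * g N := by
      intro N hN
      rcases hN.lt_or_eq with hlt | rfl
      · exact (ih N hlt).trans (le_mul_of_one_le_left (hg0 N) hlam1.le)
      · exact hlamg.le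
    have d4 : |rootMean μ X (fun _ r => ∑ a, x (rootCount r a)) n| ≤ lam * (q * g n) := by
      have e1 : |rootMean μ X (fun _ r => ∑ a, x (rootCount r a)) n| ≤
          rootMean μ X (fun _ r => |∑ a, x (rootCount r a)|) n := by
        unfold rootMean
        exact norm_integral_le_integral_norm fun ω => ∑ a, x (rootCount (rootLabels X n ω) a)
      have e2 : rootMean μ X (fun _ r => |∑ a, x (rootCount r a)|) n ≤
          rootMean μ X (fun _ r => lam * ε * ∑ a, (rootCount r a : ℝ) ^ θ +
            lam * K * ∑ a, (rootCount r a : ℝ) ^ θ') n := by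
        refine h.model.rootMean_mono fun r => ?_
        refine (Finset.abs_sum_le_sum_abs _ _).trans ?_
        rw [Finset.mul_sum, Finset.mul_sum, ← Finset.sum_add_distrib]
        refine Finset.sum_le_sum fun a _ => (hle _ (rootCount_le r a)).trans_eq ?_
        simp only [hg]
        ring
      rw [h.model.rootMean_add (fun _ r => lam * ε * ∑ a, (rootCount r a : ℝ) ^ θ),
        rootMean_mul μ X (fun _ => lam * ε), rootMean_mul μ X (fun _ => lam * K)] at e2
      refine e1.trans (e2.trans ?_)
      have f1 := mul_le_mul_of_nonneg_left d1 (show 0 ≤ lam * ε by positivity)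
      have f2 := mul_le_mul_of_nonneg_left d2 (show 0 ≤ lam * K by positivity)
      refine (add_le_add f1 f2).trans_eq ?_
      simp only [hg]
      ring
    have d5 : |x n| ≤ lam * (q * g n) + ε * (1 - q) * (n : ℝ) ^ θ := by
      have := abs_add_le (rootMean μ X (fun _ r => ∑ a, x (rootCount r a)) n)
        (x n - rootMean μ X (fun _ r => ∑ a, x (rootCount r a)) n)
      rw [add_sub_cancel] at this
      linarith
    have d6 : ε * (1 - q) * (n : ℝ) ^ θ ≤ (1 - q) * g n := by
      have : 0 ≤ (1 - q) * (K * (n : ℝ) ^ θ') := mul_nonneg (by linarith) (by positivity)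
      simp only [hg]
      linarith
    rw [hlamg] at d5
    have d7 : 0 < (lam - 1) * ((1 - q) * g n) :=
      mul_pos (by linarith) (mul_pos (by linarith) hgn)
    linarith
  rw [Metric.tendsto_nhds]
  intro ε hε
  obtain ⟨K, hK⟩ := key (ε / 2) (by positivity)
  have h1 : Tendsto (fun n : ℕ => K * (n : ℝ) ^ (-(θ - θ'))) atTop (𝓝 0) := by
    have := ((tendsto_rpow_neg_atTop (show 0 < θ - θ' by linarith)).comp
      (tendsto_natCast_atTop_atTop (R := ℝ))).const_mul K
    rwa [mul_zero] at this
  filter_upwards [h1.eventually_lt_const (half_pos hε), eventually_ge_atTop 1] with n hn hn1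
  have hn0 : (0 : ℝ) < n := by exact_mod_cast hn1
  have hnθ : 0 < (n : ℝ) ^ θ := Real.rpow_pos_of_pos hn0 _
  rw [Real.dist_eq, sub_zero, abs_div, abs_of_pos hnθ, div_lt_iff₀ hnθ]
  refine (hK n).trans_lt ?_
  have e : K * (n : ℝ) ^ θ' = K * (n : ℝ) ^ (-(θ - θ')) * (n : ℝ) ^ θ := by
    rw [mul_assoc, ← Real.rpow_add hn0]
    congr 2
    ring
  rw [e]
  have := mul_lt_mul_of_pos_right hn hnθ
  linarith

end Transfer

/-! ### Tools for the induction on the order of the moment -/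

section MomentInduction

variable {M A : ℕ} {p : Fin A → ℝ} {ρ : ℝ} {Ω : Type*} [MeasurableSpace Ω] {μ : Measure Ω}
  [IsProbabilityMeasure μ] {X : ℕ → Edge M → Ω → Fin A}

theorem IsTrie.lpBounded_gaussMoment (h : IsTrie p ρ μ X) {v : RootFun M A} (hv : LpBounded μ X v)
    (k : ℕ) : LpBounded μ X fun n r => gaussMoment k (v n r) :=
  h.model.lpBounded_const_mul _ (h.model.lpBounded_pow hv (k / 2))

theorem IsTrie.lpEquiv_gaussMoment (h : IsTrie p ρ μ X) {v w : RootFun M A}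
    (hvw : LpEquiv μ X v w) (hw : LpBounded μ X w) (k : ℕ) :
    LpEquiv μ X (fun n r => gaussMoment k (v n r)) fun n r => gaussMoment k (w n r) :=
  h.model.lpEquiv_const_mul _ (h.model.lpEquiv_pow hvw hw (k / 2))

/-- The moments of sums of independent random variables whose first moments are asymptotically
those of centered normal distributions. -/
theorem IsTrie.lpEquiv_moment_sum (h : IsTrie p ρ μ X) {ι : Type*} [DecidableEq ι] {m : ℕ} (hm : m ≠ 0)
    {e : ι → ℕ → RootFun M A} {Q : Finset ι → ℕ → RootFun M A} {v x : ι → RootFun M A}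
    (he0 : ∀ i, e i 0 = 1) (hQ0 : ∀ s, Q s 0 = 1) (hQe : ∀ k, k ≠ 0 → Q ∅ k = 0)
    (hQ : ∀ s i, i ∉ s → ∀ k, Q (insert i s) k =
      ∑ j ∈ Finset.range (k + 1), fun n r => (k.choose j : ℝ) * (e i j n r * Q s (k - j) n r))
    (hv0 : ∀ i n r, 0 ≤ v i n r) (hv : ∀ i, LpBounded μ X (v i))
    (he : ∀ i, ∀ k < m, LpEquiv μ X (e i k) fun n r => gaussMoment k (v i n r))
    (hem : ∀ i, e i m = (fun n r => gaussMoment m (v i n r)) + x i) (s : Finset ι) :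
    (∀ k < m, LpEquiv μ X (Q s k) fun n r => gaussMoment k (∑ i ∈ s, v i n r)) ∧
      LpEquiv μ X (Q s m) ((fun n r => gaussMoment m (∑ i ∈ s, v i n r)) + ∑ i ∈ s, x i) := by
  induction s using Finset.induction_on with
  | empty =>
    have key : ∀ k, Q ∅ k = fun n r => gaussMoment k (∑ i ∈ (∅ : Finset ι), v i n r) := by
      intro k
      rcases Nat.eq_zero_or_pos k with rfl | hk
      · rw [hQ0]
        funext n r
        simp [gaussMoment_zero]
      · rw [hQe k hk.ne']
        funext n r
        simp [gaussMoment_of_zero hk.ne']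
    refine ⟨fun k _ => ?_, ?_⟩
    · rw [key]
      exact LpEquiv.refl _ _ _
    · rw [key, Finset.sum_empty, add_zero]
      exact LpEquiv.refl _ _ _
  | insert i s hi ih =>
    have hvs : LpBounded μ X fun n r => ∑ i ∈ s, v i n r := by
      have := h.model.lpBounded_sum (s := s) fun i _ => hv i
      have e : (fun n (r : Fin n → Fin M → Fin A) => ∑ i ∈ s, v i n r) = ∑ i ∈ s, v i := by
        funext n r
        simp
      rw [e]
      exact this
    have hvs0 : ∀ n r, 0 ≤ ∑ i ∈ s, v i n r := fun n r => Finset.sum_nonneg fun i _ => hv0 i n r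
    have hconv : ∀ k, (fun n (r : Fin n → Fin M → Fin A) =>
        gaussMoment k (∑ i ∈ insert i s, v i n r)) = ∑ j ∈ Finset.range (k + 1), fun n r =>
        (k.choose j : ℝ) * (gaussMoment j (v i n r) *
          gaussMoment (k - j) (∑ i ∈ s, v i n r)) := by
      intro k
      funext n r
      rw [Finset.sum_insert hi, gaussMoment_add (hv0 i n r) (hvs0 n r)]
      simp only [Finset.sum_apply]
      exact Finset.sum_congr rfl fun j _ => mul_assoc _ _ _
    have hprod : ∀ j l, j < m → l < m → ∀ C : ℝ,
        LpEquiv μ X (fun n r => C * (e i j n r * Q s l n r)) fun n r =>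
          C * (gaussMoment j (v i n r) * gaussMoment l (∑ i ∈ s, v i n r)) := fun j l hj hl C =>
      h.model.lpEquiv_const_mul C (h.model.lpEquiv_mul (he i j hj) (ih.1 l hl)
        (h.lpBounded_gaussMoment (hv i) j) (h.lpBounded_gaussMoment hvs l))
    refine ⟨fun k hk => ?_, ?_⟩
    · rw [hQ s i hi, hconv]
      refine h.model.lpEquiv_sum fun j hj => hprod j (k - j) ?_ ?_ _
      · have := Finset.mem_range.1 hj
        omega
      · omega
    · have hdecomp : (fun n (r : Fin n → Fin M → Fin A) =>
          gaussMoment m (∑ i ∈ insert i s, v i n r)) + ∑ i ∈ insert i s, x i =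
          ∑ j ∈ Finset.range (m + 1), ((fun n r => (m.choose j : ℝ) * (gaussMoment j (v i n r) *
            gaussMoment (m - j) (∑ i ∈ s, v i n r))) +
            ((if j = 0 then ∑ i ∈ s, x i else 0) + if j = m then x i else 0)) := by
        rw [hconv, Finset.sum_add_distrib, Finset.sum_add_distrib, Finset.sum_ite_eq',
          Finset.sum_ite_eq', if_pos (by simp), if_pos (by simp), Finset.sum_insert hi]
        ring
      rw [hQ s i hi, hdecomp]
      -- Moments of order `m` occur only for `j = 0` and `j = m`, each multiplied by a moment of
      -- order zero. The errors `x i` therefore enter linearly and with coefficient one.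
      refine h.model.lpEquiv_sum fun j hj => ?_
      rcases Nat.eq_zero_or_pos j with rfl | hj0
      · rw [if_pos rfl, if_neg hm.symm, add_zero]
        have e1 : (fun n (r : Fin n → Fin M → Fin A) =>
            (m.choose 0 : ℝ) * (e i 0 n r * Q s (m - 0) n r)) = Q s m := by
          funext n r
          simp [he0]
        have e2 : (fun n (r : Fin n → Fin M → Fin A) => (m.choose 0 : ℝ) *
            (gaussMoment 0 (v i n r) * gaussMoment (m - 0) (∑ i ∈ s, v i n r))) =
            fun n r => gaussMoment m (∑ i ∈ s, v i n r) := by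
          funext n r
          simp [gaussMoment_zero]
        rw [e1, e2]
        exact ih.2
      rw [if_neg hj0.ne', zero_add]
      rcases eq_or_ne j m with rfl | hjm
      · rw [if_pos rfl]
        have e1 : (fun n (r : Fin n → Fin M → Fin A) =>
            (j.choose j : ℝ) * (e i j n r * Q s (j - j) n r)) = e i j := by
          funext n r
          simp [hQ0]
        have e2 : (fun n (r : Fin n → Fin M → Fin A) => (j.choose j : ℝ) *
            (gaussMoment j (v i n r) * gaussMoment (j - j) (∑ i ∈ s, v i n r))) =
            fun n r => gaussMoment j (v i n r) := by
          funext n r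
          simp [gaussMoment_zero]
        rw [e1, e2, hem]
        exact LpEquiv.refl _ _ _
      · rw [if_neg hjm, add_zero]
        have := Finset.mem_range.1 hj
        exact hprod j (m - j) (by omega) (by omega) _

/-- The asymptotic variance of the size. -/
def limVar (μ : Measure Ω) (X : ℕ → Edge M → Ω → Fin A) (c : ℝ) (n : ℕ) : ℝ :=
  c * meanIncr μ X n ^ 2 * n

theorem limVar_nonneg {c : ℝ} (hc : 0 ≤ c) (n : ℕ) : 0 ≤ limVar μ X c n := by
  unfold limVar
  positivity

theorem limVar_eq (c : ℝ) (n : ℕ) :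
    limVar μ X c n = devScale ρ n ^ 2 * (c * scaledIncr μ X ρ n ^ 2) := by
  rw [limVar, devScale, meanIncr_eq μ X ρ, mul_pow, mul_pow, Real.sq_sqrt (Nat.cast_nonneg n)]
  ring

/-- The deviation of a central moment from the moment of a normal distribution. -/
def momentError (μ : Measure Ω) (X : ℕ → Edge M → Ω → Fin A) (c : ℝ) (m n : ℕ) : ℝ :=
  centralMoment (size X n) m μ - gaussMoment m (limVar μ X c n)

theorem devScale_mono (hρ : 1 < ρ) {N n : ℕ} (h : N ≤ n) : devScale ρ N ≤ devScale ρ n := by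
  have h1 : (N : ℝ) ≤ n := by exact_mod_cast h
  exact mul_le_mul (Real.rpow_le_rpow (by positivity) h1 (by linarith)) (Real.sqrt_le_sqrt h1)
    (Real.sqrt_nonneg _) (by positivity)

theorem devScale_nonneg (ρ : ℝ) (n : ℕ) : 0 ≤ devScale ρ n := by
  unfold devScale
  positivity

theorem devScale_pow {n : ℕ} (hn : 1 ≤ n) (m : ℕ) :
    devScale ρ n ^ m = (n : ℝ) ^ ((m : ℝ) * (ρ - 1 / 2)) := by
  have hn0 : (0 : ℝ) < n := by exact_mod_cast hn
  rw [devScale, Real.sqrt_eq_rpow, ← Real.rpow_add hn0, ← Real.rpow_natCast,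
    ← Real.rpow_mul hn0.le]
  congr 1
  ring

theorem tendsto_devScale (hρ : 1 < ρ) : Tendsto (fun n : ℕ => devScale ρ n) atTop atTop := by
  have h1 : Tendsto (fun n : ℕ => (n : ℝ) ^ (ρ - 1 / 2)) atTop atTop :=
    (tendsto_rpow_atTop (by linarith)).comp tendsto_natCast_atTop_atTop
  refine h1.congr' ?_
  filter_upwards [eventually_ge_atTop 1] with n hn
  have := devScale_pow (ρ := ρ) hn 1
  rw [pow_one, Nat.cast_one, one_mul] at this
  exact this.symm

/-- The squared increment scales by `p a.2 ^ (2 * (ρ - 1))` and the number of labelings by `p a.2`.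
-/
theorem IsTrie.lpEquiv_limVar (h : IsTrie p ρ μ X) (c : ℝ) (a : Fin M × Fin A) :
    LpEquiv μ X (fun n r => limVar μ X c (rootCount r a) / devScale ρ n ^ 2)
      fun n _ => p a.2 ^ (2 * ρ - 1) * (c * scaledIncr μ X ρ n ^ 2) := by
  have h1 := h.lpEquiv_meanIncr a
  have hb1 : LpBounded μ X fun n _ => p a.2 ^ (ρ - 1) * scaledIncr μ X ρ n :=
    h.model.lpBounded_const_mul _ h.lpBounded_scaledIncr
  have h2 := h.model.lpEquiv_const_mul c (h.model.lpEquiv_mul (h.model.lpEquiv_pow h1 hb1 2)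
    (h.lpEquiv_countRatio a) (h.model.lpBounded_pow hb1 2) (lpBounded_const μ X _))
  have e1 : (fun n (r : Fin n → Fin M → Fin A) =>
      limVar μ X c (rootCount r a) / devScale ρ n ^ 2) = fun n r =>
      c * (((fun n (r : Fin n → Fin M → Fin A) =>
        meanIncr μ X (rootCount r a) / (n : ℝ) ^ (ρ - 1)) ^ 2 * countRatio a) n r) := by
    funext n r
    simp only [Pi.mul_apply, Pi.pow_apply, countRatio, limVar, devScale]
    rw [mul_pow, Real.sq_sqrt (Nat.cast_nonneg n)]
    ring
  have e2 : (fun n (_ : Fin n → Fin M → Fin A) =>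
      p a.2 ^ (2 * ρ - 1) * (c * scaledIncr μ X ρ n ^ 2)) = fun n r =>
      c * (((fun n _ => p a.2 ^ (ρ - 1) * scaledIncr μ X ρ n : RootFun M A) ^ 2 *
        (fun _ _ => p a.2 : RootFun M A) : RootFun M A) n r) := by
    funext n r
    have hp0 := (h.param.pos a.2).1
    have e : p a.2 ^ (2 * ρ - 1) = (p a.2 ^ (ρ - 1)) ^ 2 * p a.2 := by
      rw [← Real.rpow_natCast, ← Real.rpow_mul hp0.le, ← Real.rpow_add_one hp0.ne']
      congr 1
      push_cast
      ring
    simp only [Pi.mul_apply, Pi.pow_apply, e]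
    ring
  rw [e1, e2]
  exact h2

/-- The bound is uniform in the root labels: small subtries have bounded errors, negligible against
the growing scale, and for large ones the scale at `rootCount r a` is at most the scale at `n`. -/
theorem IsTrie.lpNull_momentError (h : IsTrie p ρ μ X) {c : ℝ} {k : ℕ} (hk : k ≠ 0)
    (hx : Tendsto (fun n => momentError μ X c k n / devScale ρ n ^ k) atTop (𝓝 0))
    (a : Fin M × Fin A) :
    LpNull μ X fun n r => momentError μ X c k (rootCount r a) / devScale ρ n ^ k := by
  refine h.model.lpNull_of_abs_le fun ε hε => ?_
  obtain ⟨N₀, hN₀⟩ := eventually_atTop.1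
    ((Metric.tendsto_nhds.1 hx ε hε).and (eventually_ge_atTop 1))
  set K := ∑ N ∈ Finset.range N₀, |momentError μ X c k N|
  have h1 : Tendsto (fun n => devScale ρ n ^ k) atTop atTop :=
    (tendsto_pow_atTop hk).comp (tendsto_devScale h.param.one_lt)
  filter_upwards [h1.eventually_ge_atTop (K / ε), eventually_ge_atTop 1] with n hn hn1 r
  have hs := pow_pos (devScale_pos ρ hn1) k
  rw [abs_div, abs_of_pos hs, div_le_iff₀ hs]
  rcases lt_or_ge (rootCount r a) N₀ with hlt | hge
  · have h2 : |momentError μ X c k (rootCount r a)| ≤ K :=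
      Finset.single_le_sum (f := fun N => |momentError μ X c k N|)
        (fun _ _ => abs_nonneg _) (Finset.mem_range.2 hlt)
    rw [div_le_iff₀ hε] at hn
    linarith
  · obtain ⟨h2, h3⟩ := hN₀ _ hge
    have hs' := pow_pos (devScale_pos ρ h3) k
    rw [Real.dist_eq, sub_zero, abs_div, abs_of_pos hs', div_lt_iff₀ hs'] at h2
    refine h2.le.trans (mul_le_mul_of_nonneg_left ?_ hε.le)
    exact pow_le_pow_left₀ (devScale_nonneg _ _)
      (devScale_mono h.param.one_lt (rootCount_le r a)) k

/-- The variance constant is the fixed point of the recurrence for the variances. -/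
theorem IsParam.varConst_mul (h : IsParam M p ρ) :
    varConst M p ρ * (1 - M * ∑ j, p j ^ (2 * ρ - 1)) = M * ∑ j, p j ^ (2 * ρ - 1) - 1 / M := by
  have h1 := h.sum_rpow_lt_one (θ := 2 * ρ - 1) (by linarith [h.one_lt])
  have hM : (M : ℝ) ≠ 0 := by exact_mod_cast h.pos_M.ne'
  have h2 : (1 - M * ∑ j, p j ^ (2 * ρ - 1) : ℝ) ≠ 0 := by linarith
  rw [varConst, realP]
  field_simp
  ring

theorem IsTrie.varConst_nonneg (h : IsTrie p ρ μ X) : 0 ≤ varConst M p ρ := by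
  have h1 := h.param.sum_rpow_lt_one (θ := 2 * ρ - 1) (by linarith [h.param.one_lt])
  have h2 : 0 ≤ ∫ ω, linearToll p ρ (fun i => X 0 ([], i) ω) ^ 2 ∂μ :=
    integral_nonneg fun ω => sq_nonneg _
  rw [h.model.integral_linearToll_sq h.param, ← h.param.varConst_mul] at h2
  exact nonneg_of_mul_nonneg_left h2 (by linarith)

end MomentInduction

/-! ### Asymptotic normality of the central moments -/

section CentralMoments

variable {M A : ℕ} {p : Fin A → ℝ} {ρ : ℝ} {Ω : Type*} [MeasurableSpace Ω] {μ : Measure Ω}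
  [IsProbabilityMeasure μ] {X : ℕ → Edge M → Ω → Fin A}

theorem gaussMoment_div_sq (k : ℕ) (V s : ℝ) :
    gaussMoment k (V / s ^ 2) = gaussMoment k V / s ^ k := by
  have := gaussMoment_sq_mul k s⁻¹ V
  rw [inv_pow, inv_pow] at this
  rw [div_eq_inv_mul, this, div_eq_inv_mul]

theorem integral_sum_insert_pow {ι : Type*} [DecidableEq ι] {Y : ι → Ω → ℝ}
    (hY : ∀ i, Measurable (Y i)) (hind : iIndepFun Y μ) (hL : ∀ i (k : ℕ), MemLp (Y i) k μ)
    {s : Finset ι} {i : ι} (hi : i ∉ s) (k : ℕ) :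
    ∫ ω, (∑ a ∈ insert i s, Y a ω) ^ k ∂μ = ∑ j ∈ Finset.range (k + 1),
      (k.choose j : ℝ) * (∫ ω, Y i ω ^ j ∂μ) * ∫ ω, (∑ a ∈ s, Y a ω) ^ (k - j) ∂μ := by
  have h1 : IndepFun (Y i) (fun ω => ∑ a ∈ s, Y a ω) μ := by
    have := (hind.indepFun_finsetSum_of_notMem hY hi).symm
    have e : (∑ a ∈ s, Y a) = fun ω => ∑ a ∈ s, Y a ω := by
      funext ω
      simp
    rwa [e] at this
  have h2 : ∀ l : ℕ, MemLp (fun ω => ∑ a ∈ s, Y a ω) l μ := fun l =>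
    memLp_finsetSum s fun a _ => hL a l
  simp_rw [Finset.sum_insert hi]
  exact integral_add_pow h1 (hL i) h2 k

theorem integral_add_const_pow {Y : Ω → ℝ} (hL : ∀ k : ℕ, MemLp Y k μ) (t : ℝ) (m : ℕ) :
    ∫ ω, (Y ω + t) ^ m ∂μ = ∑ j ∈ Finset.range (m + 1),
      (m.choose j : ℝ) * ((∫ ω, Y ω ^ j ∂μ) * t ^ (m - j)) := by
  simp_rw [add_pow]
  rw [integral_finsetSum _ fun j _ =>
    ((integrable_pow_of_memLp (hL j)).mul_const _).mul_const _]
  refine Finset.sum_congr rfl fun j _ => ?_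
  rw [integral_mul_const, integral_mul_const]
  ring

/-- All lower moments and the toll are replaced by Gaussian limits, while the errors of order `m` in
the subtries are kept as they are. This leaves the trie recurrence for the error itself, with a toll
that `IsTrie.transfer` can handle. -/
theorem IsTrie.tendsto_momentError_of_lt (h : IsTrie p ρ μ X) {m : ℕ} (hm : 2 ≤ m)
    (ih : ∀ k < m, Tendsto (fun n => momentError μ X (varConst M p ρ) k n / devScale ρ n ^ k)
      atTop (𝓝 0)) :
    Tendsto (fun n => momentError μ X (varConst M p ρ) m n / devScale ρ n ^ m) atTop (𝓝 0) := by
  set c := varConst M p ρ with hc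
  have hc0 : 0 ≤ c := h.varConst_nonneg
  set q : ℝ := M * ∑ j, p j ^ (2 * ρ - 1) with hq
  have hq0 : 0 ≤ q := mul_nonneg (Nat.cast_nonneg _)
    (Finset.sum_nonneg fun j _ => Real.rpow_nonneg (h.param.pos j).1.le _)
  set s2 : ℝ := ∫ ω, linearToll p ρ (fun i => X 0 ([], i) ω) ^ 2 ∂μ with hs2
  have hs20 : 0 ≤ s2 := integral_nonneg fun ω => sq_nonneg _
  -- Total variance: `q * c` is inherited from the subtries and `s2` is contributed by the root
  -- labels.
  have hfix : q * c + s2 = c := by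
    have h1 := h.param.varConst_mul
    rw [hs2, h.model.integral_linearToll_sq h.param]
    rw [← hc, ← hq] at h1
    rw [← hq]
    linarith
  have hm0 : m ≠ 0 := by omega
  choose Y hYm hYi hYL hYmom hrec using fun n =>
    h.model.exists_centered h.param.pos h.nonexplosive n
  set e : Fin M × Fin A → ℕ → RootFun M A := fun a k n r =>
    centralMoment (size X (rootCount r a)) k μ / devScale ρ n ^ k with he
  set Q : Finset (Fin M × Fin A) → ℕ → RootFun M A := fun s k n r =>
    (∫ ω, (∑ a ∈ s, Y n r a ω) ^ k ∂μ) / devScale ρ n ^ k with hQ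
  set v : Fin M × Fin A → RootFun M A := fun a n r =>
    limVar μ X c (rootCount r a) / devScale ρ n ^ 2 with hv
  set x : Fin M × Fin A → RootFun M A := fun a n r =>
    momentError μ X c m (rootCount r a) / devScale ρ n ^ m with hx
  have hu := h.lpBounded_scaledIncr
  have hw : LpBounded μ X fun n _ => c * scaledIncr μ X ρ n ^ 2 :=
    h.model.lpBounded_const_mul c (h.model.lpBounded_pow hu 2)
  have hvb : ∀ a, LpBounded μ X (v a) := fun a =>
    h.model.lpBounded_of_lpEquiv (h.lpEquiv_limVar c a) (h.model.lpBounded_const_mul _ hw)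
  have hdecomp : ∀ a k, e a k = (fun n r => gaussMoment k (v a n r)) +
      fun n r => momentError μ X c k (rootCount r a) / devScale ρ n ^ k := by
    intro a k
    funext n r
    simp only [he, hv, momentError, Pi.add_apply, gaussMoment_div_sq, sub_div]
    ring
  have hsum := h.lpEquiv_moment_sum hm0 (e := e) (Q := Q) (v := v) (x := x)
    (fun a => by
      funext n r
      simp [he, centralMoment])
    (fun s => by
      funext n r
      simp [hQ])
    (fun k hk => by
      funext n r
      simp [hQ, hk])
    (fun s a ha k => by
      funext n r
      simp only [hQ, he, Finset.sum_apply]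
      rw [integral_sum_insert_pow (hYm n r) (hYi n r) (hYL n r) ha, Finset.sum_div]
      refine Finset.sum_congr rfl fun j hj => ?_
      rw [hYmom, div_mul_div_comm, ← pow_add,
        Nat.add_sub_cancel' (Nat.lt_succ_iff.1 (Finset.mem_range.1 hj))]
      ring)
    (fun a n r => div_nonneg (limVar_nonneg hc0 _) (sq_nonneg _)) hvb
    (fun a k hk => by
      rw [LpEquiv, hdecomp, add_sub_cancel_left]
      rcases Nat.eq_zero_or_pos k with rfl | hk0
      · have e0 : (fun n (r : Fin n → Fin M → Fin A) =>
            momentError μ X c 0 (rootCount r a) / devScale ρ n ^ 0) = fun _ _ => 0 := by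
          funext n r
          simp [momentError, centralMoment, gaussMoment_zero]
        rw [e0]
        exact lpNull_zero
      · exact h.lpNull_momentError hk0.ne' (ih k hk) a)
    (fun a => hdecomp a m) Finset.univ
  have hvsum : LpEquiv μ X (fun n r => ∑ a, v a n r)
      fun n _ => scaledIncr μ X ρ n ^ 2 * (q * c) := by
    have h1 := h.model.lpEquiv_sum (s := Finset.univ) fun a _ => h.lpEquiv_limVar c a
    have e1 : (fun n (r : Fin n → Fin M → Fin A) => ∑ a, v a n r) =
        ∑ a, fun n r => limVar μ X c (rootCount r a) / devScale ρ n ^ 2 := by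
      funext n r
      simp [hv]
    have e2 : (fun n (_ : Fin n → Fin M → Fin A) => scaledIncr μ X ρ n ^ 2 * (q * c)) =
        ∑ a : Fin M × Fin A, fun n _ => p a.2 ^ (2 * ρ - 1) * (c * scaledIncr μ X ρ n ^ 2) := by
      funext n r
      simp only [Finset.sum_apply]
      rw [← Finset.sum_mul, sum_prod_snd fun j => p j ^ (2 * ρ - 1), ← hq]
      ring
    rw [e1, e2]
    exact h1
  have hwb : LpBounded μ X fun n _ => scaledIncr μ X ρ n ^ 2 * (q * c) :=
    h.model.lpBounded_mul (h.model.lpBounded_pow hu 2) (lpBounded_const μ X (q * c))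
  set g : ℕ → RootFun M A := fun k n _ => gaussMoment k (scaledIncr μ X ρ n ^ 2 * (q * c)) with hg
  have hgb : ∀ k, LpBounded μ X (g k) := fun k => h.lpBounded_gaussMoment hwb k
  have hQlt : ∀ k < m, LpEquiv μ X (Q Finset.univ k) (g k) := fun k hk =>
    h.model.lpEquiv_trans (hsum.1 k hk) (h.lpEquiv_gaussMoment hvsum hwb k)
  have hQm : LpEquiv μ X (Q Finset.univ m) (g m + ∑ a, x a) :=
    h.model.lpEquiv_trans hsum.2 (h.model.lpEquiv_add (h.lpEquiv_gaussMoment hvsum hwb m)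
      (LpEquiv.refl _ _ _))
  set t : RootFun M A := fun n r => toll μ X r / devScale ρ n with ht
  set z : RootFun M A := scaledRootSum (linearToll p ρ) with hz
  have hzb : LpBounded μ X z := h.model.lpBounded_scaledRootSum (h.model.integral_linearToll h.param)
  set uz : RootFun M A := fun n r => scaledIncr μ X ρ n * z n r with huz
  have huzb : LpBounded μ X uz := h.model.lpBounded_mul hu hzb
  have htz : LpEquiv μ X t uz := h.lpEquiv_toll
  have hall : LpEquiv μ X
      (∑ j ∈ Finset.range (m + 1), fun n r => (m.choose j : ℝ) * (Q Finset.univ j * t ^ (m - j)) n r)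
      ((∑ j ∈ Finset.range (m + 1), fun n r => (m.choose j : ℝ) * (g j * uz ^ (m - j)) n r) +
        ∑ a, x a) := by
    -- The unknown errors are attached to the term `j = m`, the only one in which the toll does not
    -- appear and the moment of the sum has full order.
    have e1 : ∑ a, x a = ∑ j ∈ Finset.range (m + 1), if j = m then ∑ a, x a else 0 := by
      rw [Finset.sum_ite_eq', if_pos (by simp)]
    rw [e1, ← Finset.sum_add_distrib]
    refine h.model.lpEquiv_sum fun j hj => ?_
    rcases eq_or_ne j m with rfl | hjm
    · rw [if_pos rfl]
      simp only [Nat.choose_self, Nat.cast_one, one_mul, Nat.sub_self, pow_zero, mul_one]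
      exact hQm
    · rw [if_neg hjm, add_zero]
      have := Finset.mem_range.1 hj
      exact h.model.lpEquiv_const_mul _ (h.model.lpEquiv_mul (hQlt j (by omega))
        (h.model.lpEquiv_pow htz huzb _) (hgb j) (h.model.lpBounded_pow huzb _))
  have hleft : ∀ n, 2 ≤ n → rootMean μ X (∑ j ∈ Finset.range (m + 1), fun n r =>
      (m.choose j : ℝ) * (Q Finset.univ j * t ^ (m - j)) n r) n =
      centralMoment (size X n) m μ / devScale ρ n ^ m := by
    intro n hn
    rw [hrec n hn m, Finset.sum_div, rootMean, ← h.model.sum_rootLabels]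
    refine Finset.sum_congr rfl fun r _ => ?_
    rw [integral_add_const_pow (fun k => memLp_finsetSum Finset.univ fun a _ => hYL n r a k),
      mul_div_assoc, Finset.sum_div]
    congr 1
    simp only [Finset.sum_apply, Pi.mul_apply, Pi.pow_apply, hQ, ht]
    refine Finset.sum_congr rfl fun j hj => ?_
    rw [div_pow, div_mul_div_comm, ← pow_add,
      Nat.add_sub_cancel' (Nat.lt_succ_iff.1 (Finset.mem_range.1 hj))]
    ring
  have hright : ∀ n, rootMean μ X (∑ j ∈ Finset.range (m + 1), fun n r =>
      (m.choose j : ℝ) * (g j * uz ^ (m - j)) n r) n = scaledIncr μ X ρ n ^ m *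
      ∑ j ∈ Finset.range (m + 1), (m.choose j : ℝ) * gaussMoment j (q * c) *
        rootMean μ X (z ^ (m - j)) n := by
    intro n
    have e1 : (∑ j ∈ Finset.range (m + 1), fun n (r : Fin n → Fin M → Fin A) =>
        (m.choose j : ℝ) * (g j * uz ^ (m - j)) n r) = fun n r => ∑ j ∈ Finset.range (m + 1),
        (fun n (r : Fin n → Fin M → Fin A) => (scaledIncr μ X ρ n ^ m * (m.choose j *
          gaussMoment j (q * c))) * (z ^ (m - j)) n r) n r := by
      funext n r
      simp only [Finset.sum_apply]
      refine Finset.sum_congr rfl fun j hj => ?_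
      have e2 : scaledIncr μ X ρ n ^ m = scaledIncr μ X ρ n ^ j * scaledIncr μ X ρ n ^ (m - j) := by
        rw [← pow_add, Nat.add_sub_cancel' (Nat.lt_succ_iff.1 (Finset.mem_range.1 hj))]
      simp only [Pi.mul_apply, Pi.pow_apply, hg, huz, gaussMoment_sq_mul, mul_pow, e2]
      ring
    rw [e1, h.model.rootMean_sum, Finset.mul_sum]
    refine Finset.sum_congr rfl fun j _ => ?_
    rw [rootMean_mul μ X fun n => scaledIncr μ X ρ n ^ m * (m.choose j * gaussMoment j (q * c))]
    ring
  -- The binomial sum combines normal moments with variances `q * c` and `s2` into those with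
  -- variance `c`, so the ansatz reproduces itself.
  have hlim : Tendsto (fun n => ∑ j ∈ Finset.range (m + 1), (m.choose j : ℝ) *
      gaussMoment j (q * c) * rootMean μ X (z ^ (m - j)) n) atTop (𝓝 (gaussMoment m c)) := by
    conv => rhs; rw [← hfix, gaussMoment_add (mul_nonneg hq0 hc0) hs20]
    refine tendsto_finsetSum _ fun j _ => ?_
    exact (h.model.tendsto_rootMean_scaledRootSum
      (h.model.integral_linearToll h.param) (m - j)).const_mul _
  have hfin : Tendsto (fun n => scaledIncr μ X ρ n ^ m *
      (∑ j ∈ Finset.range (m + 1), (m.choose j : ℝ) * gaussMoment j (q * c) *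
        rootMean μ X (z ^ (m - j)) n - gaussMoment m c)) atTop (𝓝 0) := by
    obtain ⟨C, hC0, hC⟩ := h.abs_scaledIncr_le
    have h1 := (hlim.sub_const (gaussMoment m c)).norm.const_mul (C ^ m)
    rw [sub_self, norm_zero, mul_zero] at h1
    refine squeeze_zero_norm (fun n => ?_) h1
    rw [norm_mul, norm_pow]
    exact mul_le_mul_of_nonneg_right (pow_le_pow_left₀ (norm_nonneg _) (hC n) m) (norm_nonneg _)
  -- Here `θ ≥ 2 * ρ - 1 > ρ`, which uses both `m ≥ 2` and `ρ > 1`; for `m = 1` the transfer would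
  -- not contract.
  set θ : ℝ := m * (ρ - 1 / 2) with hθ
  have hρθ : ρ < θ := by
    have h2 : (2 : ℝ) ≤ m := by exact_mod_cast hm
    have := h.param.one_lt
    nlinarith
  have hx0 : momentError μ X c m 0 = 0 := by
    simp [momentError, limVar, gaussMoment_of_zero hm0, centralMoment, size_of_lt_two, hm0]
  have hdiff := (h.model.tendsto_rootMean_sub hall).add hfin
  rw [add_zero] at hdiff
  have htrans := h.transfer hρθ hx0 (hdiff.congr' ?_)
  · refine htrans.congr' ?_
    filter_upwards [eventually_ge_atTop 1] with n hn
    rw [devScale_pow hn]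
  · filter_upwards [eventually_ge_atTop 2] with n hn
    have hs : devScale ρ n ≠ 0 := (devScale_pos ρ (by omega)).ne'
    have e1 : gaussMoment m (limVar μ X c n) / devScale ρ n ^ m =
        scaledIncr μ X ρ n ^ m * gaussMoment m c := by
      rw [limVar_eq (ρ := ρ), gaussMoment_sq_mul, mul_comm c, gaussMoment_sq_mul]
      field_simp
    have e2 : rootMean μ X (∑ a, x a) n =
        rootMean μ X (fun _ r => ∑ a, momentError μ X c m (rootCount r a)) n /
          devScale ρ n ^ m := by
      rw [rootMean, rootMean, ← integral_div]
      congr 1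
      funext ω
      simp only [Finset.sum_apply, hx, Finset.sum_div]
    have e3 : rootMean μ X ((∑ j ∈ Finset.range (m + 1), fun n r =>
        (m.choose j : ℝ) * (g j * uz ^ (m - j)) n r) + ∑ a, x a) n =
        rootMean μ X (∑ j ∈ Finset.range (m + 1), fun n r =>
        (m.choose j : ℝ) * (g j * uz ^ (m - j)) n r) n + rootMean μ X (∑ a, x a) n :=
      h.model.rootMean_add _ _ n
    rw [hleft n hn, e3, hright, e2, ← devScale_pow (by omega), sub_div, momentError, sub_div, e1]
    ring

/-- The central moments of the size are asymptotically those of a normal distribution. -/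
theorem IsTrie.tendsto_momentError (h : IsTrie p ρ μ X) (m : ℕ) :
    Tendsto (fun n => momentError μ X (varConst M p ρ) m n / devScale ρ n ^ m) atTop (𝓝 0) := by
  induction m using Nat.strong_induction_on with
  | _ m ih =>
  rcases lt_or_ge m 2 with hm | hm
  · have e : (fun n => momentError μ X (varConst M p ρ) m n / devScale ρ n ^ m) = fun _ => 0 := by
      funext n
      interval_cases m
      · simp [momentError, centralMoment, gaussMoment_zero]
      · have h1 : Integrable (size X n) μ :=
          (h.model.memLp_size h.param.pos h.nonexplosive n 1).integrable (by simp)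
        simp [momentError, centralMoment_one, gaussMoment_one]
    rw [e]
    exact tendsto_const_nhds
  · exact h.tendsto_momentError_of_lt hm ih

end CentralMoments

/-! ### Positivity of the constant and conclusion -/

section MainTheorem

variable {M A : ℕ} {p : Fin A → ℝ} {ρ : ℝ} {Ω : Type*} [MeasurableSpace Ω] {μ : Measure Ω}
  [IsProbabilityMeasure μ] {X : ℕ → Edge M → Ω → Fin A}

/-- Up to positive factors the constant is the variance of `p j ^ (ρ - 1)` for a letter `j` with law
`p`. It could vanish only if all `p j` were equal, and then each would be `1 / A`. -/
theorem IsParam.varConst_pos (h : IsParam M p ρ) (hsum : ∑ j, p j = 1)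
    (hnonunif : ¬ ∀ j, p j = 1 / (A : ℝ)) : 0 < varConst M p ρ := by
  have h1 := h.sum_rpow_lt_one (θ := 2 * ρ - 1) (by linarith [h.one_lt])
  have hM : (0 : ℝ) < M := by exact_mod_cast h.pos_M
  have hρ : 0 < ρ - 1 := by linarith [h.one_lt]
  obtain ⟨j₀, hj₀⟩ : ∃ j, p j ^ (ρ - 1) ≠ 1 / M := by
    by_contra! hall
    refine hnonunif fun j => ?_
    have heq : ∀ i, p i = p j := fun i =>
      (Real.rpow_left_inj (h.pos i).1.le (h.pos j).1.le hρ.ne').1 ((hall i).trans (hall j).symm)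
    simp only [heq, Finset.sum_const, Finset.card_univ, Fintype.card_fin, nsmul_eq_mul] at hsum
    have hA : (A : ℝ) ≠ 0 := by exact_mod_cast h.pos_A.ne'
    rw [eq_div_iff hA, mul_comm]
    exact hsum
  have h2 : 0 < ∑ j, p j * (p j ^ (ρ - 1) - 1 / M) ^ 2 :=
    Finset.sum_pos' (fun j _ => mul_nonneg (h.pos j).1.le (sq_nonneg _))
      ⟨j₀, Finset.mem_univ _, mul_pos (h.pos j₀).1 (by
        have := sub_ne_zero.2 hj₀
        positivity)⟩
  have h3 : ∑ j, p j * (p j ^ (ρ - 1) - 1 / M) ^ 2 = ∑ j, p j ^ (2 * ρ - 1) - (1 / M) ^ 2 := by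
    have e : ∀ j, p j * (p j ^ (ρ - 1) - 1 / M) ^ 2 =
        p j ^ (2 * ρ - 1) - 2 / M * (p j * p j ^ (ρ - 1)) + (1 / M) ^ 2 * p j := by
      intro j
      have hp0 := (h.pos j).1
      have e : p j ^ (2 * ρ - 1) = (p j ^ (ρ - 1)) ^ 2 * p j := by
        rw [← Real.rpow_natCast, ← Real.rpow_mul hp0.le, ← Real.rpow_add_one hp0.ne']
        congr 1
        push_cast
        ring
      rw [e]
      ring
    simp only [e]
    rw [Finset.sum_add_distrib, Finset.sum_sub_distrib, ← Finset.mul_sum, ← Finset.mul_sum,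
      h.sum_mul_rpow, hsum]
    ring
  rw [h3] at h2
  have h4 : 0 < varConst M p ρ * (1 - M * ∑ j, p j ^ (2 * ρ - 1)) := by
    rw [h.varConst_mul]
    have := mul_pos hM h2
    have e : (M : ℝ) * (∑ j, p j ^ (2 * ρ - 1) - (1 / M) ^ 2) =
      M * ∑ j, p j ^ (2 * ρ - 1) - 1 / M := by field_simp
    rwa [e] at this
  exact (pos_iff_pos_of_mul_pos h4).2 (by linarith)

/-- For odd `m` the integer and the real exponent differ, but the normal moment is zero. -/
theorem gaussMoment_eq_rpow (c : ℝ) (m : ℕ) :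
    gaussMoment m c = normalMoment m * c ^ ((m : ℝ) / 2) := by
  rcases Nat.even_or_odd m with ⟨l, rfl⟩ | hm
  · have e : (((l + l : ℕ) : ℝ) / 2) = l := by push_cast; ring
    rw [gaussMoment, e, Real.rpow_natCast, show (l + l) / 2 = l by omega]
  · simp [gaussMoment, normalMoment_of_odd hm]

theorem IsTrie.isLittleO_centralMoment (h : IsTrie p ρ μ X) (hc : 0 < varConst M p ρ) (m : ℕ) :
    (fun n : ℕ => ((centralMoment (size X n) m μ : ℝ) : ℂ) -
      (normalMoment m : ℂ) * momentScale M p ρ m n) =o[atTop] fun n : ℕ => momentScale M p ρ m n := by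
  obtain ⟨-, d, hd, hdlim⟩ := h.param.exists_meanDeriv
  set c := varConst M p ρ with hcdef
  set u := scaledIncr μ X ρ with hu
  have hud : Tendsto (fun n => u n - d n) atTop (𝓝 0) := by
    have := h.tendsto_scaledIncr_sub.add hdlim
    rw [add_zero] at this
    exact this.congr fun n => by ring
  obtain ⟨κ, hκ0, hκ⟩ := h.le_scaledIncr
  obtain ⟨C, hC0, hC⟩ := h.abs_scaledIncr_le
  -- An error that is small compared with `devScale ρ n ^ m` is small compared with `momentScale`
  -- only if the oscillating factor `d n` stays away from zero. This is the use of the lower bound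
  -- on the renewal solution.
  have hdlow : ∀ᶠ n in atTop, κ / 2 ≤ d n := by
    filter_upwards [hκ, hud.eventually_le_const (half_pos hκ0)] with n h1 h2
    linarith
  have hpow : Tendsto (fun n => u n ^ m - d n ^ m) atTop (𝓝 0) := by
    have h1 := (hud.norm.mul_const (m * (C + 1) ^ (m - 1)))
    rw [norm_zero, zero_mul] at h1
    refine squeeze_zero_norm' ?_ h1
    have h2 := hud.norm
    rw [norm_zero] at h2
    filter_upwards [h2.eventually_le_const one_pos] with n hn
    refine (abs_pow_sub_pow_le (u n) (d n) m).trans ?_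
    rw [mul_assoc]
    refine mul_le_mul_of_nonneg_left (mul_le_mul_of_nonneg_left ?_ (Nat.cast_nonneg m))
      (abs_nonneg _)
    refine pow_le_pow_left₀ (le_max_of_le_left (abs_nonneg _)) (max_le ?_ ?_) _
    · linarith [hC n]
    · have h3 := abs_sub_abs_le_abs_sub (d n) (u n)
      rw [abs_sub_comm] at h3
      rw [Real.norm_eq_abs] at hn
      linarith [hC n]
  set b : ℕ → ℝ := fun n => momentError μ X c m n / devScale ρ n ^ m +
    gaussMoment m c * (u n ^ m - d n ^ m) with hb
  have hb0 : Tendsto b atTop (𝓝 0) := by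
    simpa using (h.tendsto_momentError m).add (hpow.const_mul (gaussMoment m c))
  have hscale : ∀ n : ℕ, 1 ≤ n → momentScale M p ρ m n =
      ((c ^ ((m : ℝ) / 2) * d n ^ m * devScale ρ n ^ m : ℝ) : ℂ) := by
    intro n hn
    have e : devScale ρ n ^ m = ((n : ℝ) ^ (ρ - 1)) ^ m * (n : ℝ) ^ ((m : ℝ) / 2) := by
      rw [devScale, mul_pow, Real.sqrt_eq_rpow, ← Real.rpow_mul_natCast (Nat.cast_nonneg n) (1 / 2),
        one_div_mul_eq_div]
    rw [momentScale, hd n hn, e, ← hcdef]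
    push_cast
    ring
  rw [isLittleO_iff]
  intro ε hε
  have hcp : 0 < c ^ ((m : ℝ) / 2) := Real.rpow_pos_of_pos hc _
  have hb1 := hb0.norm
  rw [norm_zero] at hb1
  filter_upwards [hb1.eventually_le_const (show 0 < ε * (c ^ ((m : ℝ) / 2) * (κ / 2) ^ m) by
    positivity), hdlow, eventually_ge_atTop 1] with n hn hdn hn1
  have hs := pow_pos (devScale_pos ρ hn1) m
  have e1 : ((centralMoment (size X n) m μ : ℝ) : ℂ) - (normalMoment m : ℂ) * momentScale M p ρ m n =
      ((devScale ρ n ^ m * b n : ℝ) : ℂ) := by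
    rw [hscale n hn1, ← Complex.ofReal_mul, ← Complex.ofReal_sub]
    congr 1
    have e2 : gaussMoment m (limVar μ X c n) = devScale ρ n ^ m * (u n ^ m * gaussMoment m c) := by
      rw [limVar_eq (ρ := ρ), gaussMoment_sq_mul, mul_comm c, gaussMoment_sq_mul]
    have e3 : centralMoment (size X n) m μ = momentError μ X c m n +
        devScale ρ n ^ m * (u n ^ m * gaussMoment m c) := by
      rw [momentError, e2, sub_add_cancel]
    rw [e3, hb, gaussMoment_eq_rpow]
    field_simp
    ring
  rw [e1, hscale n hn1, Complex.norm_real, Complex.norm_real, norm_mul, norm_mul, norm_mul,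
    Real.norm_of_nonneg hcp.le, Real.norm_of_nonneg hs.le, norm_pow]
  have h5 : (κ / 2) ^ m ≤ ‖d n‖ ^ m :=
    pow_le_pow_left₀ (by positivity) (hdn.trans (le_abs_self _)) m
  calc devScale ρ n ^ m * ‖b n‖ ≤ devScale ρ n ^ m * (ε * (c ^ ((m : ℝ) / 2) * (κ / 2) ^ m)) :=
        mul_le_mul_of_nonneg_left hn hs.le
    _ ≤ devScale ρ n ^ m * (ε * (c ^ ((m : ℝ) / 2) * ‖d n‖ ^ m)) :=
        mul_le_mul_of_nonneg_left (mul_le_mul_of_nonneg_left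
          (mul_le_mul_of_nonneg_left h5 hcp.le) hε.le) hs.le
    _ = ε * (c ^ ((m : ℝ) / 2) * ‖d n‖ ^ m * devScale ρ n ^ m) := by ring

end MainTheorem

end GTrie

theorem proposition6
    (M A : ℕ) (hM : 1 ≤ M)
    -- the letter probabilities
    (p : Fin A → ℝ) (hp : ∀ j, 0 < p j ∧ p j < 1) (hsum : ∑ j, p j = 1)
    -- the non-explosive case
    (hexp : ∑ j, p j ^ 2 < 1 / (M : ℝ))
    -- the root `ρ`, and the case that is considered
    (ρ : ℝ) (hρ : ∑ j, p j ^ ρ = 1 / (M : ℝ)) (hρ1 : 1 < ρ)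
    (hnonunif : ¬ ∀ j, p j = 1 / (A : ℝ))
    -- the random labelings: all labels are independent and have the law `p`
    {Ω : Type*} [MeasurableSpace Ω] (μ : Measure Ω) [IsProbabilityMeasure μ]
    (X : ℕ → GTrie.Edge M → Ω → Fin A) (hX : ∀ k e, Measurable (X k e))
    (hindep : iIndepFun (fun q : ℕ × GTrie.Edge M => X q.1 q.2) μ)
    (hlaw : ∀ k e j, μ (X k e ⁻¹' {j}) = ENNReal.ofReal (p j)) :
    -- the size is almost surely finite and has finite moments
    (∀ n, ∀ᵐ ω ∂μ, (GTrie.randomNodes X n ω).Finite) ∧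
    (∀ n m : ℕ, Integrable (fun ω => GTrie.size X n ω ^ m) μ) ∧
    -- the quantities on the right-hand side are meaningful
    0 < GTrie.varConst M p ρ ∧
    (∀ n : ℕ, 1 ≤ n →
      Summable (fun β : GTrie.zeros M p ρ => ‖GTrie.meanDerivTerm M p n (β : ℂ)‖)) ∧
    -- `a_n ∼ g b_n` in the sense `a_n = g b_n + o(b_n)`
    ∀ m : ℕ,
      (fun n : ℕ => ((centralMoment (GTrie.size X n) m μ : ℝ) : ℂ)
          - (GTrie.normalMoment m : ℂ) * GTrie.momentScale M p ρ m n)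
        =o[atTop] (fun n : ℕ => GTrie.momentScale M p ρ m n) := by
  have hM0 : (0 : ℝ) < M := by exact_mod_cast hM
  have hexp' : (M : ℝ) * ∑ j, p j ^ 2 < 1 := by
    rw [lt_div_iff₀ hM0] at hexp
    linarith
  -- The sum of `p j ^ x` decreases in `x`, and the non-explosive condition says that at `x = 2` it
  -- is already below `1 / M`.
  have hρ2 : ρ < 2 := by
    by_contra! h2
    have h3 : ∑ j, p j ^ ρ ≤ ∑ j, p j ^ 2 := Finset.sum_le_sum fun j _ => by
      rw [← Real.rpow_natCast]
      exact Real.rpow_le_rpow_of_exponent_ge (hp j).1 (hp j).2.le (by exact_mod_cast h2)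
    linarith
  have hparam : GTrie.IsParam M p ρ := ⟨hp, by rw [hρ]; field_simp, hρ1, hρ2⟩
  have hmodel : GTrie.IsModel p μ X := ⟨hX, hindep, hlaw⟩
  have htrie : GTrie.IsTrie p ρ μ X := ⟨hmodel, hparam, hexp'⟩
  have hc := hparam.varConst_pos hsum hnonunif
  refine ⟨fun n => ?_, fun n m => GTrie.integrable_pow_of_memLp (hmodel.memLp_size hp hexp' n m),
    hc, hparam.exists_meanDeriv.1, htrie.isLittleO_centralMoment hc⟩
  filter_upwards [hmodel.ae_rsize_ne_top hp hexp' n] with ω hω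
  exact GTrie.finite_of_esize_ne_top _ hω

end
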